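/- Let $L$ be a densely defined, nonnegative, unbounded, self-adjoint operator on a complex Hilbert space $h$ with discrete spectrum off its kernel, i.e. the operator $L^{-1}$ (defined as $0$ on $\ker L$ and as the inverse of $L$ on $(\ker L)^\perp$) is compact on $h$. Let $N_L(x)=\mathrm{Tr}(E^L((0,x]))$ be the number of eigenvalues of $L$ in $(0,x]$ counted with multiplicity, and let $\rho(L)=N_L(L)^{-1}$ be the spectral weight: it is $0$ on $\ker L$ and acts as $N_L(\lambda)^{-1}$ on the eigenspace of each eigenvalue $\lambda>0$. Let $\mathcal A_L$ be the Lipschitz algebra of $L$, i.e. the set of all $a\in B(h)$ which map the domain of $L$ into itself and for which $[a,L]$ is bounded, and let $A$ be its norm closure. Suppose that $N_L(x)\sim\varphi(x)$ as $x\to+\infty$ for some continuous, nondecreasing function $\varphi:[0,\infty)\to[0,\infty)$ which is locally Lipschitz on $(0,\infty)$ (i.e. its weak derivative satisfies $\varphi'\in L^\infty_{\rm loc}$) and satisfies $\operatorname{ess-limsup}_{x\to+\infty}\varphi'(x)/\varphi(x)=0$. Then: (1.a) For $s>1$, $\rho(L)^s$ is trace class, and $\lim_{s\downarrow1}(s-1)\,\mathrm{Tr}(\rho(L)^s)=1$.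 (1.b) For $a\in\mathcal A_L$, $[a,\rho(L)^s]$ is trace class for $s>1$, and $\lim_{s\downarrow1}(s-1)\,\mathrm{Tr}(|[a,\rho(L)^s]|)=0$. (1.c) For $b\in B(h)$ and $s>1$, $b\,\rho(L)^s$ is trace class; for $a\in\mathcal A_L$ and $b\in B(h)$, $\lim_{s\downarrow1}(s-1)\,\mathrm{Tr}((ab-ba)\rho(L)^s)=0$. (2) For $s>1$ the formula $\omega_s(b)=(s-1)\mathrm{Tr}(b\,\rho(L)^s)$, $b\in B(h)$, defines a bounded linear functional on $B(h)$. The set of weak-* limit points of $\omega_s$ as $s\downarrow1$ is not empty, and every such limit point $\tau$ is a state on $B(h)$ such that (2.a) $\tau$ vanishes on the compact operators; (2.b) $\tau$ is a hypertrace on $A$: $\tau(ba)=\tau(ab)$ for $a\in A$, $b\in B(h)$; (2.c) the restriction of $\tau$ to $A$ is a tracial state. (3) Let $\omega$ be any state on $L^\infty(0,\infty)$ such that, for all real $f\in L^\infty(0,\infty)$, $\operatorname{ess-liminf}_{t\to+\infty}f(t)\le\omega(f)\le\operatorname{ess-limsup}_{t\to+\infty}f(t)$, and such that $\omega$ takes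 the same value on $f$ as on $t\mapsto f(rt)$ and $t\mapsto f(t^r)$ for every $r>0$, and as on $t\mapsto\frac1{\log t}\int_1^tf(u)\frac{du}u$. Let $\mu_1(T)\ge\mu_2(T)\ge\cdots$ denote the singular numbers of a compact operator $T$, and let $\mathrm{Tr}_\omega$ be the associated Dixmier trace on the dual Macaev ideal $\mathcal L^{(1,\infty)}(h)=\{T \text{ compact}:\sup_{N\ge2}\frac1{\log N}\sum_{n=1}^N\mu_n(T)<\infty\}$, i.e. the linear extension of $\mathrm{Tr}_\omega(T)=\omega\bigl(t\mapsto\frac1{\log[t]}\sum_{n=1}^{[t]}\mu_n(T)\bigr)$, $T\ge0$, where $[t]$ is the integer part of $t$ and the function is taken to be $0$ for $t<2$. Then $T\rho(L)\in\mathcal L^{(1,\infty)}(h)$ for every $T\in B(h)$, and the volume form $\Omega_L(T)=\mathrm{Tr}_\omega(T\rho(L))$ is a state on $B(h)$ which is a hypertrace on $A$ and restricts to a tracial state on $A$. -/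

import Mathlib

open Filter Topology MeasureTheory Set
open scoped ENNReal InnerProductSpace

namespace VolumeTrace

variable {h : Type*} [NormedAddCommGroup h] [InnerProductSpace ℂ h]

/-! ### The operator `L` and its counting function -/

/-- The eigenspace of the (unbounded) operator `L` for the real number `x`, a subspace of `h`;
it is `{0}` if `x` is not an eigenvalue. -/
def eigenspace (L : h →ₗ.[ℂ] h) (x : ℝ) : Submodule ℂ h :=
  (LinearMap.ker (L.toFun - (x : ℂ) • L.domain.subtype)).map L.domain.subtype

/-- `L` is a densely defined, nonnegative, unbounded, self-adjoint operator with discrete spectrum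
off its kernel, i.e. `L⁻¹` is a compact operator, where `L⁻¹` is `0` on `ker L` and the inverse
of the restriction of `L` to `(ker L)ᗮ` on `(ker L)ᗮ`. -/
structure IsDiscreteOffKernel [CompleteSpace h] (L : h →ₗ.[ℂ] h) : Prop where
  dense : Dense (L.domain : Set h)
  selfAdjoint : IsSelfAdjoint L
  nonneg : ∀ x : L.domain, 0 ≤ (⟪(x : h), L x⟫_ℂ).re
  unbounded : ¬ ∃ C : ℝ, ∀ x : L.domain, ‖L x‖ ≤ C * ‖(x : h)‖
  compact_inverse : ∃ K : h →L[ℂ] h, IsCompactOperator K ∧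
    (∀ x ∈ eigenspace L 0, K x = 0) ∧
    ∀ x ∈ (eigenspace L 0)ᗮ, K x ∈ (eigenspace L 0)ᗮ ∧
      ∃ hx : K x ∈ L.domain, L ⟨K x, hx⟩ = x

/-- The eigenvalue counting function `N_L(x) = Tr E^L((0, x])`: the dimension of the span of the
eigenvectors with eigenvalue in `(0, x]`, i.e. the number of eigenvalues in `(0, x]` counted
with multiplicity. -/
noncomputable def counting (L : h →ₗ.[ℂ] h) (x : ℝ) : ℕ :=
  Module.finrank ℂ (⨆ y ∈ Ioc (0 : ℝ) x, eigenspace L y : Submodule ℂ h)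

/-- The spectral weight `ρ(L) = N_L(L)⁻¹`, with the convention that it vanishes on `ker L`:
the norm convergent sum over `y > 0` of `N_L(y)⁻¹` times the orthogonal projection onto the
eigenspace of `y` (the projection is zero unless `y` is an eigenvalue; eigenspaces of a closed
operator are closed, so the closure below changes nothing). -/
noncomputable def spectralWeight [CompleteSpace h] (L : h →ₗ.[ℂ] h) : h →L[ℂ] h :=
  ∑' y : Ioi (0 : ℝ), ((counting L y : ℂ)⁻¹) •
    (eigenspace L (y : ℝ)).topologicalClosure.starProjection

/-! ### The Lipschitz algebra -/

/-- The Lipschitz algebra of `L`: the bounded operators `a` which preserve the domain of `L` and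
for which `[a, L]`, defined on the domain of `L`, is bounded. -/
def lipschitzAlgebra [CompleteSpace h] (L : h →ₗ.[ℂ] h) (hL : IsSelfAdjoint L) :
    StarSubalgebra ℂ (h →L[ℂ] h) where
  carrier := {a | ∃ C : ℝ, ∀ x : L.domain, ∃ hx : a x ∈ L.domain,
    ‖a (L x) - L ⟨a x, hx⟩‖ ≤ C * ‖(x : h)‖}
  mul_mem' := by
    rintro a b ⟨C, hC⟩ ⟨D, hD⟩
    refine ⟨‖a‖ * D + |C| * ‖b‖, fun x => ?_⟩
    obtain ⟨hb, hb'⟩ := hD x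
    obtain ⟨ha, ha'⟩ := hC ⟨b x, hb⟩
    refine ⟨ha, ?_⟩
    have h1 : ‖a (b (L x) - L ⟨b x, hb⟩)‖ ≤ ‖a‖ * (D * ‖(x : h)‖) :=
      (a.le_opNorm _).trans (mul_le_mul_of_nonneg_left hb' (norm_nonneg _))
    have h2 : C * ‖b x‖ ≤ |C| * (‖b‖ * ‖(x : h)‖) :=
      mul_le_mul (le_abs_self C) (b.le_opNorm _) (norm_nonneg _) (abs_nonneg C)
    calc ‖(a * b) (L x) - L ⟨(a * b) x, ha⟩‖
        = ‖a (b (L x) - L ⟨b x, hb⟩) + (a (L ⟨b x, hb⟩) - L ⟨a (b x), ha⟩)‖ := by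
          rw [map_sub]; congr 1; simp
      _ ≤ ‖a‖ * (D * ‖(x : h)‖) + |C| * (‖b‖ * ‖(x : h)‖) :=
          (norm_add_le _ _).trans (add_le_add h1 (ha'.trans h2))
      _ = (‖a‖ * D + |C| * ‖b‖) * ‖(x : h)‖ := by ring
  add_mem' := by
    rintro a b ⟨C, hC⟩ ⟨D, hD⟩
    refine ⟨C + D, fun x => ?_⟩
    obtain ⟨ha, ha'⟩ := hC x
    obtain ⟨hb, hb'⟩ := hD x
    refine ⟨L.domain.add_mem ha hb, ?_⟩
    have h1 : L ⟨(a + b) x, L.domain.add_mem ha hb⟩ = L ⟨a x, ha⟩ + L ⟨b x, hb⟩ := by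
      rw [← L.map_add]; rfl
    calc ‖(a + b) (L x) - L ⟨(a + b) x, L.domain.add_mem ha hb⟩‖
        = ‖(a (L x) - L ⟨a x, ha⟩) + (b (L x) - L ⟨b x, hb⟩)‖ := by
          rw [h1, add_apply]; congr 1; abel
      _ ≤ (C + D) * ‖(x : h)‖ := by
          rw [add_mul]; exact (norm_add_le _ _).trans (add_le_add ha' hb')
  algebraMap_mem' := by
    intro r
    have h0 : ∀ x : L.domain, (algebraMap ℂ (h →L[ℂ] h) r) x ∈ L.domain := fun x => by
      simpa [Algebra.algebraMap_eq_smul_one] using L.domain.smul_mem r x.2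
    refine ⟨0, fun x => ⟨h0 x, ?_⟩⟩
    have h1 : ∀ hx : (algebraMap ℂ (h →L[ℂ] h) r) x ∈ L.domain,
        L ⟨(algebraMap ℂ (h →L[ℂ] h) r) x, hx⟩ = r • L x := by
      intro hx
      rw [← L.map_smul]
      congr 1
    rw [h1]
    simp [Algebra.algebraMap_eq_smul_one]
  star_mem' := by
    rintro a ⟨C, hC⟩
    have hd : Dense (L.domain : Set h) := hL.dense_domain
    have hA : LinearPMap.adjoint L = L := LinearPMap.isSelfAdjoint_def.1 hL
    have hsym : ∀ x y : L.domain, ⟪L x, (y : h)⟫_ℂ = ⟪(x : h), L y⟫_ℂ := by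
      have := LinearPMap.adjoint_isFormalAdjoint hd
      rw [hA] at this
      exact this
    have hdom : ∀ y : h, Continuous ((innerₛₗ ℂ y).comp L.toFun) → y ∈ L.domain := by
      intro y hy
      have := (LinearPMap.mem_adjoint_domain_iff (T := L) y).2 hy
      rwa [hA] at this
    have key : ∀ x y : L.domain, ∃ c : ℂ, ⟪star a (x : h), L y⟫_ℂ = c + ⟪star a (L x), (y : h)⟫_ℂ ∧
        ‖c‖ ≤ C * ‖(x : h)‖ * ‖(y : h)‖ := by
      intro x y
      obtain ⟨ha, ha'⟩ := hC y
      refine ⟨⟪(x : h), a (L y) - L ⟨a y, ha⟩⟫_ℂ, ?_, ?_⟩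
      · rw [ContinuousLinearMap.star_eq_adjoint, ContinuousLinearMap.adjoint_inner_left,
          ContinuousLinearMap.adjoint_inner_left, inner_sub_right, ← hsym x ⟨a y, ha⟩]
        simp
      · calc _ ≤ ‖(x : h)‖ * ‖a (L y) - L ⟨a y, ha⟩‖ := norm_inner_le_norm _ _
          _ ≤ ‖(x : h)‖ * (C * ‖(y : h)‖) := mul_le_mul_of_nonneg_left ha' (norm_nonneg _)
          _ = _ := by ring
    have hmem : ∀ x : L.domain, star a (x : h) ∈ L.domain := by
      intro x
      refine hdom _ (AddMonoidHomClass.continuous_of_bound _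
        (C * ‖(x : h)‖ + ‖star a (L x)‖) fun y => ?_)
      obtain ⟨c, hc, hc'⟩ := key x y
      change ‖⟪star a (x : h), L y⟫_ℂ‖ ≤ _
      rw [hc, add_mul]
      exact (norm_add_le _ _).trans (add_le_add hc' (norm_inner_le_norm _ _))
    refine ⟨C, fun x => ⟨hmem x, ?_⟩⟩
    set v : h := star a (L x) - L ⟨star a (x : h), hmem x⟩ with hv
    have hb : ∀ y : L.domain, ‖⟪v, (y : h)⟫_ℂ‖ ≤ C * ‖(x : h)‖ * ‖(y : h)‖ := by
      intro y
      obtain ⟨c, hc, hc'⟩ := key x y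
      have h1 : ⟪v, (y : h)⟫_ℂ = -c := by
        rw [hv, inner_sub_left, hsym ⟨_, hmem x⟩ y, hc]; ring
      rw [h1, norm_neg]
      exact hc'
    have hb' : ∀ y : h, ‖⟪v, y⟫_ℂ‖ ≤ C * ‖(x : h)‖ * ‖y‖ := by
      intro y
      refine hd.induction (P := fun y => ‖⟪v, y⟫_ℂ‖ ≤ C * ‖(x : h)‖ * ‖y‖)
        (fun y hy => hb ⟨y, hy⟩) ?_ y
      exact isClosed_le (by fun_prop) (by fun_prop)
    have h2 := hb' v
    rw [inner_self_eq_norm_sq_to_K] at h2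
    have h3 : ‖v‖ * ‖v‖ ≤ C * ‖(x : h)‖ * ‖v‖ := by
      simpa [pow_two] using h2
    rcases (norm_nonneg v).eq_or_lt with h0 | h0
    · obtain ⟨ha, ha'⟩ := hC x
      rw [← h0]
      exact (norm_nonneg _).trans ha'
    · exact le_of_mul_le_mul_right h3 h0

/-! ### Trace class operators, singular numbers and the Macaev ideal -/

section Trace

variable (h) in
/-- The index set of a fixed orthonormal basis of `h`. -/
def basisSet [CompleteSpace h] : Set h := (exists_hilbertBasis ℂ h).choose

variable (h) in
/-- A fixed orthonormal basis of `h`. -/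
noncomputable def onBasis [CompleteSpace h] : HilbertBasis (basisSet h) ℂ h :=
  (exists_hilbertBasis ℂ h).choose_spec.choose

/-- `T` is trace class: `Tr |T| = ∑ ⟨e, |T| e⟩` is finite
(this does not depend on the orthonormal basis). -/
def IsTraceClass [CompleteSpace h] (T : h →L[ℂ] h) : Prop :=
  Summable fun i => (⟪onBasis h i, CFC.abs T (onBasis h i)⟫_ℂ).re

/-- The trace `∑ ⟨e, T e⟩` of a trace class operator
(for these it does not depend on the orthonormal basis). -/
noncomputable def trace [CompleteSpace h] (T : h →L[ℂ] h) : ℂ :=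
  ∑' i, ⟪onBasis h i, T (onBasis h i)⟫_ℂ

/-- The singular numbers of `T`, numbered from `0`: the distance of `T` to the operators of rank
at most `n`. For compact `T` they are the eigenvalues of `|T|` in decreasing order, repeated
according to multiplicity. -/
noncomputable def singularNumber (n : ℕ) (T : h →L[ℂ] h) : ℝ :=
  sInf {r : ℝ | ∃ F : h →L[ℂ] h, LinearMap.rank (F : h →ₗ[ℂ] h) ≤ (n : Cardinal) ∧ r = ‖T - F‖}

/-- The logarithmic mean `(1 / Log N) ∑ μ_n(T)` over the first `N` singular numbers. -/
noncomputable def logMean (T : h →L[ℂ] h) (N : ℕ) : ℝ :=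
  (Real.log N)⁻¹ * ∑ n ∈ Finset.range N, singularNumber n T

/-- `T` belongs to the dual Macaev ideal `𝓛^(1,∞)(h)`. -/
def InMacaev (T : h →L[ℂ] h) : Prop :=
  IsCompactOperator T ∧ ∃ C : ℝ, ∀ N : ℕ, 2 ≤ N → logMean T N ≤ C

end Trace

/-! ### Dixmier traces and volume forms -/

/-- The real Banach space `L^∞(0, ∞)`. -/
abbrev LInfty : Type := Lp ℝ ∞ (volume.restrict (Ioi (0 : ℝ)))

/-- The properties of the states `ω` on `L^∞(0, ∞)` that define Dixmier traces (a state on the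
complex `L^∞` is determined by its restriction to real functions, which is real). -/
structure IsDixmierState (ω : LInfty →L[ℝ] ℝ) : Prop where
  /-- `ω` is a limit process at `+∞` (and in particular a state). -/
  limit : ∀ f : LInfty, liminf f (atTop ⊓ ae volume) ≤ ω f ∧ ω f ≤ limsup f (atTop ⊓ ae volume)
  /-- Invariance under dilations. -/
  dilation : ∀ s : ℝ, 0 < s → ∀ f g : LInfty,
    (∀ᵐ t ∂(volume.restrict (Ioi (0 : ℝ))), g t = f (s * t)) → ω g = ω f
  /-- Invariance under powers. -/
  power : ∀ s : ℝ, 0 < s → ∀ f g : LInfty,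
    (∀ᵐ t ∂(volume.restrict (Ioi (0 : ℝ))), g t = f (t ^ s)) → ω g = ω f
  /-- Invariance under logarithmic Cesàro means. -/
  cesaro : ∀ f g : LInfty,
    (∀ᵐ t ∂(volume.restrict (Ioi (0 : ℝ))), g t = (Real.log t)⁻¹ * ∫ s in (1 : ℝ)..t, f s / s) →
    ω g = ω f

open Classical in
/-- `ω-lim u(N)` for a bounded sequence `u`: the value of `ω` on the class of `t ↦ u([t])`
(and `0` if `u` is not bounded). -/
noncomputable def omegaLim (ω : LInfty →L[ℝ] ℝ) (u : ℕ → ℝ) : ℝ :=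
  if hu : MemLp (fun t : ℝ => u ⌊t⌋₊) ∞ (volume.restrict (Ioi (0 : ℝ))) then
    ω (hu.toLp (fun t : ℝ => u ⌊t⌋₊)) else 0

/-- The Dixmier trace of a positive operator in the dual Macaev ideal. -/
noncomputable def dixmierTracePos (ω : LInfty →L[ℝ] ℝ) (T : h →L[ℂ] h) : ℝ :=
  omegaLim ω (logMean T)

/-- The Dixmier trace on the dual Macaev ideal: the linear extension from positive operators,
through the positive and negative parts of the real and imaginary parts. -/
noncomputable def dixmierTrace [CompleteSpace h] (ω : LInfty →L[ℝ] ℝ) (T : h →L[ℂ] h) : ℂ :=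
  ((dixmierTracePos ω ((realPart T : h →L[ℂ] h)⁺)
      - dixmierTracePos ω ((realPart T : h →L[ℂ] h)⁻) : ℝ) : ℂ) +
  Complex.I * ((dixmierTracePos ω ((imaginaryPart T : h →L[ℂ] h)⁺)
      - dixmierTracePos ω ((imaginaryPart T : h →L[ℂ] h)⁻) : ℝ) : ℂ)

/-- The volume form `Ω_L(T) = Tr_ω(T ρ(L))`. -/
noncomputable def volumeForm [CompleteSpace h] (L : h →ₗ.[ℂ] h) (ω : LInfty →L[ℝ] ℝ)
    (T : h →L[ℂ] h) : ℂ :=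
  dixmierTrace ω (T * spectralWeight L)

/-! ### States and hypertraces -/

/-- The continuous linear form `τ` is a state on `B(h)`. -/
def IsState [CompleteSpace h] (τ : WeakDual ℂ (h →L[ℂ] h)) : Prop :=
  τ 1 = 1 ∧ ∀ T : h →L[ℂ] h, T.IsPositive → 0 ≤ (τ T).re ∧ (τ T).im = 0

/-- The linear form `τ` on `B(h)` satisfies `τ(ba) = τ(ab)` for `a ∈ A` and `b ∈ B(h)`. -/
def IsHypertraceOn [CompleteSpace h] (A : StarSubalgebra ℂ (h →L[ℂ] h))
    (τ : WeakDual ℂ (h →L[ℂ] h)) : Prop :=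
  ∀ a ∈ A, ∀ b : h →L[ℂ] h, τ (b * a) = τ (a * b)

/-- The restriction of `τ` to the unital *-algebra `A` is a tracial state. -/
def IsTracialStateOn [CompleteSpace h] (A : StarSubalgebra ℂ (h →L[ℂ] h))
    (τ : WeakDual ℂ (h →L[ℂ] h)) : Prop :=
  τ 1 = 1 ∧ (∀ a ∈ A, 0 ≤ (τ (star a * a)).re ∧ (τ (star a * a)).im = 0) ∧
    ∀ a ∈ A, ∀ b ∈ A, τ (a * b) = τ (b * a)

end VolumeTrace

open VolumeTrace

namespace VolumeTrace

set_option linter.unusedSectionVars false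

/-! ### Eigenvectors of positive compact operators -/

section

variable {h : Type*} [NormedAddCommGroup h] [InnerProductSpace ℂ h]

/-! The proof turns everything into estimates on matrix entries. Since `L` has a compact inverse off
its kernel, there is an orthonormal basis of eigenvectors with positive eigenvalues `λ_0 ≤ λ_1 ≤ … →
∞`, completed by a basis of the kernel (`exists_isEigenbasis`). In it `ρ(L)` is diagonal with
entries `w_n = N_L(λ_n)⁻¹ ≤ 1/(n+1)`, and `0` on the kernel.

The growth hypothesis is used in one form only: for every fixed `W`, `N_L(x+W)/N_L(x) → 1`
(`eventually_apply_add_le`, a Gronwall-type argument for `φ`). This has two consequences. First,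
multiplicities and clusters of eigenvalues are asymptotically negligible, so `(n+1) w_n → 1`; hence
`Tr ρ(L)^s` has the residue of the zeta function at `1`, and the logarithmic means of `w` tend to
`1`. Second, `w_m` and `w_n` are nearly equal once `|λ_m - λ_n| ≤ W` and `λ_n` is large.

The heart is an estimate of commutators. Let `R²` be the diagonal operator with entries `w_n^s`, and
let `a` belong to the Lipschitz algebra. Then `‖[a,R]‖₂² = ∑ |a_mn|² (R_m - R_n)²`, while
boundedness of `[a,L]` bounds `∑ |a_mn|² (λ_m - λ_n)²` along each row and each column. Entries with
`|λ_m - λ_n| ≤ W` are small by slow variation, and the others gain a factor `W⁻²`; a bounded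
remainder comes from the finitely many low positive eigenvalues. Thus `‖[a,R]‖₂² = o(‖R‖₂²)`, in the
sense that it is `o(1/(s-1))` as `s ↓ 1` (`IsSlowWeightFamily.eventually_hsSum_commutator_le`). From
`[a,R²] = [a,R]R + R[a,R]`, the Cauchy–Schwarz inequality for Hilbert–Schmidt operators and
cyclicity of the trace, both the trace norm of `[a,R²]` and `Tr([a,c]R²)` are `o(1/(s-1))`. The
states in the limit come from Banach–Alaoglu, and the hypertrace property passes to the norm closure
by continuity.

For the Dixmier trace, the eigenvalue sums of the positive and negative parts of the real and
imaginary parts of `Tρ(L)` are compared with the diagonal sums `∑_{n<N} w_n ⟨b_n, T b_n⟩`. Both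
orthonormal systems have at most `2N` vectors and carry the quadratic form up to `O(1/N)`, so inside
their joint span the two sums differ by `O(1)`, which disappears after division by `log N`
(`dixmierTracePos_sub_eq`). The volume form thus becomes a generalized limit of logarithmic diagonal
means, visibly linear and positive. It vanishes on commutators by the same estimate applied to the
truncated weights `max(w_n - 1/N, 0)`, whose sums are `O(log N)`. -/

/-- A compact operator maps an orthonormal sequence to a null sequence. -/
theorem tendsto_apply_orthonormal [CompleteSpace h] {T : h →L[ℂ] h} (hT : IsCompactOperator T)
    {g : ℕ → h} (hg : Orthonormal ℂ g) : Tendsto (fun n => T (g n)) atTop (𝓝 0) := by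
  obtain ⟨K, hK, hKT⟩ := hT.image_closedBall_subset_compact (𝕜₁ := ℂ) (f := (T : h →ₗ[ℂ] h)) 1
  have hmem : ∀ n, T (g n) ∈ K := fun n => hKT ⟨g n, by simp [hg.1 n], rfl⟩
  have hweak : ∀ y : h, Tendsto (fun n => ⟪g n, y⟫_ℂ) atTop (𝓝 0) := by
    intro y
    have h1 := (hg.inner_products_summable (x := y)).tendsto_atTop_zero
    have h2 : Tendsto (fun n => ‖⟪g n, y⟫_ℂ‖) atTop (𝓝 0) := by
      have := h1.sqrt
      simpa using this
    exact tendsto_zero_iff_norm_tendsto_zero.2 h2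
  -- The images stay in a compact set and tend weakly to `0` by Bessel, so every subsequential norm
  -- limit `y` satisfies `⟪y, y⟫ = 0`.
  refine tendsto_of_subseq_tendsto fun ns hns => ?_
  obtain ⟨y, -, φ, hφ, hlim⟩ := hK.tendsto_subseq (fun n => hmem (ns n))
  refine ⟨φ, ?_⟩
  have h3 : Tendsto (fun n => ⟪T (g (ns (φ n))), y⟫_ℂ) atTop (𝓝 0) := by
    have := (hweak (ContinuousLinearMap.adjoint T y)).comp (hns.comp hφ.tendsto_atTop)
    simpa [Function.comp_def, ContinuousLinearMap.adjoint_inner_right] using this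
  have h4 : Tendsto (fun n => ⟪T (g (ns (φ n))), y⟫_ℂ) atTop (𝓝 ⟪y, y⟫_ℂ) :=
    (hlim.inner tendsto_const_nhds)
  have h5 : y = 0 := inner_self_eq_zero.1 (tendsto_nhds_unique h4 h3)
  rw [← h5]
  exact hlim

/-- A nonzero positive compact operator attains its norm as an eigenvalue. -/
theorem exists_eigenvector_norm [CompleteSpace h] {Y : h →L[ℂ] h} (hY : IsCompactOperator Y)
    (hpos : Y.IsPositive) (h0 : Y ≠ 0) :
    ∃ g : h, ‖g‖ = 1 ∧ Y g = (‖Y‖ : ℂ) • g := by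
  have hc : 0 < ‖Y‖ := norm_pos_iff.2 h0
  set c := ‖Y‖ with hcdef
  have hsym : ∀ x y : h, ⟪Y x, y⟫_ℂ = ⟪x, Y y⟫_ℂ := hpos.inner_left_eq_inner_right
  have hex : ∀ n : ℕ, ∃ x : h, ‖x‖ ≤ 1 ∧ c - 1 / ((n : ℝ) + 1) < ‖Y x‖ := by
    intro n
    have h1 : c - 1 / ((n : ℝ) + 1) < c := by
      have : 0 < 1 / ((n : ℝ) + 1) := by positivity
      linarith
    obtain ⟨x, hx, hx'⟩ := Y.exists_lt_apply_of_lt_opNorm h1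
    exact ⟨x, hx.le, hx'⟩
  choose x hx1 hx2 using hex
  obtain ⟨K, hK, hKT⟩ := hY.image_closedBall_subset_compact (𝕜₁ := ℂ) (f := (Y : h →ₗ[ℂ] h)) 1
  have hmem : ∀ n, Y (x n) ∈ K := fun n => hKT ⟨x n, by simpa using hx1 n, rfl⟩
  obtain ⟨z, -, φ, hφ, hlim⟩ := hK.tendsto_subseq hmem
  have hYx : ∀ n, ‖Y (x n)‖ ≤ c := fun n => by
    simpa using (Y.le_opNorm_of_le (hx1 n))
  have hnorm : Tendsto (fun n => ‖Y (x n)‖) atTop (𝓝 c) := by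
    have h1 : Tendsto (fun n : ℕ => c - 1 / ((n : ℝ) + 1)) atTop (𝓝 (c - 0)) :=
      tendsto_const_nhds.sub tendsto_one_div_add_atTop_nhds_zero_nat
    rw [sub_zero] at h1
    exact tendsto_of_tendsto_of_tendsto_of_le_of_le h1 tendsto_const_nhds
      (fun n => (hx2 n).le) hYx
  -- Along a norming sequence `Y² x_n - c² x_n → 0`: in the expanded square the cross term is
  -- exactly `-2c²‖Y x_n‖²`, and each square is at most its extremal value.
  have hdiff : ∀ n, ‖Y (Y (x n)) - ((c ^ 2 : ℝ) : ℂ) • x n‖ ^ 2 ≤ c ^ 2 * (c ^ 2 - ‖Y (x n)‖ ^ 2) := by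
    intro n
    rw [@norm_sub_sq ℂ]
    have h1 : ‖Y (Y (x n))‖ ≤ c * ‖Y (x n)‖ := Y.le_opNorm _
    have h2 : RCLike.re ⟪Y (Y (x n)), ((c ^ 2 : ℝ) : ℂ) • x n⟫_ℂ = c ^ 2 * ‖Y (x n)‖ ^ 2 := by
      rw [hsym, map_smul, inner_smul_right, inner_self_eq_norm_sq_to_K]
      have h3 : ((c ^ 2 : ℝ) : ℂ) * (RCLike.ofReal ‖Y (x n)‖) ^ 2
          = ((c ^ 2 * ‖Y (x n)‖ ^ 2 : ℝ) : ℂ) := by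
        push_cast; rfl
      rw [h3]
      exact Complex.ofReal_re _
    have h3 : ‖((c ^ 2 : ℝ) : ℂ) • x n‖ ≤ c ^ 2 := by
      rw [norm_smul, Complex.norm_real, Real.norm_of_nonneg (by positivity)]
      exact mul_le_of_le_one_right (by positivity) (hx1 n)
    have h4 : ‖Y (Y (x n))‖ ^ 2 ≤ (c * ‖Y (x n)‖) ^ 2 := by gcongr
    have h5 : ‖((c ^ 2 : ℝ) : ℂ) • x n‖ ^ 2 ≤ (c ^ 2) ^ 2 := by gcongr
    rw [h2]
    nlinarith
  have hdiff0 : Tendsto (fun n => Y (Y (x n)) - ((c ^ 2 : ℝ) : ℂ) • x n) atTop (𝓝 0) := by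
    rw [tendsto_zero_iff_norm_tendsto_zero]
    have h1 : Tendsto (fun n => c ^ 2 * (c ^ 2 - ‖Y (x n)‖ ^ 2)) atTop (𝓝 0) := by
      have := ((hnorm.pow 2).const_sub (c ^ 2)).const_mul (c ^ 2)
      simpa using this
    have h2 : Tendsto (fun n => ‖Y (Y (x n)) - ((c ^ 2 : ℝ) : ℂ) • x n‖ ^ 2) atTop (𝓝 0) :=
      squeeze_zero (fun n => by positivity) hdiff h1
    simpa using h2.sqrt
  have hc2 : ((c ^ 2 : ℝ) : ℂ) ≠ 0 := by exact_mod_cast (by positivity : c ^ 2 ≠ 0)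
  have hYY : Tendsto (fun n => Y (Y (x (φ n)))) atTop (𝓝 (Y z)) :=
    (Y.continuous.tendsto z).comp hlim
  have hxlim : Tendsto (fun n => x (φ n)) atTop (𝓝 (((c ^ 2 : ℝ) : ℂ)⁻¹ • Y z)) := by
    have h1 := hYY.sub (hdiff0.comp hφ.tendsto_atTop)
    rw [sub_zero] at h1
    have h2 := h1.const_smul (((c ^ 2 : ℝ) : ℂ)⁻¹)
    refine h2.congr fun n => ?_
    simp only [Function.comp, sub_sub_cancel]
    rw [smul_smul, inv_mul_cancel₀ hc2, one_smul]
  set u := ((c ^ 2 : ℝ) : ℂ)⁻¹ • Y z with hu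
  have hYu : Y u = z := tendsto_nhds_unique ((Y.continuous.tendsto u).comp hxlim) hlim
  have hzc : ‖z‖ = c := tendsto_nhds_unique hlim.norm (hnorm.comp hφ.tendsto_atTop)
  have hu1 : Y z = ((c ^ 2 : ℝ) : ℂ) • u := by
    rw [hu, smul_smul, mul_inv_cancel₀ hc2, one_smul]
  -- From `Y u = z` and `Y z = c² u`, the factorization `Y² - c² = (Y - c)(Y + c)` suggests `z + c
  -- u` as eigenvector for `c`. Positivity of `Y` excludes cancellation, which would mean the
  -- eigenvalue `-c`.
  set y := z + (c : ℂ) • u with hy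
  have hYy : Y y = (c : ℂ) • y := by
    rw [hy, map_add, map_smul, hYu, hu1]
    push_cast
    module
  have hy0 : y ≠ 0 := by
    intro h1
    have h2 : 0 ≤ RCLike.re ⟪z, u⟫_ℂ := by
      rw [← hYu]; exact hpos.re_inner_nonneg_left u
    have h3 : ‖y‖ ^ 2 = ‖z‖ ^ 2 + 2 * (c * RCLike.re ⟪z, u⟫_ℂ) + ‖(c : ℂ) • u‖ ^ 2 := by
      rw [hy, @norm_add_sq ℂ, inner_smul_right]
      simp
    rw [h1, hzc, norm_zero] at h3
    have : 0 ≤ 2 * (c * RCLike.re ⟪z, u⟫_ℂ) := by positivity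
    nlinarith [sq_nonneg ‖(c : ℂ) • u‖, sq_pos_of_pos hc]
  refine ⟨((‖y‖ : ℂ))⁻¹ • y, ?_, ?_⟩
  · rw [norm_smul, norm_inv, Complex.norm_real, norm_norm, inv_mul_cancel₀ (norm_ne_zero_iff.2 hy0)]
  · rw [map_smul, hYy, smul_comm]

/-- The next eigenvector of a positive compact operator, orthogonal to an invariant subspace. -/
theorem exists_eigenvector_orthogonal [CompleteSpace h] (hinf : ¬ FiniteDimensional ℂ h)
    {Y : h →L[ℂ] h} (hY : IsCompactOperator Y) (hpos : Y.IsPositive) (V : Submodule ℂ h)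
    [FiniteDimensional ℂ V] (hV : ∀ v ∈ V, Y v ∈ V) :
    ∃ g : h, ∃ ν : ℝ, ‖g‖ = 1 ∧ g ∈ Vᗮ ∧ Y g = (ν : ℂ) • g ∧ ∀ v ∈ Vᗮ, ‖Y v‖ ≤ ν * ‖v‖ := by
  have hsym : ∀ x y : h, ⟪Y x, y⟫_ℂ = ⟪x, Y y⟫_ℂ := hpos.inner_left_eq_inner_right
  have hV' : ∀ v ∈ Vᗮ, Y v ∈ Vᗮ := by
    intro v hv w hw
    rw [← hsym]
    exact hv _ (hV w hw)
  set Q := Vᗮ.starProjection with hQ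
  have hQv : ∀ v ∈ Vᗮ, Q v = v := fun v hv => Submodule.starProjection_eq_self_iff.2 hv
  set Z := Q ∘L Y ∘L Q with hZ
  have hZpos : Z.IsPositive := by
    have := hpos.conj_starProjection Vᗮ
    simpa [hZ, hQ, ContinuousLinearMap.mul_def] using this
  have hZv : ∀ v ∈ Vᗮ, Z v = Y v := by
    intro v hv
    simp only [hZ, ContinuousLinearMap.comp_apply, hQv v hv, hQv _ (hV' v hv)]
  -- If the compression to the orthogonal complement vanishes, any unit vector there serves with `ν
  -- = 0`; infinite dimension provides one.
  by_cases h0 : Z = 0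
  · have hne : Vᗮ ≠ ⊥ := by
      intro hb
      rw [Submodule.orthogonal_eq_bot_iff] at hb
      apply hinf
      have : FiniteDimensional ℂ (⊤ : Submodule ℂ h) := hb ▸ inferInstance
      exact Module.finite_def.2 (Module.Finite.iff_fg.1 this)
    obtain ⟨v, hv, hv0⟩ := Submodule.exists_mem_ne_zero_of_ne_bot hne
    refine ⟨((‖v‖ : ℂ))⁻¹ • v, 0, ?_, Vᗮ.smul_mem _ hv, ?_, fun w hw => ?_⟩
    · rw [norm_smul, norm_inv, Complex.norm_real, norm_norm,
        inv_mul_cancel₀ (norm_ne_zero_iff.2 hv0)]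
    · rw [map_smul, ← hZv v hv, h0]; simp
    · rw [← hZv w hw, h0]; simp
  · have hZc : IsCompactOperator Z := (hY.comp_clm Q).clm_comp Q
    obtain ⟨g, hg, hg'⟩ := exists_eigenvector_norm hZc hZpos h0
    have hgV : g ∈ Vᗮ := by
      have h1 : Z g ∈ Vᗮ := by
        simp only [hZ, ContinuousLinearMap.comp_apply]
        exact Submodule.starProjection_apply_mem _ _
      rw [hg'] at h1
      exact ((Vᗮ).smul_mem_iff (by exact_mod_cast (norm_ne_zero_iff.2 h0))).1 h1
    refine ⟨g, ‖Z‖, hg, hgV, ?_, fun v hv => ?_⟩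
    · rw [← hZv g hgV, hg']
    · rw [← hZv v hv]; exact Z.le_opNorm v

/-- The sequence of eigenvectors of a positive compact operator on an infinite dimensional space,
in decreasing order of the eigenvalues. -/
theorem exists_decreasing_eigensequence [CompleteSpace h] (hinf : ¬ FiniteDimensional ℂ h)
    {Y : h →L[ℂ] h} (hY : IsCompactOperator Y) (hpos : Y.IsPositive) :
    ∃ g : ℕ → h, ∃ ν : ℕ → ℝ, Orthonormal ℂ g ∧ (∀ n, Y (g n) = (ν n : ℂ) • g n) ∧
      ∀ n v, (∀ i < n, ⟪g i, v⟫_ℂ = 0) → ‖Y v‖ ≤ ν n * ‖v‖ := by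
  -- The recursion runs over finite-dimensional invariant subspaces, so that each new eigenvector is
  -- orthogonal to all earlier ones and extremal on what remains.
  let S := {V : Submodule ℂ h // FiniteDimensional ℂ V ∧ ∀ v ∈ V, Y v ∈ V}
  have hstep : ∀ V : S, ∃ p : h × ℝ, ‖p.1‖ = 1 ∧ p.1 ∈ V.1ᗮ ∧ Y p.1 = (p.2 : ℂ) • p.1 ∧
      ∀ v ∈ V.1ᗮ, ‖Y v‖ ≤ p.2 * ‖v‖ := by
    rintro ⟨V, hVf, hV⟩
    obtain ⟨g, ν, h1⟩ := exists_eigenvector_orthogonal hinf hY hpos V hV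
    exact ⟨(g, ν), h1⟩
  choose p hp1 hp2 hp3 hp4 using hstep
  have hnext : ∀ V : S, FiniteDimensional ℂ ↥(V.1 ⊔ Submodule.span ℂ {(p V).1}) ∧
      ∀ v ∈ V.1 ⊔ Submodule.span ℂ {(p V).1}, Y v ∈ V.1 ⊔ Submodule.span ℂ {(p V).1} := by
    intro V
    have := V.2.1
    refine ⟨inferInstance, fun v hv => ?_⟩
    obtain ⟨a, ha, b, hb, rfl⟩ := Submodule.mem_sup.1 hv
    obtain ⟨c, rfl⟩ := Submodule.mem_span_singleton.1 hb
    rw [map_add, map_smul, hp3]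
    exact Submodule.add_mem_sup (V.2.2 a ha)
      (Submodule.smul_mem _ _ (Submodule.smul_mem _ _ (Submodule.mem_span_singleton_self _)))
  let V : ℕ → S := fun n => Nat.rec ⟨⊥, inferInstance, by simp⟩ (fun _ W => ⟨_, hnext W⟩) n
  have hVs : ∀ n, (V (n + 1)).1 = (V n).1 ⊔ Submodule.span ℂ {(p (V n)).1} := fun n => rfl
  have hVmono : Monotone fun n => (V n).1 := monotone_nat_of_le_succ fun n => by
    rw [hVs]; exact le_sup_left
  have hgmem : ∀ i n, i < n → (p (V i)).1 ∈ (V n).1 := by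
    intro i n hin
    refine hVmono (Nat.succ_le_of_lt hin) ?_
    change _ ∈ (V (i + 1)).1
    rw [hVs]
    exact Submodule.mem_sup_right (Submodule.mem_span_singleton_self _)
  have hlt : ∀ i n, i < n → ⟪(p (V i)).1, (p (V n)).1⟫_ℂ = 0 := fun i n hin =>
    hp2 (V n) _ (hgmem i n hin)
  refine ⟨fun n => (p (V n)).1, fun n => (p (V n)).2, ⟨fun n => hp1 _, fun i j hij => ?_⟩,
    fun n => hp3 _, fun n v hv => hp4 _ v ?_⟩
  · rcases lt_or_gt_of_ne hij with h1 | h1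
    · exact hlt i j h1
    · exact inner_eq_zero_symm.1 (hlt j i h1)
  · have key : ∀ m ≤ n, v ∈ (V m).1ᗮ := by
      intro m
      induction m with
      | zero => intro _; change v ∈ (⊥ : Submodule ℂ h)ᗮ; simp
      | succ m ih =>
        intro hm
        rw [hVs, ← Submodule.inf_orthogonal]
        exact ⟨ih (by omega), by
          exact Submodule.mem_orthogonal_singleton_iff_inner_right.2 (hv m (by omega))⟩
    exact key n le_rfl

end

section

variable {h : Type*} [NormedAddCommGroup h] [InnerProductSpace ℂ h]

/-! ### Singular numbers -/

theorem singularNumber_le {T F : h →L[ℂ] h} {n : ℕ}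
    (hF : LinearMap.rank (F : h →ₗ[ℂ] h) ≤ (n : Cardinal)) : singularNumber n T ≤ ‖T - F‖ :=
  csInf_le ⟨0, by rintro r ⟨F, -, rfl⟩; exact norm_nonneg _⟩ ⟨F, hF, rfl⟩

theorem le_singularNumber {T : h →L[ℂ] h} {n : ℕ} {c : ℝ}
    (hc : ∀ F : h →L[ℂ] h, LinearMap.rank (F : h →ₗ[ℂ] h) ≤ (n : Cardinal) → c ≤ ‖T - F‖) :
    c ≤ singularNumber n T :=
  le_csInf ⟨‖T - 0‖, 0, by simp, rfl⟩ (by rintro r ⟨F, hF, rfl⟩; exact hc F hF)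

theorem singularNumber_nonneg (n : ℕ) (T : h →L[ℂ] h) : 0 ≤ singularNumber n T :=
  le_singularNumber fun _ _ => norm_nonneg _

theorem singularNumber_mul_le (T A : h →L[ℂ] h) (n : ℕ) :
    singularNumber n (T * A) ≤ ‖T‖ * singularNumber n A := by
  have h1 : ∀ F : h →L[ℂ] h, LinearMap.rank (F : h →ₗ[ℂ] h) ≤ (n : Cardinal) →
      singularNumber n (T * A) ≤ ‖T‖ * ‖A - F‖ := by
    intro F hF
    have h2 : LinearMap.rank ((T * F : h →L[ℂ] h) : h →ₗ[ℂ] h) ≤ (n : Cardinal) :=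
      (LinearMap.rank_comp_le_right (F : h →ₗ[ℂ] h) (T : h →ₗ[ℂ] h)).trans hF
    refine (singularNumber_le h2).trans ?_
    rw [← mul_sub]
    exact norm_mul_le _ _
  rcases (norm_nonneg T).eq_or_lt with h0 | h0
  · have := h1 0 (by simp)
    rw [← h0, zero_mul] at this ⊢
    exact this
  · rw [← div_le_iff₀' h0]
    exact le_singularNumber fun F hF => (div_le_iff₀' h0).2 (h1 F hF)

/-- A linear map of rank at most `n` vanishes at a nonzero vector of the span of any `n + 1`
orthonormal eigenvectors. -/
theorem exists_ker_rayleigh_ge {W : Type*} [AddCommGroup W] [Module ℂ W] {Y : h →L[ℂ] h}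
    {g : ℕ → h} {ν : ℕ → ℝ} (hg : Orthonormal ℂ g) {n : ℕ}
    (hY : ∀ i ≤ n, Y (g i) = (ν i : ℂ) • g i) (hν : ∀ i ≤ n, ν n ≤ ν i) (G : h →ₗ[ℂ] W)
    (hG : LinearMap.rank G ≤ (n : Cardinal)) :
    ∃ v : h, v ≠ 0 ∧ G v = 0 ∧ ν n * ‖v‖ ^ 2 ≤ (⟪v, Y v⟫_ℂ).re := by
  let ℓ : (Fin (n + 1) → ℂ) →ₗ[ℂ] h := Fintype.linearCombination ℂ (fun i : Fin (n + 1) => g i)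
  have hℓ : ∀ c, ℓ c = ∑ i : Fin (n + 1), c i • g i := fun c => by
    simp [ℓ, Fintype.linearCombination_apply]
  have hg' : Orthonormal ℂ (fun i : Fin (n + 1) => g i) := hg.comp _ Fin.val_injective
  have hfin : FiniteDimensional ℂ (LinearMap.range G) := by
    rw [FiniteDimensional, ← Module.rank_lt_aleph0_iff]
    exact hG.trans_lt (Cardinal.natCast_lt_aleph0)
  have hlt : Module.finrank ℂ (LinearMap.range G) < Module.finrank ℂ (Fin (n + 1) → ℂ) := by
    rw [Module.finrank_fin_fun]
    exact Nat.lt_succ_of_le (Module.finrank_le_of_rank_le hG)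
  have hker := LinearMap.ker_ne_bot_of_finrank_lt (f := G.rangeRestrict ∘ₗ ℓ) hlt
  obtain ⟨c, hc, hc0⟩ := Submodule.exists_mem_ne_zero_of_ne_bot hker
  have hnorm : ‖ℓ c‖ ^ 2 = ∑ i, ‖c i‖ ^ 2 := by
    have h1 := hg'.inner_sum c c Finset.univ
    rw [← hℓ, inner_self_eq_norm_sq_to_K] at h1
    have h2 : ∀ i, (starRingEnd ℂ) (c i) * c i = ((‖c i‖ ^ 2 : ℝ) : ℂ) := fun i => by
      rw [mul_comm, Complex.mul_conj, Complex.normSq_eq_norm_sq]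
    simp only [h2] at h1
    have h4 : ((‖ℓ c‖ ^ 2 : ℝ) : ℂ) = ((∑ i, ‖c i‖ ^ 2 : ℝ) : ℂ) := by
      push_cast at h1 ⊢
      exact h1
    exact Complex.ofReal_injective h4
  have hray : (⟪ℓ c, Y (ℓ c)⟫_ℂ).re = ∑ i : Fin (n + 1), ν i * ‖c i‖ ^ 2 := by
    have h3 : Y (ℓ c) = ∑ i : Fin (n + 1), ((ν i : ℂ) * c i) • g i := by
      rw [hℓ, map_sum]
      refine Finset.sum_congr rfl fun i _ => ?_
      rw [map_smul, hY i (by omega), smul_smul, mul_comm]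
    rw [h3, hℓ, hg'.inner_sum c _ Finset.univ, Complex.re_sum]
    refine Finset.sum_congr rfl fun i _ => ?_
    have h2 : (starRingEnd ℂ) (c i) * ((ν i : ℂ) * c i) = ((ν i * ‖c i‖ ^ 2 : ℝ) : ℂ) := by
      rw [mul_left_comm, mul_comm _ (c i), Complex.mul_conj, Complex.normSq_eq_norm_sq]
      push_cast; ring
    rw [h2, Complex.ofReal_re]
  refine ⟨ℓ c, fun h0 => hc0 ?_, ?_, ?_⟩
  · rw [h0, norm_zero] at hnorm
    have h1 := (Finset.sum_eq_zero_iff_of_nonneg (fun i _ => by positivity)).1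
      (hnorm.symm.trans (by norm_num : (0 : ℝ) ^ 2 = 0))
    funext i
    simpa using h1 i (Finset.mem_univ _)
  · have h1 : G.rangeRestrict (ℓ c) = 0 := hc
    have := congrArg Subtype.val h1
    simpa using this
  · rw [hray, hnorm, Finset.mul_sum]
    refine Finset.sum_le_sum fun i _ => ?_
    have := hν i (by omega)
    gcongr

section Eigensequence

variable {Y : h →L[ℂ] h} {g : ℕ → h} {ν : ℕ → ℝ}

theorem eigenvalue_nonneg_of_bound (hg : Orthonormal ℂ g)
    (hbd : ∀ n v, (∀ i < n, ⟪g i, v⟫_ℂ = 0) → ‖Y v‖ ≤ ν n * ‖v‖) (n : ℕ) : 0 ≤ ν n := by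
  have := hbd n (g n) (fun i hi => hg.2 hi.ne)
  rw [hg.1 n, mul_one] at this
  exact (norm_nonneg _).trans this

theorem eigenvalue_antitone_of_bound (hg : Orthonormal ℂ g)
    (hY : ∀ n, Y (g n) = (ν n : ℂ) • g n)
    (hbd : ∀ n v, (∀ i < n, ⟪g i, v⟫_ℂ = 0) → ‖Y v‖ ≤ ν n * ‖v‖) : Antitone ν := by
  intro m n hmn
  have := hbd m (g n) (fun i hi => hg.2 (hi.trans_le hmn).ne)
  rw [hY, norm_smul, hg.1 n, mul_one, mul_one, Complex.norm_real] at this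
  exact (le_abs_self _).trans this

/-- The singular numbers of a positive compact operator are its eigenvalues. -/
theorem singularNumber_eq_eigenvalue (hg : Orthonormal ℂ g)
    (hY : ∀ n, Y (g n) = (ν n : ℂ) • g n)
    (hbd : ∀ n v, (∀ i < n, ⟪g i, v⟫_ℂ = 0) → ‖Y v‖ ≤ ν n * ‖v‖) (n : ℕ) :
    singularNumber n Y = ν n := by
  have h0 := eigenvalue_nonneg_of_bound hg hbd
  have hanti := eigenvalue_antitone_of_bound hg hY hbd
  refine le_antisymm ?_ (le_singularNumber fun F hF => ?_)
  -- Upper bound: `Y P`, with `P` the projection onto the first `n` eigenvectors, is a competitor of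
  -- rank at most `n`, and the error `Y(1 - P)` is controlled by `hbd`.
  · classical
    let V : Submodule ℂ h := Submodule.span ℂ ((Finset.range n).image g : Finset h)
    have hVf : FiniteDimensional ℂ V :=
      FiniteDimensional.span_of_finite ℂ (Finset.finite_toSet _)
    have hrank : Module.rank ℂ V ≤ (n : Cardinal) := by
      refine (rank_span_finset_le _).trans ?_
      exact_mod_cast Finset.card_image_le.trans (Finset.card_range n).le
    have hF : LinearMap.rank ((Y * V.starProjection : h →L[ℂ] h) : h →ₗ[ℂ] h)
        ≤ (n : Cardinal) := by
      refine (LinearMap.rank_comp_le_right (V.starProjection : h →ₗ[ℂ] h)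
        (Y : h →ₗ[ℂ] h)).trans ?_
      have h1 : LinearMap.range (V.starProjection : h →ₗ[ℂ] h) = V :=
        Submodule.range_starProjection V
      unfold LinearMap.rank
      rw [h1]
      exact hrank
    refine (singularNumber_le hF).trans (ContinuousLinearMap.opNorm_le_bound _ (h0 n) fun v => ?_)
    have h2 : (Y - Y * V.starProjection) v = Y (Vᗮ.starProjection v) := by
      rw [Submodule.starProjection_orthogonal']
      simp
    rw [h2]
    refine (hbd n _ fun i hi => ?_).trans ?_
    · exact Submodule.starProjection_apply_mem Vᗮ v _
        (Submodule.subset_span (Finset.mem_coe.2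
          (Finset.mem_image_of_mem _ (Finset.mem_range.2 hi))))
    · exact mul_le_mul_of_nonneg_left (Submodule.norm_starProjection_apply_le Vᗮ v) (h0 n)
  -- Lower bound: any `F` of rank at most `n` kills some nonzero vector in the span of the first `n
  -- + 1` eigenvectors, where `Y` is at least `ν n`.
  · obtain ⟨v, hv0, hFv, hv⟩ := exists_ker_rayleigh_ge hg (fun i _ => hY i)
      (fun i hi => hanti hi) (F : h →ₗ[ℂ] h) hF
    have h1 : ‖Y v‖ ≤ ‖Y - F‖ * ‖v‖ := by
      have h2 : Y v = (Y - F) v := by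
        have : F v = 0 := hFv
        simp [this]
      rw [h2]
      exact (Y - F).le_opNorm v
    have h3 : (⟪v, Y v⟫_ℂ).re ≤ ‖v‖ * ‖Y v‖ :=
      (Complex.re_le_norm _).trans (norm_inner_le_norm _ _)
    have hvpos : 0 < ‖v‖ := norm_pos_iff.2 hv0
    have h4 : ν n * ‖v‖ ^ 2 ≤ ‖Y - F‖ * ‖v‖ ^ 2 := by nlinarith
    exact le_of_mul_le_mul_right h4 (by positivity)

end Eigensequence

/-! ### Positive and negative parts -/

section PosPart

variable [CompleteSpace h]

/-- `X⁺ v` and `X⁻ v` are orthogonal because `X⁺ X⁻ = 0`, so Pythagoras applies to `X v = X⁺ v - X⁻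
v`. It makes the two parts of a compact operator compact. -/
theorem norm_posPart_apply_le {X : h →L[ℂ] h} (hX : IsSelfAdjoint X) (v : h) :
    ‖X⁺ v‖ ≤ ‖X v‖ := by
  have h1 : X v = X⁺ v - X⁻ v := by
    conv_lhs => rw [← CFC.posPart_sub_negPart X hX]
    simp
  have h2 : ⟪X⁺ v, X⁻ v⟫_ℂ = 0 := by
    have hp : (X⁺).IsPositive := (ContinuousLinearMap.nonneg_iff_isPositive _).1
      (CFC.posPart_nonneg X)
    rw [hp.inner_left_eq_inner_right, ← mul_apply_eq_comp, CFC.posPart_mul_negPart]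
    simp
  have h3 : ‖X v‖ ^ 2 = ‖X⁺ v‖ ^ 2 + ‖X⁻ v‖ ^ 2 := by
    rw [h1, @norm_sub_sq ℂ, h2]; simp
  exact le_of_sq_le_sq (by nlinarith [sq_nonneg ‖X⁻ v‖]) (norm_nonneg _)

/-- A finite `ε`-net of the image of the unit ball under `B`, lifted to the ball and mapped by `A`,
is an `ε`-net for `A`, since `‖A(v - w)‖ ≤ ‖B(v - w)‖`. -/
theorem IsCompactOperator.of_norm_apply_le {A B : h →L[ℂ] h} (hB : IsCompactOperator B)
    (hAB : ∀ v, ‖A v‖ ≤ ‖B v‖) : IsCompactOperator A := by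
  refine (isCompactOperator_iff_isCompact_closure_image_closedBall (𝕜₁ := ℂ) (A : h →ₗ[ℂ] h)
    zero_lt_one).2 ?_
  have h1 := (isCompactOperator_iff_isCompact_closure_image_closedBall (𝕜₁ := ℂ)
    (B : h →ₗ[ℂ] h) zero_lt_one).1 hB
  have h2 : TotallyBounded ((B : h →ₗ[ℂ] h) '' Metric.closedBall 0 1) :=
    h1.totallyBounded.subset subset_closure
  refine isCompact_iff_totallyBounded_isComplete.2
    ⟨TotallyBounded.closure ?_, isClosed_closure.isComplete⟩
  rw [Metric.totallyBounded_iff]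
  intro ε hε
  obtain ⟨t, hts, htf, ht⟩ := Metric.finite_approx_of_totallyBounded h2 ε hε
  obtain ⟨s, hs, hsf, rfl⟩ := Set.exists_subset_image_finite_and.1 ⟨t, hts, htf, rfl⟩
  refine ⟨(A : h →ₗ[ℂ] h) '' s, hsf.image _, ?_⟩
  rintro _ ⟨v, hv, rfl⟩
  obtain ⟨y, hy, hvy⟩ := mem_iUnion₂.1 (ht ⟨v, hv, rfl⟩)
  obtain ⟨w, hw, rfl⟩ := hy
  refine mem_iUnion₂.2 ⟨_, ⟨w, hw, rfl⟩, ?_⟩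
  rw [Metric.mem_ball, dist_eq_norm] at hvy ⊢
  rw [← map_sub] at hvy ⊢
  exact (hAB _).trans_lt hvy

theorem apply_eq_of_posPart_eigenvector {X : h →L[ℂ] h} (hX : IsSelfAdjoint X) {g : h} {ν : ℝ}
    (hν : 0 < ν) (hg : X⁺ g = (ν : ℂ) • g) : X g = (ν : ℂ) • g := by
  have h0 : (ν : ℂ) ≠ 0 := by exact_mod_cast hν.ne'
  have h1 : X⁻ g = 0 := by
    have h2 : X⁻ (X⁺ g) = 0 := by
      rw [← mul_apply_eq_comp, CFC.negPart_mul_posPart]; simp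
    rw [hg, map_smul] at h2
    exact (smul_eq_zero.1 h2).resolve_left h0
  have h3 : X g = X⁺ g - X⁻ g := by
    conv_lhs => rw [← CFC.posPart_sub_negPart X hX]
    simp
  rw [h3, h1, hg, sub_zero]

end PosPart

/-! ### Comparison of diagonal sums -/

/-- The sum of the diagonal values of `X` over an orthonormal system which carries `X` up to `c`
is, up to an error, the trace of the compression of `X` to any larger subspace. -/
theorem abs_trace_compression_sub_le {ι : Type*} [Fintype ι] (X : h →L[ℂ] h) (R : Submodule ℂ h)
    [FiniteDimensional ℂ R] {v : ι → h} (hv : Orthonormal ℂ v) (hvR : ∀ i, v i ∈ R) {c : ℝ}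
    (hc0 : 0 ≤ c) (hc : ∀ u, (∀ i, ⟪v i, u⟫_ℂ = 0) → |(⟪u, X u⟫_ℂ).re| ≤ c * ‖u‖ ^ 2) :
    |(LinearMap.trace ℂ R ((R.orthogonalProjectionOnto : h →ₗ[ℂ] R) ∘ₗ (X : h →ₗ[ℂ] h) ∘ₗ
      R.subtype)).re - ∑ i, (⟪v i, X (v i)⟫_ℂ).re| ≤ c * Module.finrank ℂ R := by
  classical
  let v' : ι → R := fun i => ⟨v i, hvR i⟩
  have hv' : Orthonormal ℂ v' := by
    rw [← R.subtypeₗᵢ.orthonormal_comp_iff]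
    exact hv
  -- The trace of the compression may be computed in an orthonormal basis of `R` extending `v`. The
  -- added vectors are orthogonal to all of `v`, so each contributes at most `c`.
  obtain ⟨u, b, hu, hb⟩ := hv'.toSubtypeRange.exists_orthonormalBasis_extension
  have htr : (LinearMap.trace ℂ R ((R.orthogonalProjectionOnto : h →ₗ[ℂ] R) ∘ₗ (X : h →ₗ[ℂ] h) ∘ₗ
      R.subtype)) = ∑ e ∈ u, ⟪(e : h), X e⟫_ℂ := by
    rw [LinearMap.trace_eq_sum_inner _ b, ← Finset.sum_coe_sort u]
    refine Finset.sum_congr rfl fun e _ => ?_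
    rw [hb]
    simp
  have hinj : Function.Injective v' := hv'.linearIndependent.injective
  have hsum : ∑ i, (⟪v i, X (v i)⟫_ℂ).re
      = ∑ e ∈ Finset.univ.image v', (⟪(e : h), X e⟫_ℂ).re := by
    rw [Finset.sum_image fun i _ j _ hij => hinj hij]
  have hsub : Finset.univ.image v' ⊆ u := by
    intro e he
    obtain ⟨i, -, rfl⟩ := Finset.mem_image.1 he
    exact hu ⟨i, rfl⟩
  have hcard : (u.card : ℝ) = Module.finrank ℂ R := by
    rw [Module.finrank_eq_card_finset_basis b.toBasis]
  have horth : ∀ e ∈ u, ∀ e' ∈ u, e ≠ e' → ⟪(e : h), (e' : h)⟫_ℂ = 0 := by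
    intro e he e' he' hne
    have h1 := b.orthonormal.2 (i := ⟨e, he⟩) (j := ⟨e', he'⟩)
      (fun h2 => hne (congrArg Subtype.val h2))
    rw [hb] at h1
    exact h1
  have hnorm : ∀ e ∈ u, ‖(e : h)‖ = 1 := by
    intro e he
    have h1 := b.orthonormal.1 ⟨e, he⟩
    rw [hb] at h1
    exact h1
  rw [htr, Complex.re_sum, hsum, ← Finset.sum_sdiff hsub, add_sub_cancel_right]
  calc _ ≤ ∑ e ∈ u \ Finset.univ.image v', |(⟪(e : h), X e⟫_ℂ).re| :=
        Finset.abs_sum_le_sum_abs _ _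
    _ ≤ ∑ e ∈ u \ Finset.univ.image v', c := by
        refine Finset.sum_le_sum fun e he => ?_
        rw [Finset.mem_sdiff] at he
        have h1 := hc e fun i => horth (v' i) (hsub (Finset.mem_image_of_mem _ (Finset.mem_univ i)))
          e he.1 (by rintro rfl; exact he.2 (Finset.mem_image_of_mem _ (Finset.mem_univ i)))
        rwa [hnorm e he.1, one_pow, mul_one] at h1
    _ ≤ c * u.card := by
        rw [Finset.sum_const, nsmul_eq_mul, mul_comm]
        gcongr
        exact Finset.sdiff_subset
    _ = _ := by rw [hcard]

/-- Two orthonormal systems which carry `X` up to `c` give nearly the same diagonal sum. -/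
theorem abs_sum_inner_sub_le {ι κ : Type*} [Fintype ι] [Fintype κ] (X : h →L[ℂ] h)
    {v : ι → h} (hv : Orthonormal ℂ v) {w : κ → h} (hw : Orthonormal ℂ w) {c : ℝ}
    (hc0 : 0 ≤ c) (hcv : ∀ u, (∀ i, ⟪v i, u⟫_ℂ = 0) → |(⟪u, X u⟫_ℂ).re| ≤ c * ‖u‖ ^ 2)
    (hcw : ∀ u, (∀ i, ⟪w i, u⟫_ℂ = 0) → |(⟪u, X u⟫_ℂ).re| ≤ c * ‖u‖ ^ 2) :
    |∑ i, (⟪v i, X (v i)⟫_ℂ).re - ∑ i, (⟪w i, X (w i)⟫_ℂ).re|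
      ≤ 2 * c * (Fintype.card ι + Fintype.card κ) := by
  classical
  -- Both diagonal sums are compared with the same number, the trace of the compression to the joint
  -- span.
  let R : Submodule ℂ h := Submodule.span ℂ (range (Sum.elim v w))
  have hRf : FiniteDimensional ℂ R := FiniteDimensional.span_of_finite ℂ (finite_range _)
  have hcard : (Module.finrank ℂ R : ℝ) ≤ Fintype.card ι + Fintype.card κ := by
    have := finrank_range_le_card (R := ℂ) (Sum.elim v w)
    rw [Fintype.card_sum] at this
    exact_mod_cast this
  have h1 := abs_trace_compression_sub_le X R hv
    (fun i => Submodule.subset_span ⟨Sum.inl i, rfl⟩) hc0 hcv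
  have h2 := abs_trace_compression_sub_le X R hw
    (fun i => Submodule.subset_span ⟨Sum.inr i, rfl⟩) hc0 hcw
  have h3 : c * Module.finrank ℂ R ≤ c * (Fintype.card ι + Fintype.card κ) := by gcongr
  rw [abs_le] at h1 h2 ⊢
  constructor <;> linarith [h1.1, h1.2, h2.1, h2.2]

end

/-! ### Eigenvalues of positive and negative parts against diagonal values -/

section

variable {h : Type*} [NormedAddCommGroup h] [InnerProductSpace ℂ h] [CompleteSpace h]

/-- The eigenvalues of the positive part of `X` are bounded by the values of the quadratic form of
`X` off the first vectors of any orthonormal sequence. -/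
theorem posPart_eigenvalue_le {X : h →L[ℂ] h} (hX : IsSelfAdjoint X) {f g : ℕ → h} {ν : ℕ → ℝ}
    {C : ℝ} (hC0 : 0 ≤ C)
    (hC : ∀ N v, (∀ i < N, ⟪f i, v⟫_ℂ = 0) → |(⟪v, X v⟫_ℂ).re| ≤ C / (N + 1) * ‖v‖ ^ 2)
    (hg : Orthonormal ℂ g) (hY : ∀ n, X⁺ (g n) = (ν n : ℂ) • g n)
    (hbd : ∀ n v, (∀ i < n, ⟪g i, v⟫_ℂ = 0) → ‖X⁺ v‖ ≤ ν n * ‖v‖) (N : ℕ) :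
    ν N ≤ C / (N + 1) := by
  have h0 := eigenvalue_nonneg_of_bound hg hbd
  have hanti := eigenvalue_antitone_of_bound hg hY hbd
  rcases (h0 N).eq_or_lt with h1 | h1
  · rw [← h1]; positivity
  -- When `ν N > 0`, the first `N + 1` eigenvectors of `X⁺` are eigenvectors of `X` itself. Some
  -- nonzero vector of their span is orthogonal to `f_0, …, f_{N-1}`, and there both bounds on the
  -- quadratic form of `X` apply.
  · let G : h →ₗ[ℂ] (Fin N → ℂ) := LinearMap.pi fun i => innerₛₗ ℂ (f i)
    have hG : LinearMap.rank G ≤ (N : Cardinal) := by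
      refine (Submodule.rank_le _).trans ?_
      simp
    obtain ⟨v, hv0, hGv, hv⟩ := exists_ker_rayleigh_ge (Y := X) hg
      (fun i hi => apply_eq_of_posPart_eigenvector hX (h1.trans_le (hanti hi)) (hY i))
      (fun i hi => hanti hi) G hG
    have h2 : ∀ i < N, ⟪f i, v⟫_ℂ = 0 := fun i hi => congrFun hGv ⟨i, hi⟩
    have h3 := hv.trans ((le_abs_self _).trans (hC N v h2))
    exact le_of_mul_le_mul_right h3 (by have := norm_pos_iff.2 hv0; positivity)

/-- Only the eigenvectors of nonzero eigenvalues are needed to control a positive operator. -/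
theorem norm_apply_le_of_orthogonal_pos {Y : h →L[ℂ] h} {g : ℕ → h} {ν : ℕ → ℝ}
    (hg : Orthonormal ℂ g)
    (hbd : ∀ n v, (∀ i < n, ⟪g i, v⟫_ℂ = 0) → ‖Y v‖ ≤ ν n * ‖v‖) {N : ℕ} {v : h}
    (hv : ∀ i < N, 0 < ν i → ⟪g i, v⟫_ℂ = 0) : ‖Y v‖ ≤ ν N * ‖v‖ := by
  have h0 := eigenvalue_nonneg_of_bound hg hbd
  by_cases hex : ∃ i < N, ν i ≤ 0
  · classical
    -- At the first index with `ν ≤ 0` all earlier eigenvalues are positive, so the bound there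
    -- needs only the assumed orthogonality.
    have hm := Nat.find_spec hex
    have h1 := hbd (Nat.find hex) v fun i hi => hv i (hi.trans hm.1) (by
      by_contra hcon
      exact Nat.find_min hex hi ⟨hi.trans hm.1, not_lt.1 hcon⟩)
    refine h1.trans (mul_le_mul_of_nonneg_right (hm.2.trans (h0 N)) (norm_nonneg _))
  · push Not at hex
    exact hbd N v fun i hi => hv i hi (hex i hi)

theorem sum_subtype_pos {ν : ℕ → ℝ} (hν : ∀ n, 0 ≤ ν n) (N : ℕ)
    [Fintype {i : Fin N // 0 < ν i}] :
    ∑ i : {i : Fin N // 0 < ν i}, ν i.1 = ∑ n ∈ Finset.range N, ν n := by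
  classical
  rw [Finset.sum_range, ← Finset.sum_subtype (Finset.univ.filter fun i : Fin N => 0 < ν i)
    (by simp) (fun i : Fin N => ν i)]
  exact Finset.sum_filter_of_ne fun i _ hi => (hν i).lt_of_ne' hi

/-- For a self-adjoint compact operator, the difference of the sums of the singular numbers of the
positive and negative parts is, up to a bounded error, the sum of the diagonal values along an
orthonormal sequence adapted to the operator. -/
theorem abs_sum_inner_sub_singularNumber_le (hinf : ¬ FiniteDimensional ℂ h) {X : h →L[ℂ] h}
    (hX : IsSelfAdjoint X) (hXc : IsCompactOperator X) {f : ℕ → h} (hf : Orthonormal ℂ f)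
    {C : ℝ} (hC0 : 0 ≤ C)
    (hC : ∀ N v, (∀ i < N, ⟪f i, v⟫_ℂ = 0) → |(⟪v, X v⟫_ℂ).re| ≤ C / (N + 1) * ‖v‖ ^ 2) (N : ℕ) :
    |∑ n ∈ Finset.range N, (⟪f n, X (f n)⟫_ℂ).re - (∑ n ∈ Finset.range N, singularNumber n X⁺ -
      ∑ n ∈ Finset.range N, singularNumber n X⁻)| ≤ 6 * C := by
  classical
  have hpp : (X⁺).IsPositive :=
    (ContinuousLinearMap.nonneg_iff_isPositive _).1 (CFC.posPart_nonneg X)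
  have hpm : (X⁻).IsPositive :=
    (ContinuousLinearMap.nonneg_iff_isPositive _).1 (CFC.negPart_nonneg X)
  have hXn : IsSelfAdjoint (-X) := hX.neg
  have hneg : X⁻ = (-X)⁺ := (CFC.posPart_neg X).symm
  have hcp : IsCompactOperator (X⁺ : h →L[ℂ] h) :=
    IsCompactOperator.of_norm_apply_le hXc (norm_posPart_apply_le hX)
  have hcm : IsCompactOperator (X⁻ : h →L[ℂ] h) := by
    rw [hneg]
    exact IsCompactOperator.of_norm_apply_le hXc fun v => by
      simpa using norm_posPart_apply_le hXn v
  obtain ⟨g, ν, hg, hgY, hgb⟩ := exists_decreasing_eigensequence hinf hcp hpp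
  obtain ⟨k, μ, hk, hkY, hkb⟩ := exists_decreasing_eigensequence hinf hcm hpm
  have hν0 := eigenvalue_nonneg_of_bound hg hgb
  have hμ0 := eigenvalue_nonneg_of_bound hk hkb
  have hνN := posPart_eigenvalue_le hX hC0 hC hg hgY hgb N
  have hμN : μ N ≤ C / (N + 1) := by
    refine posPart_eigenvalue_le hXn (f := f) (g := k) hC0 (fun N v hv => ?_) hk ?_ ?_ N
    · simpa using hC N v hv
    · rw [← hneg]; exact hkY
    · rw [← hneg]; exact hkb
  have hXg : ∀ i, 0 < ν i → X (g i) = (ν i : ℂ) • g i := fun i hi =>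
    apply_eq_of_posPart_eigenvector hX hi (hgY i)
  have hXk : ∀ i, 0 < μ i → X (k i) = -((μ i : ℂ) • k i) := fun i hi => by
    have h1 := apply_eq_of_posPart_eigenvector hXn hi (by rw [← hneg]; exact hkY i)
    rw [← h1]; simp
  have hgk : ∀ i j, 0 < ν i → 0 < μ j → ⟪g i, k j⟫_ℂ = 0 := by
    intro i j hi hj
    have h1 : ⟪X⁺ (g i), X⁻ (k j)⟫_ℂ = 0 := by
      rw [hpp.inner_left_eq_inner_right, ← mul_apply_eq_comp, CFC.posPart_mul_negPart]
      simp
    rw [hgY, hkY, inner_smul_left, inner_smul_right] at h1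
    have h2 : (ν i : ℂ) ≠ 0 := by exact_mod_cast hi.ne'
    have h3 : (μ j : ℂ) ≠ 0 := by exact_mod_cast hj.ne'
    simpa [h2, h3] using h1
  -- Only positive eigenvalues are kept: eigenvectors of `X⁺` and `X⁻` for nonzero eigenvalues are
  -- mutually orthogonal, whereas those for the eigenvalue `0` need not be. Dropping zero
  -- eigenvalues does not change the sums.
  let P := {i : Fin N // 0 < ν i}
  let M := {i : Fin N // 0 < μ i}
  let w : P ⊕ M → h := Sum.elim (fun i => g i.1) (fun i => k i.1)
  have hw : Orthonormal ℂ w := by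
    refine ⟨?_, ?_⟩
    · rintro (i | i)
      · exact hg.1 _
      · exact hk.1 _
    · rintro (i | i) (j | j) hij
      · refine hg.2 fun h1 => hij ?_
        rw [Subtype.ext (Fin.ext h1)]
      · exact hgk _ _ i.2 j.2
      · exact inner_eq_zero_symm.1 (hgk _ _ j.2 i.2)
      · refine hk.2 fun h1 => hij ?_
        rw [Subtype.ext (Fin.ext h1)]
  have hcN : 0 ≤ C / ((N : ℝ) + 1) := by positivity
  have hbw : ∀ u, (∀ i, ⟪w i, u⟫_ℂ = 0) → |(⟪u, X u⟫_ℂ).re| ≤ C / ((N : ℝ) + 1) * ‖u‖ ^ 2 := by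
    intro u hu
    have h1 : ‖X⁺ u‖ ≤ ν N * ‖u‖ := norm_apply_le_of_orthogonal_pos hg hgb
      fun i hi hpos => hu (Sum.inl ⟨⟨i, hi⟩, hpos⟩)
    have h2 : ‖X⁻ u‖ ≤ μ N * ‖u‖ := norm_apply_le_of_orthogonal_pos hk hkb
      fun i hi hpos => hu (Sum.inr ⟨⟨i, hi⟩, hpos⟩)
    have h3 : ∀ Y : h →L[ℂ] h, (⟪u, Y u⟫_ℂ).re ≤ ‖u‖ * ‖Y u‖ := fun Y =>
      (Complex.re_le_norm _).trans (norm_inner_le_norm _ _)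
    have h4 : (⟪u, X u⟫_ℂ).re = (⟪u, X⁺ u⟫_ℂ).re - (⟪u, X⁻ u⟫_ℂ).re := by
      conv_lhs => rw [← CFC.posPart_sub_negPart X hX]
      simp
    have h5 : 0 ≤ (⟪u, X⁺ u⟫_ℂ).re := hpp.re_inner_nonneg_right u
    have h6 : 0 ≤ (⟪u, X⁻ u⟫_ℂ).re := hpm.re_inner_nonneg_right u
    have h7 : ‖u‖ * ‖X⁺ u‖ ≤ C / ((N : ℝ) + 1) * ‖u‖ ^ 2 := by
      calc ‖u‖ * ‖X⁺ u‖ ≤ ‖u‖ * (C / ((N : ℝ) + 1) * ‖u‖) := by gcongr; exact h1.trans (by gcongr)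
        _ = _ := by ring
    have h8 : ‖u‖ * ‖X⁻ u‖ ≤ C / ((N : ℝ) + 1) * ‖u‖ ^ 2 := by
      calc ‖u‖ * ‖X⁻ u‖ ≤ ‖u‖ * (C / ((N : ℝ) + 1) * ‖u‖) := by gcongr; exact h2.trans (by gcongr)
        _ = _ := by ring
    rw [h4, abs_le]
    constructor <;> linarith [h3 X⁺, h3 X⁻]
  have hf' : Orthonormal ℂ (fun i : Fin N => f i) := hf.comp _ Fin.val_injective
  have hbf : ∀ u, (∀ i : Fin N, ⟪f i, u⟫_ℂ = 0) →
      |(⟪u, X u⟫_ℂ).re| ≤ C / ((N : ℝ) + 1) * ‖u‖ ^ 2 := fun u hu => hC N u fun i hi => hu ⟨i, hi⟩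
  have hmain := abs_sum_inner_sub_le X hf' hw hcN hbf hbw
  have hsw : ∑ i, (⟪w i, X (w i)⟫_ℂ).re = ∑ n ∈ Finset.range N, singularNumber n X⁺ -
      ∑ n ∈ Finset.range N, singularNumber n X⁻ := by
    have hval : ∀ (x : h) (r : ℝ), ‖x‖ = 1 → (⟪x, (r : ℂ) • x⟫_ℂ).re = r := by
      intro x r hx
      rw [inner_smul_right, inner_self_eq_norm_sq_to_K, hx]; simp
    rw [Fintype.sum_sum_type]
    have e1 : ∑ i : P, (⟪w (Sum.inl i), X (w (Sum.inl i))⟫_ℂ).re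
        = ∑ n ∈ Finset.range N, singularNumber n X⁺ := by
      have : ∀ i : P, (⟪w (Sum.inl i), X (w (Sum.inl i))⟫_ℂ).re = ν i.1 := fun i => by
        change (⟪g i.1, X (g i.1)⟫_ℂ).re = _
        rw [hXg _ i.2, hval _ _ (hg.1 _)]
      rw [Finset.sum_congr rfl fun i _ => this i, sum_subtype_pos hν0]
      exact Finset.sum_congr rfl fun n _ => (singularNumber_eq_eigenvalue hg hgY hgb n).symm
    have e2 : ∑ i : M, (⟪w (Sum.inr i), X (w (Sum.inr i))⟫_ℂ).re
        = - ∑ n ∈ Finset.range N, singularNumber n X⁻ := by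
      have : ∀ i : M, (⟪w (Sum.inr i), X (w (Sum.inr i))⟫_ℂ).re = - μ i.1 := fun i => by
        change (⟪k i.1, X (k i.1)⟫_ℂ).re = _
        rw [hXk _ i.2, inner_neg_right, Complex.neg_re, hval _ _ (hk.1 _)]
      rw [Finset.sum_congr rfl fun i _ => this i, Finset.sum_neg_distrib, sum_subtype_pos hμ0]
      exact congrArg _ (Finset.sum_congr rfl fun n _ =>
        (singularNumber_eq_eigenvalue hk hkY hkb n).symm)
    rw [e1, e2, sub_eq_add_neg]
  -- There are `N` vectors from `f` and at most `2N` from the two spectral systems; with the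
  -- threshold `C/(N+1)` this gives `2 · 3 · C`.
  have hcard : (Fintype.card (Fin N) : ℝ) + Fintype.card (P ⊕ M) ≤ 3 * N := by
    have h1 : Fintype.card P ≤ N := by simpa using Fintype.card_subtype_le (fun i : Fin N => 0 < ν i)
    have h2 : Fintype.card M ≤ N := by simpa using Fintype.card_subtype_le (fun i : Fin N => 0 < μ i)
    rw [Fintype.card_sum, Fintype.card_fin]
    have h1' : (Fintype.card P : ℝ) ≤ N := by exact_mod_cast h1
    have h2' : (Fintype.card M : ℝ) ≤ N := by exact_mod_cast h2
    push_cast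
    linarith
  rw [hsw, ← Finset.sum_range (fun n => (⟪f n, X (f n)⟫_ℂ).re)] at hmain
  refine hmain.trans ?_
  calc 2 * (C / ((N : ℝ) + 1)) * (Fintype.card (Fin N) + Fintype.card (P ⊕ M))
      ≤ 2 * (C / ((N : ℝ) + 1)) * (3 * ((N : ℝ) + 1)) := by gcongr; linarith
    _ = 6 * C := by field_simp; ring

theorem singularNumber_posPart_le (hinf : ¬ FiniteDimensional ℂ h) {X : h →L[ℂ] h}
    (hX : IsSelfAdjoint X) (hXc : IsCompactOperator X) {f : ℕ → h} {C : ℝ} (hC0 : 0 ≤ C)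
    (hC : ∀ N v, (∀ i < N, ⟪f i, v⟫_ℂ = 0) → |(⟪v, X v⟫_ℂ).re| ≤ C / (N + 1) * ‖v‖ ^ 2) (n : ℕ) :
    singularNumber n X⁺ ≤ C / (n + 1) := by
  obtain ⟨g, ν, hg, hgY, hgb⟩ := exists_decreasing_eigensequence hinf
    (IsCompactOperator.of_norm_apply_le hXc (norm_posPart_apply_le hX))
    ((ContinuousLinearMap.nonneg_iff_isPositive _).1 (CFC.posPart_nonneg X))
  rw [singularNumber_eq_eigenvalue hg hgY hgb n]
  exact posPart_eigenvalue_le hX hC0 hC hg hgY hgb n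

theorem singularNumber_negPart_le (hinf : ¬ FiniteDimensional ℂ h) {X : h →L[ℂ] h}
    (hX : IsSelfAdjoint X) (hXc : IsCompactOperator X) {f : ℕ → h} {C : ℝ} (hC0 : 0 ≤ C)
    (hC : ∀ N v, (∀ i < N, ⟪f i, v⟫_ℂ = 0) → |(⟪v, X v⟫_ℂ).re| ≤ C / (N + 1) * ‖v‖ ^ 2) (n : ℕ) :
    singularNumber n X⁻ ≤ C / (n + 1) := by
  rw [← CFC.posPart_neg X]
  refine singularNumber_posPart_le hinf hX.neg ?_ (f := f) hC0 (fun N v hv => ?_) n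
  · exact IsCompactOperator.of_norm_apply_le hXc fun v => by simp
  · simpa using hC N v hv

end

section

/-! ### Generalized limits of bounded sequences -/

theorem memLp_floor {u : ℕ → ℝ} {C : ℝ} (hu : ∀ n, |u n| ≤ C) :
    MemLp (fun t : ℝ => u ⌊t⌋₊) ∞ (volume.restrict (Ioi (0 : ℝ))) := by
  refine memLp_top_of_bound ?_ C (ae_of_all _ fun t => hu _)
  exact ((measurable_of_countable u).comp Nat.measurable_floor).aestronglyMeasurable

theorem omegaLim_eq (ω : LInfty →L[ℝ] ℝ) {u : ℕ → ℝ} {C : ℝ} (hu : ∀ n, |u n| ≤ C) :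
    omegaLim ω u = ω ((memLp_floor hu).toLp (fun t : ℝ => u ⌊t⌋₊)) := by
  rw [omegaLim, dif_pos (memLp_floor hu)]

theorem omegaLim_add (ω : LInfty →L[ℝ] ℝ) {u v : ℕ → ℝ} {C D : ℝ} (hu : ∀ n, |u n| ≤ C)
    (hv : ∀ n, |v n| ≤ D) : omegaLim ω (fun n => u n + v n) = omegaLim ω u + omegaLim ω v := by
  have huv : ∀ n, |u n + v n| ≤ C + D := fun n =>
    (abs_add_le _ _).trans (add_le_add (hu n) (hv n))
  rw [omegaLim_eq ω hu, omegaLim_eq ω hv, omegaLim_eq ω huv, ← map_add]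
  rfl

theorem omegaLim_const_mul (ω : LInfty →L[ℝ] ℝ) {u : ℕ → ℝ} {C : ℝ} (hu : ∀ n, |u n| ≤ C)
    (c : ℝ) : omegaLim ω (fun n => c * u n) = c * omegaLim ω u := by
  have hcu : ∀ n, |c * u n| ≤ |c| * C := fun n => by
    rw [abs_mul]; exact mul_le_mul_of_nonneg_left (hu n) (abs_nonneg c)
  rw [omegaLim_eq ω hu, omegaLim_eq ω hcu, ← smul_eq_mul c (ω _), ← map_smul]
  rfl

theorem omegaLim_sub (ω : LInfty →L[ℝ] ℝ) {u v : ℕ → ℝ} {C D : ℝ} (hu : ∀ n, |u n| ≤ C)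
    (hv : ∀ n, |v n| ≤ D) : omegaLim ω (fun n => u n - v n) = omegaLim ω u - omegaLim ω v := by
  have h1 := omegaLim_const_mul ω hv (-1)
  have h2 : ∀ n, |(-1) * v n| ≤ D := fun n => by simpa using hv n
  have h3 := omegaLim_add ω hu h2
  rw [h1] at h3
  rw [show (fun n => u n - v n) = fun n => u n + (-1) * v n by funext n; ring, h3]
  ring

theorem abs_omegaLim_le (ω : LInfty →L[ℝ] ℝ) {u : ℕ → ℝ} {C : ℝ} (hu : ∀ n, |u n| ≤ C) :
    |omegaLim ω u| ≤ ‖ω‖ * C := by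
  have hC : 0 ≤ C := (abs_nonneg _).trans (hu 0)
  rw [omegaLim_eq ω hu, ← Real.norm_eq_abs]
  refine (ω.le_opNorm _).trans (mul_le_mul_of_nonneg_left ?_ (norm_nonneg _))
  rw [Lp.norm_toLp]
  refine ENNReal.toReal_le_of_le_ofReal hC ?_
  rw [eLpNorm_exponent_top]
  exact eLpNormEssSup_le_of_ae_bound (ae_of_all _ fun t => hu _)

/-- A set of full measure meets every half-line, the latter having infinite measure. Without this
the essential liminf and limsup could not be compared with limits. -/
instance neBot_atTop_inf_ae : NeBot (atTop ⊓ ae (volume : Measure ℝ)) := by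
  rw [inf_neBot_iff]
  intro s hs t ht
  obtain ⟨a, ha⟩ := mem_atTop_sets.1 hs
  by_contra hne
  rw [not_nonempty_iff_eq_empty] at hne
  have h1 : Ioi a ⊆ tᶜ := fun x hx hxt => by
    have : x ∈ s ∩ t := ⟨ha x (le_of_lt hx), hxt⟩
    rw [hne] at this
    exact this
  have h2 : volume (Ioi a) = 0 := measure_mono_null h1 (mem_ae_iff.1 ht)
  simp at h2

theorem eventually_toLp_floor {u : ℕ → ℝ} {C : ℝ} (hu : ∀ n, |u n| ≤ C) :
    ∀ᶠ t in atTop ⊓ ae (volume : Measure ℝ),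
      ((memLp_floor hu).toLp (fun t : ℝ => u ⌊t⌋₊) : ℝ → ℝ) t = u ⌊t⌋₊ := by
  have h1 := (ae_restrict_iff' measurableSet_Ioi).1 (memLp_floor hu).coeFn_toLp
  have h2 : ∀ᶠ t : ℝ in atTop ⊓ ae (volume : Measure ℝ), 0 < t :=
    (eventually_gt_atTop 0).filter_mono inf_le_left
  have h3 := Eventually.filter_mono (inf_le_right : atTop ⊓ ae (volume : Measure ℝ) ≤ _) h1
  filter_upwards [h2, h3] with t ht ht'
  exact ht' ht

theorem omegaLim_nonneg {ω : LInfty →L[ℝ] ℝ} (hω : IsDixmierState ω) {u : ℕ → ℝ} {C : ℝ}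
    (hu : ∀ n, |u n| ≤ C) (h0 : ∀ n, 0 ≤ u n) : 0 ≤ omegaLim ω u := by
  rw [omegaLim_eq ω hu]
  refine le_trans ?_ (hω.limit _).1
  have h1 := eventually_toLp_floor hu
  refine le_liminf_of_le ?_ (h1.mono fun t ht => by rw [ht]; exact h0 _)
  -- The liminf is taken in `ℝ`, so it obeys lower bounds only once the function is known to be
  -- frequently bounded above.
  refine IsCobounded.mk C fun s hs => ?_
  obtain ⟨t, ht1, ht2⟩ := (h1.and (Filter.mem_map.1 hs)).exists
  refine ⟨_, ht2, ?_⟩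
  change _ ≤ C
  rw [ht1]
  exact (le_abs_self _).trans (hu _)

theorem omegaLim_of_tendsto {ω : LInfty →L[ℝ] ℝ} (hω : IsDixmierState ω) {u : ℕ → ℝ} {C c : ℝ}
    (hu : ∀ n, |u n| ≤ C) (hc : Tendsto u atTop (𝓝 c)) : omegaLim ω u = c := by
  rw [omegaLim_eq ω hu]
  have h1 : Tendsto ((memLp_floor hu).toLp (fun t : ℝ => u ⌊t⌋₊) : ℝ → ℝ)
      (atTop ⊓ ae (volume : Measure ℝ)) (𝓝 c) := by
    have h2 : Tendsto (fun t : ℝ => u ⌊t⌋₊) (atTop ⊓ ae (volume : Measure ℝ)) (𝓝 c) :=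
      (hc.comp tendsto_nat_floor_atTop).mono_left inf_le_left
    exact h2.congr' ((eventually_toLp_floor hu).mono fun t ht => ht.symm)
  have h3 := hω.limit ((memLp_floor hu).toLp (fun t : ℝ => u ⌊t⌋₊))
  rw [h1.liminf_eq, h1.limsup_eq] at h3
  exact le_antisymm h3.2 h3.1

/-- The sequence of logarithmic means of a sequence. -/
noncomputable def logMeanSeq (d : ℕ → ℝ) (N : ℕ) : ℝ :=
  (Real.log N)⁻¹ * ∑ n ∈ Finset.range N, d n

theorem sum_inv_succ_le (N : ℕ) : ∑ n ∈ Finset.range N, ((n : ℝ) + 1)⁻¹ ≤ 1 + Real.log N := by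
  have := harmonic_le_one_add_log N
  simpa [harmonic] using this

theorem abs_sum_le_of_le_div {d : ℕ → ℝ} {D : ℝ} (hD : 0 ≤ D)
    (hd : ∀ n, |d n| ≤ D / ((n : ℝ) + 1)) (N : ℕ) :
    |∑ n ∈ Finset.range N, d n| ≤ D * (1 + Real.log N) :=
  calc _ ≤ ∑ n ∈ Finset.range N, |d n| := Finset.abs_sum_le_sum_abs _ _
    _ ≤ ∑ n ∈ Finset.range N, D * ((n : ℝ) + 1)⁻¹ :=
        Finset.sum_le_sum fun n _ => by simpa [div_eq_mul_inv] using hd n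
    _ ≤ _ := by rw [← Finset.mul_sum]; exact mul_le_mul_of_nonneg_left (sum_inv_succ_le N) hD

/-- For `N ≥ 2` one has `log N ≥ log 2 > 1/2`, hence `1 + log N ≤ 3 log N`. For `N < 2` the mean is
`0`, because the inverse of `log N = 0` is `0`. -/
theorem abs_logMeanSeq_le {d : ℕ → ℝ} {D : ℝ} (hD : 0 ≤ D)
    (hd : ∀ n, |d n| ≤ D / ((n : ℝ) + 1)) (N : ℕ) : |logMeanSeq d N| ≤ 3 * D := by
  rcases lt_or_ge N 2 with h2 | h2
  · have : Real.log N = 0 := by interval_cases N <;> simp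
    rw [logMeanSeq, this]; simp [hD]
  · have h3 : 1 / 2 ≤ Real.log N := by
      have h4 : Real.log 2 ≤ Real.log N :=
        Real.log_le_log (by norm_num) (by exact_mod_cast h2)
      linarith [Real.log_two_gt_d9]
    rw [logMeanSeq, abs_mul, abs_inv, abs_of_pos (by linarith : 0 < Real.log N),
      inv_mul_le_iff₀ (by linarith)]
    refine (abs_sum_le_of_le_div hD hd N).trans ?_
    nlinarith

theorem tendsto_log_natCast_atTop : Tendsto (fun N : ℕ => Real.log N) atTop atTop :=
  Real.tendsto_log_atTop.comp tendsto_natCast_atTop_atTop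

theorem tendsto_inv_log_mul_of_bounded {u : ℕ → ℝ} {C : ℝ} (hu : ∀ N, |u N| ≤ C) :
    Tendsto (fun N : ℕ => (Real.log N)⁻¹ * u N) atTop (𝓝 0) := by
  have h1 : Tendsto (fun N : ℕ => (Real.log N)⁻¹) atTop (𝓝 0) :=
    tendsto_inv_atTop_zero.comp tendsto_log_natCast_atTop
  exact h1.zero_mul_isBoundedUnder_le
    ⟨C, Filter.eventually_map.2 (Eventually.of_forall fun N => by simpa using hu N)⟩

/-- A bounded difference of partial sums tends to `0` after division by `log N`, and the generalized
limit agrees with ordinary limits. -/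
theorem omegaLim_logMeanSeq_congr {ω : LInfty →L[ℝ] ℝ} (hω : IsDixmierState ω) {d e : ℕ → ℝ}
    {D C : ℝ} (hD : 0 ≤ D) (hd : ∀ n, |d n| ≤ D / ((n : ℝ) + 1))
    (he : ∀ n, |e n| ≤ D / ((n : ℝ) + 1))
    (hde : ∀ N, |∑ n ∈ Finset.range N, d n - ∑ n ∈ Finset.range N, e n| ≤ C) :
    omegaLim ω (logMeanSeq d) = omegaLim ω (logMeanSeq e) := by
  have h1 := omegaLim_sub ω (abs_logMeanSeq_le hD hd) (abs_logMeanSeq_le hD he)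
  have h2 : Tendsto (fun N => logMeanSeq d N - logMeanSeq e N) atTop (𝓝 0) := by
    simp only [logMeanSeq, ← mul_sub]
    exact tendsto_inv_log_mul_of_bounded hde
  have h3 : ∀ N, |logMeanSeq d N - logMeanSeq e N| ≤ 3 * D + 3 * D := fun N =>
    (abs_sub _ _).trans (add_le_add (abs_logMeanSeq_le hD hd N) (abs_logMeanSeq_le hD he N))
  rw [omegaLim_of_tendsto hω h3 h2] at h1
  linarith

variable {h : Type*} [NormedAddCommGroup h] [InnerProductSpace ℂ h] [CompleteSpace h]

/-- The Dixmier trace of a self-adjoint operator is the generalized limit of the logarithmic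
means of its diagonal values along an adapted orthonormal sequence. -/
theorem dixmierTracePos_sub_eq (hinf : ¬ FiniteDimensional ℂ h) {ω : LInfty →L[ℝ] ℝ}
    (hω : IsDixmierState ω) {X : h →L[ℂ] h}
    (hX : IsSelfAdjoint X) (hXc : IsCompactOperator X) {f : ℕ → h} (hf : Orthonormal ℂ f)
    {C : ℝ} (hC0 : 0 ≤ C)
    (hC : ∀ N v, (∀ i < N, ⟪f i, v⟫_ℂ = 0) → |(⟪v, X v⟫_ℂ).re| ≤ C / (N + 1) * ‖v‖ ^ 2) :
    dixmierTracePos ω X⁺ - dixmierTracePos ω X⁻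
      = omegaLim ω (logMeanSeq fun n => (⟪f n, X (f n)⟫_ℂ).re) := by
  have hp : ∀ n, |singularNumber n X⁺| ≤ C / ((n : ℝ) + 1) := fun n => by
    rw [abs_of_nonneg (singularNumber_nonneg _ _)]
    exact singularNumber_posPart_le hinf hX hXc hC0 hC n
  have hm : ∀ n, |singularNumber n X⁻| ≤ C / ((n : ℝ) + 1) := fun n => by
    rw [abs_of_nonneg (singularNumber_nonneg _ _)]
    exact singularNumber_negPart_le hinf hX hXc hC0 hC n
  have hd : ∀ n, |(⟪f n, X (f n)⟫_ℂ).re| ≤ C / ((n : ℝ) + 1) := fun n => by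
    have h1 := hC n (f n) fun i hi => hf.2 hi.ne
    rwa [hf.1 n, one_pow, mul_one] at h1
  have h1 : dixmierTracePos ω X⁺ = omegaLim ω (logMeanSeq fun n => singularNumber n X⁺) := rfl
  have h2 : dixmierTracePos ω X⁻ = omegaLim ω (logMeanSeq fun n => singularNumber n X⁻) := rfl
  rw [h1, h2, ← omegaLim_sub ω (abs_logMeanSeq_le hC0 hp) (abs_logMeanSeq_le hC0 hm)]
  have h3 : (fun N => logMeanSeq (fun n => singularNumber n X⁺) N
      - logMeanSeq (fun n => singularNumber n X⁻) N)
      = logMeanSeq fun n => singularNumber n X⁺ - singularNumber n X⁻ := by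
    funext N
    simp only [logMeanSeq, Finset.sum_sub_distrib, mul_sub]
  rw [h3]
  symm
  refine omegaLim_logMeanSeq_congr hω (D := 2 * C) (C := 6 * C) (by positivity) (fun n => ?_)
    (fun n => ?_) fun N => ?_
  · refine (hd n).trans ?_
    gcongr
    linarith
  · refine (abs_sub _ _).trans ((add_le_add (hp n) (hm n)).trans (le_of_eq (by ring)))
  · rw [Finset.sum_sub_distrib]
    exact abs_sum_inner_sub_singularNumber_le hinf hX hXc hf hC0 hC N

end

section

variable {h : Type*} [NormedAddCommGroup h] [InnerProductSpace ℂ h] [CompleteSpace h]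
variable {ι κ : Type*}

/-! ### Hilbert–Schmidt sums -/

/-- The squared Hilbert–Schmidt norm of `T`, computed in the basis `b`. -/
noncomputable def hsSum (b : HilbertBasis ι ℂ h) (T : h →L[ℂ] h) : ℝ≥0∞ :=
  ∑' i, ‖T (b i)‖ₑ ^ 2

theorem hasSum_norm_inner_sq (b : HilbertBasis ι ℂ h) (x : h) :
    HasSum (fun i => ‖⟪b i, x⟫_ℂ‖ ^ 2) (‖x‖ ^ 2) := by
  have h1 := b.hasSum_inner_mul_inner x x
  rw [inner_self_eq_norm_sq_to_K] at h1
  have h2 : ∀ i, ⟪x, b i⟫_ℂ * ⟪b i, x⟫_ℂ = ((‖⟪b i, x⟫_ℂ‖ ^ 2 : ℝ) : ℂ) := fun i => by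
    rw [← inner_conj_symm, mul_comm, Complex.mul_conj, Complex.normSq_eq_norm_sq]
  simp only [h2] at h1
  have h3 := Complex.hasSum_re h1
  simp only [Complex.ofReal_re] at h3
  convert h3 using 1
  rw [← Complex.ofReal_re (‖x‖ ^ 2)]
  push_cast
  rfl

theorem tsum_enorm_inner_sq (b : HilbertBasis ι ℂ h) (x : h) :
    ∑' i, ‖⟪b i, x⟫_ℂ‖ₑ ^ 2 = ‖x‖ₑ ^ 2 := by
  have h1 := hasSum_norm_inner_sq b x
  have h2 := ENNReal.ofReal_tsum_of_nonneg (fun i => by positivity) h1.summable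
  rw [h1.tsum_eq] at h2
  simp only [ENNReal.ofReal_pow (norm_nonneg _), ofReal_norm] at h2
  exact h2.symm

/-- Both sides are the double sum of `|⟪b' j, T (b i)⟫|²`, by Parseval and Tonelli. Allowing two
different bases here yields basis independence at once. -/
theorem hsSum_adjoint (b : HilbertBasis ι ℂ h) (b' : HilbertBasis κ ℂ h) (T : h →L[ℂ] h) :
    hsSum b' (ContinuousLinearMap.adjoint T) = hsSum b T := by
  calc ∑' j, ‖ContinuousLinearMap.adjoint T (b' j)‖ₑ ^ 2
      = ∑' j, ∑' i, ‖⟪b i, ContinuousLinearMap.adjoint T (b' j)⟫_ℂ‖ₑ ^ 2 :=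
        tsum_congr fun j => (tsum_enorm_inner_sq b _).symm
    _ = ∑' i, ∑' j, ‖⟪b i, ContinuousLinearMap.adjoint T (b' j)⟫_ℂ‖ₑ ^ 2 := ENNReal.tsum_comm
    _ = ∑' i, ∑' j, ‖⟪b' j, T (b i)⟫_ℂ‖ₑ ^ 2 := by
        refine tsum_congr fun i => tsum_congr fun j => ?_
        rw [ContinuousLinearMap.adjoint_inner_right, ← ofReal_norm, ← ofReal_norm,
          norm_inner_symm]
    _ = ∑' i, ‖T (b i)‖ₑ ^ 2 := tsum_congr fun i => tsum_enorm_inner_sq b' _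

theorem hsSum_basis_indep (b : HilbertBasis ι ℂ h) (b' : HilbertBasis κ ℂ h) (T : h →L[ℂ] h) :
    hsSum b T = hsSum b' T := by
  rw [← hsSum_adjoint b b', hsSum_adjoint b' b']

theorem hsSum_mul_le_left (b : HilbertBasis ι ℂ h) (A B : h →L[ℂ] h) :
    hsSum b (A * B) ≤ ‖A‖ₑ ^ 2 * hsSum b B := by
  unfold hsSum
  rw [← ENNReal.tsum_mul_left]
  refine ENNReal.tsum_le_tsum fun i => ?_
  rw [← mul_pow]
  gcongr
  exact A.le_opENorm _

theorem hsSum_mul_le_right (b : HilbertBasis ι ℂ h) (A B : h →L[ℂ] h) :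
    hsSum b (A * B) ≤ ‖B‖ₑ ^ 2 * hsSum b A := by
  have h1 : ContinuousLinearMap.adjoint (A * B)
      = ContinuousLinearMap.adjoint B * ContinuousLinearMap.adjoint A :=
    ContinuousLinearMap.adjoint_comp A B
  have h2 : ‖ContinuousLinearMap.adjoint B‖ₑ = ‖B‖ₑ := by
    rw [← ofReal_norm, ← ofReal_norm, LinearIsometryEquiv.norm_map]
  rw [← hsSum_adjoint b b, h1, ← hsSum_adjoint b b A, ← h2]
  exact hsSum_mul_le_left b _ _

theorem sum_norm_sq_le_of_hsSum_le {b : HilbertBasis ι ℂ h} {T : h →L[ℂ] h} {c : ℝ} (hc : 0 ≤ c)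
    (hT : hsSum b T ≤ ENNReal.ofReal c) (F : Finset ι) : ∑ i ∈ F, ‖T (b i)‖ ^ 2 ≤ c := by
  have h1 := (ENNReal.sum_le_tsum F).trans hT
  rw [← ENNReal.ofReal_le_ofReal_iff hc, ENNReal.ofReal_sum_of_nonneg fun i _ => by positivity]
  simpa only [ENNReal.ofReal_pow (norm_nonneg _), ofReal_norm] using h1

theorem summable_norm_sq_of_hsSum_ne_top {b : HilbertBasis ι ℂ h} {T : h →L[ℂ] h}
    (hT : hsSum b T ≠ ∞) : Summable fun i => ‖T (b i)‖ ^ 2 := by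
  refine summable_of_sum_le (c := (hsSum b T).toReal) (fun i => by positivity)
    (sum_norm_sq_le_of_hsSum_le ENNReal.toReal_nonneg ?_)
  rw [ENNReal.ofReal_toReal hT]

theorem norm_inner_le_weighted (x y : h) {t : ℝ} (ht : 0 < t) :
    ‖⟪x, y⟫_ℂ‖ ≤ (t * ‖x‖ ^ 2 + t⁻¹ * ‖y‖ ^ 2) / 2 := by
  refine (norm_inner_le_norm x y).trans ?_
  have h1 : (t * ‖x‖ ^ 2 + t⁻¹ * ‖y‖ ^ 2) / 2 - ‖x‖ * ‖y‖ = t⁻¹ * (t * ‖x‖ - ‖y‖) ^ 2 / 2 := by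
    field_simp; ring
  have h2 : 0 ≤ t⁻¹ * (t * ‖x‖ - ‖y‖) ^ 2 / 2 := by positivity
  linarith

/-- The trace of the product of two Hilbert–Schmidt operators does not depend on the basis. -/
theorem hasSum_inner_of_hsSum_ne_top (b : HilbertBasis ι ℂ h) (b' : HilbertBasis κ ℂ h)
    {A B : h →L[ℂ] h} (hA : hsSum b A ≠ ∞) (hB : hsSum b B ≠ ∞) :
    HasSum (fun i => ⟪A (b i), B (b i)⟫_ℂ)
      (∑' j, ⟪ContinuousLinearMap.adjoint B (b' j), ContinuousLinearMap.adjoint A (b' j)⟫_ℂ) := by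
  have hsq : ∀ {T : h →L[ℂ] h}, hsSum b T ≠ ∞ →
      Summable fun p : ι × κ => ‖⟪b' p.2, T (b p.1)⟫_ℂ‖ ^ 2 := by
    intro T hT
    refine (summable_prod_of_nonneg (f := fun p : ι × κ => ‖⟪b' p.2, T (b p.1)⟫_ℂ‖ ^ 2)
      (fun p => sq_nonneg _)).2 ⟨fun i => (hasSum_norm_inner_sq b' (T (b i))).summable, ?_⟩
    have h1 : (fun i => ∑' j, ‖⟪b' j, T (b i)⟫_ℂ‖ ^ 2) = fun i => ‖T (b i)‖ ^ 2 :=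
      funext fun i => (hasSum_norm_inner_sq b' (T (b i))).tsum_eq
    rw [h1]
    exact summable_norm_sq_of_hsSum_ne_top hT
  -- Absolute summability of the double series, from `2xy ≤ x² + y²` and the two Hilbert–Schmidt
  -- sums, is what permits exchanging the bases.
  have hS : Summable fun p : ι × κ => ⟪A (b p.1), b' p.2⟫_ℂ * ⟪b' p.2, B (b p.1)⟫_ℂ := by
    refine Summable.of_norm_bounded (((hsq hA).add (hsq hB)).div_const 2) fun p => ?_
    rw [norm_mul, norm_inner_symm]
    nlinarith [sq_nonneg (‖⟪b' p.2, A (b p.1)⟫_ℂ‖ - ‖⟪b' p.2, B (b p.1)⟫_ℂ‖)]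
  have h1 : ∀ i, HasSum (fun j => ⟪A (b i), b' j⟫_ℂ * ⟪b' j, B (b i)⟫_ℂ) ⟪A (b i), B (b i)⟫_ℂ :=
    fun i => b'.hasSum_inner_mul_inner _ _
  have h2 : ∀ j, HasSum (fun i => ⟪A (b i), b' j⟫_ℂ * ⟪b' j, B (b i)⟫_ℂ)
      ⟪ContinuousLinearMap.adjoint B (b' j), ContinuousLinearMap.adjoint A (b' j)⟫_ℂ := by
    intro j
    have h3 : (fun i => ⟪A (b i), b' j⟫_ℂ * ⟪b' j, B (b i)⟫_ℂ)
        = fun i => ⟪ContinuousLinearMap.adjoint B (b' j), b i⟫_ℂ *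
          ⟪b i, ContinuousLinearMap.adjoint A (b' j)⟫_ℂ := by
      funext i
      rw [ContinuousLinearMap.adjoint_inner_left, ContinuousLinearMap.adjoint_inner_right, mul_comm]
    rw [h3]
    exact b.hasSum_inner_mul_inner _ _
  have h3 := hS.hasSum.prod_fiberwise h1
  have h4 := hS.prod_symm.hasSum.prod_fiberwise h2
  have h5 : ∑' p : κ × ι, ⟪A (b p.swap.1), b' p.swap.2⟫_ℂ * ⟪b' p.swap.2, B (b p.swap.1)⟫_ℂ
      = ∑' p : ι × κ, ⟪A (b p.1), b' p.2⟫_ℂ * ⟪b' p.2, B (b p.1)⟫_ℂ :=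
    (Equiv.prodComm κ ι).tsum_eq
      (fun p : ι × κ => ⟪A (b p.1), b' p.2⟫_ℂ * ⟪b' p.2, B (b p.1)⟫_ℂ)
  rw [h4.tsum_eq, h5]
  exact h3

/-! ### Trace class operators -/

theorem norm_apply_eq_norm_abs_apply (T : h →L[ℂ] h) (x : h) : ‖T x‖ = ‖CFC.abs T x‖ := by
  have h1 : ‖T x‖ ^ 2 = ‖CFC.abs T x‖ ^ 2 := by
    have hsa : IsSelfAdjoint (CFC.abs T) := IsSelfAdjoint.of_nonneg (CFC.abs_nonneg T)
    have h2 : ⟪T x, T x⟫_ℂ = ⟪CFC.abs T x, CFC.abs T x⟫_ℂ := by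
      rw [← ContinuousLinearMap.adjoint_inner_right, ← ContinuousLinearMap.adjoint_inner_right,
        ← ContinuousLinearMap.star_eq_adjoint, ← ContinuousLinearMap.star_eq_adjoint,
        hsa.star_eq, ← mul_apply_eq_comp, ← mul_apply_eq_comp, CFC.abs_mul_abs]
    rw [inner_self_eq_norm_sq_to_K, inner_self_eq_norm_sq_to_K] at h2
    exact Complex.ofReal_injective (by push_cast; exact h2)
  exact (sq_eq_sq₀ (norm_nonneg _) (norm_nonneg _)).1 h1

/-- Approximate polar decomposition. -/
theorem exists_approx_polar (T : h →L[ℂ] h) {ε : ℝ} (hε : 0 < ε) :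
    ∃ V : h →L[ℂ] h, ‖V‖ ≤ 1 ∧
      ∀ x, ‖x‖ = 1 → (⟪x, CFC.abs T x⟫_ℂ).re ≤ (⟪V x, T x⟫_ℂ).re + ε := by
  set P := CFC.abs T with hP
  have hP0 : 0 ≤ P := CFC.abs_nonneg T
  have hsa : IsSelfAdjoint P := IsSelfAdjoint.of_nonneg hP0
  have hspec : ∀ x ∈ spectrum ℝ P, 0 ≤ x := fun x hx => spectrum_nonneg_of_nonneg hP0 hx
  have hcont : ContinuousOn (fun x : ℝ => (x + ε)⁻¹) (spectrum ℝ P) :=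
    ContinuousOn.inv₀ (by fun_prop) fun x hx => by have := hspec x hx; positivity
  -- With `V = T(|T| + ε)⁻¹` one gets `V* T = |T|(|T| + ε)⁻¹|T|`, which differs from `|T|` by
  -- `ε|T|/(|T| + ε) ≤ ε`. This replaces the partial isometry of the exact polar decomposition.
  set R := cfc (fun x : ℝ => (x + ε)⁻¹) P with hR
  have hRsa : IsSelfAdjoint R := cfc_predicate _ _
  have hPR : P * R = cfc (fun x : ℝ => x * (x + ε)⁻¹) P := by
    rw [cfc_mul (fun x : ℝ => x) _ P (by fun_prop) hcont, cfc_id' ℝ P]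
  have hPRP : P * R * P = cfc (fun x : ℝ => x * (x + ε)⁻¹ * x) P := by
    rw [cfc_mul (fun x : ℝ => x * (x + ε)⁻¹) (fun x => x) P
      (continuousOn_id.mul hcont) (by fun_prop), ← hPR, cfc_id' ℝ P]
  have hdiff : P - P * R * P = cfc (fun x : ℝ => x - x * (x + ε)⁻¹ * x) P := by
    rw [cfc_sub (fun x : ℝ => x) (fun x : ℝ => x * (x + ε)⁻¹ * x) P (by fun_prop)
      ((continuousOn_id.mul hcont).mul continuousOn_id), ← hPRP, cfc_id' ℝ P]
  have hn1 : ‖P * R‖ ≤ 1 := by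
    rw [hPR]
    refine norm_cfc_le zero_le_one fun x hx => ?_
    have h0 := hspec x hx
    rw [Real.norm_of_nonneg (by positivity), ← div_eq_mul_inv, div_le_one (by positivity)]
    linarith
  have hn2 : ‖P - P * R * P‖ ≤ ε := by
    rw [hdiff]
    refine norm_cfc_le hε.le fun x hx => ?_
    have h0 := hspec x hx
    have h1 : x - x * (x + ε)⁻¹ * x = ε * (x / (x + ε)) := by field_simp; ring
    rw [h1, Real.norm_of_nonneg (by positivity)]
    refine mul_le_of_le_one_right hε.le ?_
    rw [div_le_one (by positivity)]
    linarith
  have hcomm : Commute P R := by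
    have := cfc_commute_cfc (fun x : ℝ => x) (fun x : ℝ => (x + ε)⁻¹) P
    rwa [cfc_id' ℝ P] at this
  refine ⟨T * R, ContinuousLinearMap.opNorm_le_bound _ zero_le_one fun x => ?_, fun x hx => ?_⟩
  · rw [mul_apply_eq_comp, norm_apply_eq_norm_abs_apply, ← hP, ← mul_apply_eq_comp]
    exact (P * R).le_of_opNorm_le hn1 x
  · have h1 : ⟪(T * R) x, T x⟫_ℂ = ⟪x, (P * R * P) x⟫_ℂ := by
      have h2 : P * R * P = star (T * R) * T := by
        rw [star_mul, hRsa.star_eq, mul_assoc R, ← CFC.abs_mul_abs, ← hP, hcomm.eq, mul_assoc]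
      rw [h2, ContinuousLinearMap.star_eq_adjoint,
        mul_apply_eq_comp (ContinuousLinearMap.adjoint (T * R)) T,
        ContinuousLinearMap.adjoint_inner_right]
    have h3 : ⟪x, P x⟫_ℂ = ⟪x, (P * R * P) x⟫_ℂ + ⟪x, (P - P * R * P) x⟫_ℂ := by
      rw [← inner_add_right]; simp
    have h4 : (⟪x, (P - P * R * P) x⟫_ℂ).re ≤ ε := by
      refine (Complex.re_le_norm _).trans ((norm_inner_le_norm _ _).trans ?_)
      rw [hx, one_mul]
      have := (P - P * R * P).le_of_opNorm_le hn2 x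
      rwa [hx, mul_one] at this
    rw [h3, h1, Complex.add_re]
    linarith

theorem abs_diag_nonneg (T : h →L[ℂ] h) (x : h) : 0 ≤ (⟪x, CFC.abs T x⟫_ℂ).re :=
  ((ContinuousLinearMap.nonneg_iff_isPositive _).1 (CFC.abs_nonneg T)).re_inner_nonneg_right x

/-- A criterion for trace class operators, with a bound of the trace norm. -/
theorem sum_abs_le_of_forall_contraction {T : h →L[ℂ] h} {c : ℝ}
    (hT : ∀ V : h →L[ℂ] h, ‖V‖ ≤ 1 → ∀ F : Finset (basisSet h),
      ∑ i ∈ F, (⟪V (onBasis h i), T (onBasis h i)⟫_ℂ).re ≤ c) (F : Finset (basisSet h)) :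
    ∑ i ∈ F, (⟪onBasis h i, CFC.abs T (onBasis h i)⟫_ℂ).re ≤ c := by
  refine le_of_forall_pos_le_add fun δ hδ => ?_
  -- The polar error is paid once for each basis vector of `F`, so it is shared out among them.
  have hε : 0 < δ / (F.card + 1) := by positivity
  obtain ⟨V, hV, hV'⟩ := exists_approx_polar T hε
  calc _ ≤ ∑ i ∈ F, ((⟪V (onBasis h i), T (onBasis h i)⟫_ℂ).re + δ / (F.card + 1)) :=
        Finset.sum_le_sum fun i _ => hV' _ ((onBasis h).orthonormal.1 i)
    _ ≤ c + δ := by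
        rw [Finset.sum_add_distrib, Finset.sum_const, nsmul_eq_mul]
        refine add_le_add (hT V hV F) ?_
        rw [mul_div_assoc', div_le_iff₀ (by positivity)]
        nlinarith

/-- Moving `A` to the other side gives `⟪A V e, B e⟫`, where `A V` is again Hilbert–Schmidt with no
larger norm. The Cauchy–Schwarz bound is kept in its weighted arithmetic form with a free parameter
`t`, to be balanced later. -/
theorem sum_re_inner_le {A B V : h →L[ℂ] h} {α β t : ℝ} (hα : 0 ≤ α) (hβ : 0 ≤ β) (ht : 0 < t)
    (hA : hsSum (onBasis h) A ≤ ENNReal.ofReal α) (hB : hsSum (onBasis h) B ≤ ENNReal.ofReal β)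
    (hV : ‖V‖ ≤ 1) (F : Finset (basisSet h)) :
    ∑ i ∈ F, (⟪V (onBasis h i), (star A * B) (onBasis h i)⟫_ℂ).re ≤ (t * α + t⁻¹ * β) / 2 := by
  have hAV : hsSum (onBasis h) (A * V) ≤ ENNReal.ofReal α := by
    refine (hsSum_mul_le_right _ _ _).trans (le_trans ?_ hA)
    refine mul_le_of_le_one_left' (pow_le_one₀ (by simp) ?_)
    rw [← ofReal_norm]
    exact ENNReal.ofReal_le_one.2 hV
  calc _ ≤ ∑ i ∈ F, (t * ‖(A * V) (onBasis h i)‖ ^ 2 + t⁻¹ * ‖B (onBasis h i)‖ ^ 2) / 2 := by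
        refine Finset.sum_le_sum fun i _ => ?_
        rw [mul_apply_eq_comp, ContinuousLinearMap.star_eq_adjoint,
          ContinuousLinearMap.adjoint_inner_right]
        exact (Complex.re_le_norm _).trans (norm_inner_le_weighted _ _ ht)
    _ = (t * ∑ i ∈ F, ‖(A * V) (onBasis h i)‖ ^ 2 + t⁻¹ * ∑ i ∈ F, ‖B (onBasis h i)‖ ^ 2) / 2 := by
        rw [← Finset.sum_div, Finset.sum_add_distrib, Finset.mul_sum, Finset.mul_sum]
    _ ≤ _ := by
        have := sum_norm_sq_le_of_hsSum_le hα hAV F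
        have := sum_norm_sq_le_of_hsSum_le hβ hB F
        gcongr

theorem isTraceClass_of_sum_le {T : h →L[ℂ] h} {c : ℝ}
    (hT : ∀ F : Finset (basisSet h), ∑ i ∈ F, (⟪onBasis h i, CFC.abs T (onBasis h i)⟫_ℂ).re ≤ c) :
    IsTraceClass T :=
  summable_of_sum_le (fun _ => abs_diag_nonneg T _) hT

theorem norm_trace_abs_le {T : h →L[ℂ] h} {c : ℝ}
    (hT : ∀ F : Finset (basisSet h), ∑ i ∈ F, (⟪onBasis h i, CFC.abs T (onBasis h i)⟫_ℂ).re ≤ c) :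
    ‖trace (CFC.abs T)‖ ≤ c := by
  have hpos : (CFC.abs T).IsPositive :=
    (ContinuousLinearMap.nonneg_iff_isPositive _).1 (CFC.abs_nonneg T)
  have h1 : ∀ i : basisSet h, ⟪onBasis h i, CFC.abs T (onBasis h i)⟫_ℂ
      = (((⟪onBasis h i, CFC.abs T (onBasis h i)⟫_ℂ).re : ℝ) : ℂ) := fun i => by
    have := hpos.inner_nonneg_right (onBasis h i)
    exact Complex.eq_re_of_ofReal_le (r := 0) (by simpa using this)
  have hs : Summable fun i => (⟪onBasis h i, CFC.abs T (onBasis h i)⟫_ℂ).re :=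
    isTraceClass_of_sum_le hT
  rw [trace, tsum_congr h1, ← Complex.ofReal_tsum, Complex.norm_real,
    Real.norm_of_nonneg (tsum_nonneg fun i => abs_diag_nonneg T _)]
  exact hs.tsum_le_of_sum_le hT

end

section

/-! ### Functions of subexponential growth -/

/-- A locally Lipschitz function is Lipschitz on compact intervals, hence absolutely continuous, and
the fundamental theorem of calculus turns an a.e. bound on the derivative into a bound on
increments. -/
theorem sub_le_of_deriv_le {φ : ℝ → ℝ} (hφ_lip : LocallyLipschitzOn (Ioi 0) φ) {x y c : ℝ}
    (hx : 0 < x) (hxy : x ≤ y) (hc : ∀ᵐ t, t ∈ Icc x y → deriv φ t ≤ c) :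
    φ y - φ x ≤ c * (y - x) := by
  have hsub : Icc x y ⊆ Ioi 0 := fun t ht => hx.trans_le ht.1
  obtain ⟨K, hK⟩ := (hφ_lip.mono hsub).exists_lipschitzOnWith_of_compact isCompact_Icc
  rw [← uIcc_of_le hxy] at hK
  have hac := hK.absolutelyContinuousOnInterval
  rw [← hac.integral_deriv_eq_sub]
  have h1 := intervalIntegral.integral_mono_ae_restrict hxy hac.intervalIntegrable_deriv
    (intervalIntegrable_const (c := c)) ((ae_restrict_iff' measurableSet_Icc).2 hc)
  refine h1.trans (le_of_eq ?_)
  rw [intervalIntegral.integral_const, smul_eq_mul, mul_comm]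

theorem exists_one_lt_cube_le {η : ℝ} (hη : 1 < η) : ∃ q : ℝ, 1 < q ∧ q ^ 3 ≤ η := by
  set d := min 1 ((η - 1) / 7) with hd
  have h0 : 0 < d := lt_min one_pos (by linarith)
  have h1 : d ≤ 1 := min_le_left _ _
  have h2 : d ≤ (η - 1) / 7 := min_le_right _ _
  refine ⟨1 + d, by linarith, ?_⟩
  nlinarith [mul_nonneg h0.le h0.le, mul_nonneg h0.le (sub_nonneg.2 h1),
    mul_nonneg (mul_nonneg h0.le h0.le) (sub_nonneg.2 h1)]

/-- A function equivalent to a locally Lipschitz function with vanishing logarithmic derivative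
grows by a factor tending to `1` over intervals of constant length. -/
theorem eventually_apply_add_le {n φ : ℝ → ℝ} (hφ_mono : MonotoneOn φ (Ici 0))
    (hφ_lip : LocallyLipschitzOn (Ioi 0) φ)
    (hφ_log : limsup (fun x : ℝ => ((deriv φ x / φ x : ℝ) : EReal)) (atTop ⊓ ae volume) = 0)
    (hN : Asymptotics.IsEquivalent atTop n φ) (hn : Tendsto n atTop atTop) {W η : ℝ}
    (hW : 0 < W) (hη : 1 < η) : ∀ᶠ x in atTop, n (x + W) ≤ η * n x := by
  -- One factor `q` pays for the growth of `φ` over length `W`, the other two for passing from `n`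
  -- to `φ` and back.
  obtain ⟨q, hq1, hq⟩ := exists_one_lt_cube_le hη
  have hq0 : 0 < q := by linarith
  have hφpos : ∀ᶠ x in atTop, 0 < φ x := (hN.tendsto_atTop hn).eventually_gt_atTop 0
  -- Since `φ` is nondecreasing, `φ' ≤ εφ ≤ ε φ(x + W)` on the interval, so its increment is at most
  -- `εW φ(x + W) = (1 - q⁻¹) φ(x + W)`, that is, `φ(x + W) ≤ q φ(x)`.
  set ε := (1 - q⁻¹) / W with hε
  have hqi : q⁻¹ < 1 := inv_lt_one_of_one_lt₀ hq1
  have hε0 : 0 < ε := div_pos (by linarith) hW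
  have hder : ∀ᶠ x in atTop ⊓ ae (volume : Measure ℝ), deriv φ x / φ x < ε := by
    have h1 : limsup (fun x : ℝ => ((deriv φ x / φ x : ℝ) : EReal)) (atTop ⊓ ae volume)
        < ((ε : ℝ) : EReal) := by
      rw [hφ_log]; exact_mod_cast hε0
    filter_upwards [eventually_lt_of_limsup_lt h1] with x hx
    exact_mod_cast hx
  obtain ⟨s, hs, t, ht, hst⟩ := mem_inf_iff_superset.1 hder
  have hφW : ∀ᶠ x in atTop, φ (x + W) ≤ q * φ x := by
    obtain ⟨a, ha⟩ := mem_atTop_sets.1 hs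
    obtain ⟨b, hb⟩ := eventually_atTop.1 hφpos
    filter_upwards [eventually_gt_atTop 0, eventually_ge_atTop a, eventually_ge_atTop b]
      with x hx hxa hxb
    have h1 : φ (x + W) - φ x ≤ ε * φ (x + W) * (x + W - x) := by
      refine sub_le_of_deriv_le hφ_lip hx (by linarith) ?_
      filter_upwards [ht] with y hy hyI
      have h2 : deriv φ y / φ y < ε := hst ⟨ha y (hxa.trans hyI.1), hy⟩
      have h3 : 0 < φ y := hb y (hxb.trans hyI.1)
      rw [div_lt_iff₀ h3] at h2
      have h4 : φ y ≤ φ (x + W) := hφ_mono (hx.le.trans hyI.1) (by simp; linarith) hyI.2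
      nlinarith
    have h5 : ε * φ (x + W) * (x + W - x) = (1 - q⁻¹) * φ (x + W) := by
      rw [hε]; field_simp; ring
    rw [h5] at h1
    have h6 : q⁻¹ * φ (x + W) ≤ φ x := by linarith
    rwa [inv_mul_le_iff₀ hq0] at h6
  obtain ⟨ψ, hψ, hψn⟩ := hN.exists_eq_mul
  have hup : ∀ᶠ x in atTop, n x ≤ q * φ x := by
    filter_upwards [hψn, hψ.eventually_le_const hq1, hφpos] with x h1 h2 h3
    rw [h1]; exact mul_le_mul_of_nonneg_right h2 h3.le
  have hlo : ∀ᶠ x in atTop, φ x ≤ q * n x := by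
    filter_upwards [hψn, hψ.eventually_const_le hqi, hφpos] with x h1 h2 h3
    rw [h1]
    have : q⁻¹ * φ x ≤ ψ x * φ x := mul_le_mul_of_nonneg_right h2 h3.le
    rwa [inv_mul_le_iff₀ hq0] at this
  filter_upwards [(tendsto_atTop_add_const_right atTop W tendsto_id).eventually hup, hφW, hlo,
    hn.eventually_gt_atTop 0] with x h1 h2 h3 h4
  calc n (x + W) ≤ q * φ (x + W) := h1
    _ ≤ q * (q * φ x) := by gcongr
    _ ≤ q * (q * (q * n x)) := by gcongr
    _ = q ^ 3 * n x := by ring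
    _ ≤ η * n x := by gcongr

/-- Bounding the exponent by `2` makes `(1 + δ)^s ≤ 1 + ε` uniform in `s`. The two comparisons are
symmetric, and `x^s < (1 - ε) y^s` would contradict `y^s ≤ (1 + ε) x^s`. -/
theorem abs_rpow_sub_rpow_le {x y δ ε s : ℝ} (hx : 0 < x) (hy : 0 < y) (hδ : 0 < δ)
    (hδε : (1 + δ) ^ 2 ≤ 1 + ε) (h1 : x ≤ (1 + δ) * y) (h2 : y ≤ (1 + δ) * x) (hs0 : 0 ≤ s)
    (hs : s ≤ 2) : |x ^ s - y ^ s| ≤ ε * y ^ s := by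
  have hδs : (1 + δ) ^ s ≤ 1 + ε := by
    refine le_trans ?_ hδε
    rw [← Real.rpow_natCast (1 + δ) 2]
    exact Real.rpow_le_rpow_of_exponent_le (by linarith) (by exact_mod_cast hs)
  have hxs : 0 < x ^ s := Real.rpow_pos_of_pos hx s
  have hys : 0 < y ^ s := Real.rpow_pos_of_pos hy s
  have hmono : ∀ {a b : ℝ}, 0 < a → 0 < b → a ≤ (1 + δ) * b → a ^ s ≤ (1 + ε) * b ^ s := by
    intro a b ha hb hab
    calc a ^ s ≤ ((1 + δ) * b) ^ s := Real.rpow_le_rpow ha.le hab hs0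
      _ = (1 + δ) ^ s * b ^ s := Real.mul_rpow (by linarith) hb.le
      _ ≤ _ := mul_le_mul_of_nonneg_right hδs (Real.rpow_pos_of_pos hb s).le
  have h3 := hmono hx hy h1
  have h4 := hmono hy hx h2
  have hε : 0 < ε := by nlinarith
  rw [abs_le]
  constructor
  · by_contra hcon
    push Not at hcon
    nlinarith
  · linarith

/-- The powers of the inverse of a slowly growing function vary little over intervals of constant
length, uniformly in bounded exponents. -/
theorem exists_forall_abs_rpow_inv_sub_le {n : ℝ → ℝ} (hmono : Monotone n)
    (hn : Tendsto n atTop atTop)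
    (hgrow : ∀ W η : ℝ, 0 < W → 1 < η → ∀ᶠ x in atTop, n (x + W) ≤ η * n x) {W ε : ℝ}
    (hW : 0 < W) (hε : 0 < ε) :
    ∃ M : ℝ, ∀ x y : ℝ, |x - y| ≤ W → M < y → ∀ s : ℝ, 0 ≤ s → s ≤ 2 →
      |(n x)⁻¹ ^ s - (n y)⁻¹ ^ s| ≤ ε * (n y)⁻¹ ^ s := by
  obtain ⟨q, hq1, hq⟩ := exists_one_lt_cube_le (by linarith : 1 < 1 + ε)
  have hq2 : (1 + (q - 1)) ^ 2 ≤ 1 + ε := by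
    refine le_trans ?_ hq
    nlinarith [sq_nonneg q]
  obtain ⟨M, hM⟩ := eventually_atTop.1 ((hgrow W q hW hq1).and (hn.eventually_gt_atTop 0))
  have key : ∀ x y : ℝ, M ≤ x → y ≤ x + W → n y ≤ q * n x := fun x y hx hy =>
    (hmono hy).trans (hM x hx).1
  -- The shift by `W` puts both points beyond `M`, so the growth bound may be used in either
  -- direction.
  refine ⟨M + W, fun x y hxy hy s hs0 hs => ?_⟩
  rw [abs_le] at hxy
  have hx0 : 0 < n x := (hM x (by linarith)).2
  have hy0 : 0 < n y := (hM y (by linarith)).2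
  refine abs_rpow_sub_rpow_le (inv_pos.2 hx0) (inv_pos.2 hy0) (by linarith : 0 < q - 1) hq2 ?_ ?_
    hs0 hs
  · have := key x y (by linarith) (by linarith)
    rw [add_sub_cancel, ← div_eq_mul_inv, le_div_iff₀ hy0, inv_mul_le_iff₀ hx0]
    linarith
  · have := key y x (by linarith) (by linarith)
    rw [add_sub_cancel, ← div_eq_mul_inv, le_div_iff₀ hx0, inv_mul_le_iff₀ hy0]
    linarith

end

section

variable {h : Type*} [NormedAddCommGroup h] [InnerProductSpace ℂ h] [CompleteSpace h]
variable {ι κ : Type*}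

/-! ### Diagonal operators -/

/-- The functional calculus of `T` acts on eigenvectors of `T` through the eigenvalue. -/
theorem cfc_apply_eigenvector {T : h →L[ℂ] h} (hT : IsSelfAdjoint T) {v : h} {c : ℝ}
    (hv : T v = (c : ℂ) • v) {g : ℝ → ℝ} (hg : ContinuousOn g (spectrum ℝ T)) :
    cfc g T v = (g c : ℂ) • v := by
  by_cases hv0 : v = 0
  · simp [hv0]
  have hc : c ∈ spectrum ℝ T := by
    rw [spectrum.mem_iff]
    intro hu
    have h1 : (algebraMap ℝ (h →L[ℂ] h) c - T) v = 0 := by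
      rw [sub_apply, hv, Algebra.algebraMap_eq_smul_one]
      simp
    obtain ⟨u, hu⟩ := hu
    rw [← hu] at h1
    apply hv0
    have h2 : ((↑u⁻¹ : h →L[ℂ] h) * (u : h →L[ℂ] h)) v = 0 := by
      rw [mul_apply_eq_comp, h1, map_zero]
    simpa using h2
  rw [cfc_apply g T hT hg]
  -- Stone–Weierstrass: the identity holds for constants and the coordinate function, is stable
  -- under sums and products, and is a closed condition on `k`.
  have key : ∀ k : C(spectrum ℝ T, ℝ), cfcHom hT k v = (k ⟨c, hc⟩ : ℂ) • v := by
    intro k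
    induction k using ContinuousMap.induction_on_of_compact with
    | const r =>
      have h1 : cfcHom hT (ContinuousMap.const (spectrum ℝ T) r) = algebraMap ℝ (h →L[ℂ] h) r :=
        AlgHomClass.commutes (cfcHom hT) r
      rw [h1, Algebra.algebraMap_eq_smul_one]
      simp
    | id => rw [cfcHom_id hT, hv]; rfl
    | star_id => rw [map_star, cfcHom_id hT, hT.star_eq, hv]; rfl
    | add f g hf hg => rw [map_add, add_apply, hf, hg, ← add_smul]; simp
    | mul f g hf hg =>
      rw [map_mul, mul_apply_eq_comp, hg, map_smul, hf, smul_smul, mul_comm]; simp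
    | frequently f hf =>
      have hcl : IsClosed {k : C(spectrum ℝ T, ℝ) | cfcHom hT k v = (k ⟨c, hc⟩ : ℂ) • v} := by
        refine isClosed_eq ?_ ?_
        · exact (ContinuousLinearMap.apply ℂ h v).continuous.comp (cfcHom_continuous hT)
        · exact (Complex.continuous_ofReal.comp
            (continuous_eval_const (⟨c, hc⟩ : spectrum ℝ T))).smul continuous_const
      exact hf.mem_of_closed hcl
  exact key _

theorem rpow_apply_eigenvector {T : h →L[ℂ] h} (hT : 0 ≤ T) {v : h} {c : ℝ}
    (hv : T v = (c : ℂ) • v) {s : ℝ} (hs : 0 ≤ s) : (T ^ s) v = ((c ^ s : ℝ) : ℂ) • v := by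
  rw [CFC.rpow_eq_cfc_real hT]
  exact cfc_apply_eigenvector (IsSelfAdjoint.of_nonneg hT) hv
    (Real.continuous_rpow_const hs).continuousOn

theorem hilbertBasis_ext (b : HilbertBasis ι ℂ h) {S T : h →L[ℂ] h}
    (hST : ∀ i, S (b i) = T (b i)) : S = T :=
  ContinuousLinearMap.ext_on (s := range b)
    (by rw [dense_iff_closure_eq, ← Submodule.topologicalClosure_coe, b.dense_span]; rfl)
    (by rintro _ ⟨i, rfl⟩; exact hST i)

theorem inner_diag_apply (b : HilbertBasis ι ℂ h) {S : h →L[ℂ] h} {d : ι → ℝ}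
    (hS : ∀ i, S (b i) = (d i : ℂ) • b i) (i : ι) (x : h) :
    ⟪b i, S x⟫_ℂ = d i * ⟪b i, x⟫_ℂ := by
  have h1 : (innerSL ℂ (b i)).comp S = (d i : ℂ) • innerSL ℂ (b i) := by
    refine ContinuousLinearMap.ext_on (s := range b)
      (by rw [dense_iff_closure_eq, ← Submodule.topologicalClosure_coe, b.dense_span]; rfl) ?_
    rintro _ ⟨j, rfl⟩
    have h2 : ⟪b i, S (b j)⟫_ℂ = d i * ⟪b i, b j⟫_ℂ := by
      rw [hS, inner_smul_right]
      by_cases hij : i = j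
      · rw [hij]
      · rw [b.orthonormal.2 hij]; simp
    simpa using h2
  have h3 := congrArg (fun T : h →L[ℂ] ℂ => T x) h1
  simpa using h3

theorem isPositive_diag (b : HilbertBasis ι ℂ h) {S : h →L[ℂ] h} {d : ι → ℝ}
    (hS : ∀ i, S (b i) = (d i : ℂ) • b i) (hd : ∀ i, 0 ≤ d i) : 0 ≤ S := by
  rw [ContinuousLinearMap.nonneg_iff_isPositive, ContinuousLinearMap.isPositive_iff_complex]
  intro x
  have h1 := b.hasSum_inner_mul_inner (S x) x
  have h2 : ∀ i, ⟪S x, b i⟫_ℂ * ⟪b i, x⟫_ℂ = ((d i * ‖⟪b i, x⟫_ℂ‖ ^ 2 : ℝ) : ℂ) := by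
    intro i
    rw [← inner_conj_symm, inner_diag_apply b hS, map_mul, Complex.conj_ofReal, mul_assoc,
      mul_comm ((starRingEnd ℂ) _), Complex.mul_conj, Complex.normSq_eq_norm_sq]
    push_cast; ring
  simp only [h2] at h1
  have h3 : ⟪S x, x⟫_ℂ = ((∑' i, d i * ‖⟪b i, x⟫_ℂ‖ ^ 2 : ℝ) : ℂ) := by
    rw [Complex.ofReal_tsum]; exact h1.tsum_eq.symm
  rw [h3]
  refine ⟨by simp, ?_⟩
  have : 0 ≤ ∑' i, d i * ‖⟪b i, x⟫_ℂ‖ ^ 2 :=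
    tsum_nonneg fun i => mul_nonneg (hd i) (by positivity)
  simpa using this

theorem norm_diag_le (b : HilbertBasis ι ℂ h) {S : h →L[ℂ] h} {d : ι → ℝ}
    (hS : ∀ i, S (b i) = (d i : ℂ) • b i) {C : ℝ} (hC : 0 ≤ C) (hd : ∀ i, |d i| ≤ C) :
    ‖S‖ ≤ C := by
  refine ContinuousLinearMap.opNorm_le_bound _ hC fun x => ?_
  refine le_of_sq_le_sq ?_ (by positivity)
  rw [mul_pow]
  refine hasSum_le (fun i => ?_) (hasSum_norm_inner_sq b (S x))
    ((hasSum_norm_inner_sq b x).mul_left (C ^ 2))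
  rw [inner_diag_apply b hS, norm_mul, mul_pow, Complex.norm_real]
  gcongr
  exact hd i

theorem hsSum_diag (b : HilbertBasis ι ℂ h) {S : h →L[ℂ] h} {d : ι → ℝ}
    (hS : ∀ i, S (b i) = (d i : ℂ) • b i) : hsSum b S = ∑' i, ENNReal.ofReal (d i ^ 2) := by
  refine tsum_congr fun i => ?_
  rw [hS, ← ofReal_norm, norm_smul, b.orthonormal.1 i, mul_one, Complex.norm_real,
    ← ENNReal.ofReal_pow (norm_nonneg _), Real.norm_eq_abs, sq_abs]

/-! ### Commutators with diagonal operators -/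

/-- The squared modulus of the matrix entry of `a`. -/
noncomputable def entrySq (b : HilbertBasis ι ℂ h) (a : h →L[ℂ] h) (m n : ι) : ℝ≥0∞ :=
  ‖⟪b m, a (b n)⟫_ℂ‖ₑ ^ 2

theorem tsum_entrySq_le (b : HilbertBasis ι ℂ h) (a : h →L[ℂ] h) (n : ι) :
    ∑' m, entrySq b a m n ≤ ENNReal.ofReal (‖a‖ ^ 2) := by
  unfold entrySq
  rw [tsum_enorm_inner_sq, ENNReal.ofReal_pow (norm_nonneg _), ← ofReal_norm]
  gcongr
  simpa [b.orthonormal.1 n] using a.le_opNorm (b n)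

theorem entrySq_star (b : HilbertBasis ι ℂ h) (a : h →L[ℂ] h) (m n : ι) :
    entrySq b (star a) m n = entrySq b a n m := by
  rw [entrySq, entrySq, ContinuousLinearMap.star_eq_adjoint,
    ContinuousLinearMap.adjoint_inner_right, ← ofReal_norm, ← ofReal_norm, norm_inner_symm]

/-- The entry of `[a, R]` at `(m, n)` is `(d n - d m)` times that of `a`; Parseval in each column
does the rest. In this form `[a, R]` can be compared with `[a, L]` entry by entry. -/
theorem hsSum_commutator (b : HilbertBasis ι ℂ h) {R : h →L[ℂ] h} {d : ι → ℝ}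
    (hR : ∀ i, R (b i) = (d i : ℂ) • b i) (a : h →L[ℂ] h) :
    hsSum b (a * R - R * a)
      = ∑' n, ∑' m, entrySq b a m n * ENNReal.ofReal ((d m - d n) ^ 2) := by
  refine tsum_congr fun n => ?_
  rw [← tsum_enorm_inner_sq b]
  refine tsum_congr fun m => ?_
  have h1 : ⟪b m, (a * R - R * a) (b n)⟫_ℂ = ((d n - d m : ℝ) : ℂ) * ⟪b m, a (b n)⟫_ℂ := by
    rw [sub_apply, mul_apply_eq_comp, mul_apply_eq_comp, inner_sub_right, inner_diag_apply b hR,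
      hR, map_smul, inner_smul_right]
    push_cast; ring
  rw [h1, enorm_mul, mul_pow, mul_comm, entrySq]
  congr 1
  rw [← ofReal_norm, Complex.norm_real, ← ENNReal.ofReal_pow (norm_nonneg _), Real.norm_eq_abs,
    sq_abs]
  congr 1
  ring

/-- The first bound serves near the diagonal, where the weights are close; the second serves far
from it, where only their size is known. -/
theorem sqrt_sub_sqrt_sq_le {x y : ℝ} (hx : 0 ≤ x) (hy : 0 ≤ y) :
    (√x - √y) ^ 2 ≤ |x - y| ∧ (√x - √y) ^ 2 ≤ x + y := by
  have h1 := Real.sq_sqrt hx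
  have h2 := Real.sq_sqrt hy
  have h3 := Real.sqrt_nonneg x
  have h4 := Real.sqrt_nonneg y
  refine ⟨?_, by nlinarith⟩
  rcases le_total (√y) (√x) with h5 | h5
  · refine le_trans ?_ (le_abs_self _)
    nlinarith
  · refine le_trans ?_ (neg_le_abs _)
    nlinarith

/-- The pointwise estimate behind `hsSum_commutator_sqrt_le`. -/
theorem sqrt_sub_sqrt_sq_le_near_far {lam w v : ι → ℝ} (hw : ∀ i, 0 ≤ w i) (hv : ∀ i, 0 ≤ v i)
    {W ε M : ℝ} (hW : 0 < W) (hε : 0 ≤ ε)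
    (hnear : ∀ m n, |lam m - lam n| ≤ W → M < lam n → |w m - w n| ≤ ε * v n) (m n : ι) :
    (√(w m) - √(w n)) ^ 2 ≤ (if lam m ≤ M + W then w m else 0)
      + (if lam n ≤ M + W then w n else 0) + ε * v n
      + w m / W ^ 2 * (lam m - lam n) ^ 2 + w n / W ^ 2 * (lam m - lam n) ^ 2 := by
  obtain ⟨h1, h2⟩ := sqrt_sub_sqrt_sq_le (hw m) (hw n)
  have q1 : 0 ≤ (if lam m ≤ M + W then w m else 0) := by split_ifs; exacts [hw m, le_rfl]
  have q2 : 0 ≤ (if lam n ≤ M + W then w n else 0) := by split_ifs; exacts [hw n, le_rfl]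
  have q3 : 0 ≤ ε * v n := mul_nonneg hε (hv n)
  have q4 : 0 ≤ w m / W ^ 2 * (lam m - lam n) ^ 2 :=
    mul_nonneg (div_nonneg (hw m) (by positivity)) (sq_nonneg _)
  have q5 : 0 ≤ w n / W ^ 2 * (lam m - lam n) ^ 2 :=
    mul_nonneg (div_nonneg (hw n) (by positivity)) (sq_nonneg _)
  -- Near and low: both indices lie below `M + W` and the indicator terms suffice. Near and high:
  -- slow variation gives `ε * v n`. Far: `(lam m - lam n)² / W² ≥ 1` may be inserted.
  rcases le_or_gt |lam m - lam n| W with hmn | hmn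
  · rcases le_or_gt (lam n) M with hM | hM
    · have h3 : lam m ≤ M + W := by linarith [(abs_le.1 hmn).2]
      have h4 : lam n ≤ M + W := by linarith
      rw [if_pos h3, if_pos h4] at *
      linarith
    · have := hnear m n hmn hM
      linarith
  · have h3 : 1 ≤ (lam m - lam n) ^ 2 / W ^ 2 := by
      rw [one_le_div (by positivity), ← sq_abs (lam m - lam n)]
      gcongr
    have h4 : w m ≤ w m / W ^ 2 * (lam m - lam n) ^ 2 := by
      rw [div_mul_eq_mul_div, mul_div_assoc]; exact le_mul_of_one_le_right (hw m) h3
    have h5 : w n ≤ w n / W ^ 2 * (lam m - lam n) ^ 2 := by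
      rw [div_mul_eq_mul_div, mul_div_assoc]; exact le_mul_of_one_le_right (hw n) h3
    linarith

theorem tsum_tsum_mul_le_of_right {c : ι → ι → ℝ≥0∞} {q : ι → ℝ≥0∞} {A : ℝ≥0∞}
    (hc : ∀ n, ∑' m, c m n ≤ A) : ∑' n, ∑' m, c m n * q n ≤ A * ∑' n, q n := by
  rw [← ENNReal.tsum_mul_left]
  refine ENNReal.tsum_le_tsum fun n => ?_
  rw [ENNReal.tsum_mul_right]
  exact mul_le_mul_left (hc n) _

theorem tsum_tsum_mul_le_of_left {c : ι → ι → ℝ≥0∞} {q : ι → ℝ≥0∞} {A : ℝ≥0∞}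
    (hc : ∀ m, ∑' n, c m n ≤ A) : ∑' n, ∑' m, c m n * q m ≤ A * ∑' n, q n := by
  rw [ENNReal.tsum_comm]
  exact tsum_tsum_mul_le_of_right (c := fun m n => c n m) hc

/-- The Hilbert–Schmidt norm of the commutator of `a` with the square root of a diagonal
operator: entries far from the diagonal are controlled by the commutator of `a` with
`diag lam`, those near the diagonal by the slow variation of the weights. -/
theorem hsSum_commutator_sqrt_le (b : HilbertBasis ι ℂ h) {lam w v : ι → ℝ} (hw : ∀ i, 0 ≤ w i)
    (hv : ∀ i, 0 ≤ v i) {R a : h →L[ℂ] h} (hR : ∀ i, R (b i) = ((√(w i) : ℝ) : ℂ) • b i) {D : ℝ}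
    (hD : 0 ≤ D)
    (hcol : ∀ n, ∑' m, entrySq b a m n * ENNReal.ofReal ((lam m - lam n) ^ 2) ≤ ENNReal.ofReal D)
    (hrow : ∀ m, ∑' n, entrySq b a m n * ENNReal.ofReal ((lam m - lam n) ^ 2) ≤ ENNReal.ofReal D)
    {W ε M S Q : ℝ} (hW : 0 < W) (hε : 0 ≤ ε) (hS : 0 ≤ S) (hQ : 0 ≤ Q)
    (hnear : ∀ m n, |lam m - lam n| ≤ W → M < lam n → |w m - w n| ≤ ε * v n)
    (hwS : ∑' i, ENNReal.ofReal (w i) ≤ ENNReal.ofReal S)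
    (hvS : ∑' i, ENNReal.ofReal (v i) ≤ ENNReal.ofReal S)
    (hwQ : ∑' i, ENNReal.ofReal (if lam i ≤ M + W then w i else 0) ≤ ENNReal.ofReal Q) :
    hsSum b (a * R - R * a)
      ≤ ENNReal.ofReal (2 * ‖a‖ ^ 2 * Q + ‖a‖ ^ 2 * (ε * S) + 2 * (D * (S / W ^ 2))) := by
  set A := ENNReal.ofReal (‖a‖ ^ 2) with hA
  set c := entrySq b a with hcdef
  have hc1 : ∀ n, ∑' m, c m n ≤ A := tsum_entrySq_le b a
  have hc2 : ∀ m, ∑' n, c m n ≤ A := fun m => by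
    have h1 := tsum_entrySq_le b (star a) m
    simpa only [entrySq_star, norm_star] using h1
  set q : ι → ℝ≥0∞ := fun i => ENNReal.ofReal (if lam i ≤ M + W then w i else 0) with hq
  have hq0 : ∀ i, 0 ≤ (if lam i ≤ M + W then w i else 0) := fun i => by
    split_ifs; exacts [hw i, le_rfl]
  have hsumv : ∑' n, ENNReal.ofReal (ε * v n) ≤ ENNReal.ofReal (ε * S) := by
    simp only [ENNReal.ofReal_mul hε]
    rw [ENNReal.tsum_mul_left]
    gcongr
  have hsumw : ∑' n, ENNReal.ofReal (w n / W ^ 2) ≤ ENNReal.ofReal (S / W ^ 2) := by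
    simp only [div_eq_mul_inv, ENNReal.ofReal_mul (hw _), ENNReal.ofReal_mul hS]
    rw [ENNReal.tsum_mul_right]
    gcongr
  set e : ι → ι → ℝ≥0∞ := fun m n => c m n * ENNReal.ofReal ((lam m - lam n) ^ 2) with he
  have hterm : ∀ m n, c m n * ENNReal.ofReal ((√(w m) - √(w n)) ^ 2) ≤
      c m n * q m + c m n * q n + c m n * ENNReal.ofReal (ε * v n)
        + e m n * ENNReal.ofReal (w m / W ^ 2) + e m n * ENNReal.ofReal (w n / W ^ 2) := by
    intro m n
    have h1 := ENNReal.ofReal_le_ofReal (sqrt_sub_sqrt_sq_le_near_far hw hv hW hε hnear m n)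
    have hm := div_nonneg (hw m) (sq_nonneg W)
    have hn := div_nonneg (hw n) (sq_nonneg W)
    have hεv := mul_nonneg hε (hv n)
    have h2 := hq0 m
    have h3 := hq0 n
    have h4 := mul_nonneg hm (sq_nonneg (lam m - lam n))
    have h5 := mul_nonneg hn (sq_nonneg (lam m - lam n))
    rw [ENNReal.ofReal_add (by linarith) h5, ENNReal.ofReal_add (by linarith) h4,
      ENNReal.ofReal_add (by linarith) hεv, ENNReal.ofReal_add h2 h3, ENNReal.ofReal_mul hm,
      ENNReal.ofReal_mul hn] at h1
    refine (mul_le_mul_right h1 (c m n)).trans (le_of_eq ?_)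
    simp only [hq, he]
    ring
  rw [hsSum_commutator b hR]
  refine (ENNReal.tsum_le_tsum fun n => ENNReal.tsum_le_tsum fun m => hterm m n).trans ?_
  simp only [ENNReal.tsum_add]
  have t1 := tsum_tsum_mul_le_of_left (q := q) hc2
  have t2 := tsum_tsum_mul_le_of_right (q := q) hc1
  have t3 := tsum_tsum_mul_le_of_right (q := fun n => ENNReal.ofReal (ε * v n)) hc1
  have t4 := tsum_tsum_mul_le_of_left (q := fun n => ENNReal.ofReal (w n / W ^ 2)) hrow
  have t5 := tsum_tsum_mul_le_of_right (q := fun n => ENNReal.ofReal (w n / W ^ 2)) hcol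
  refine (add_le_add (add_le_add (add_le_add (add_le_add t1 t2) t3) t4) t5).trans ?_
  have hD' : ENNReal.ofReal D * ∑' n, ENNReal.ofReal (w n / W ^ 2)
      ≤ ENNReal.ofReal (D * (S / W ^ 2)) := by
    rw [ENNReal.ofReal_mul hD]; gcongr
  have hQ' : A * ∑' n, q n ≤ ENNReal.ofReal (‖a‖ ^ 2 * Q) := by
    rw [ENNReal.ofReal_mul (by positivity)]; gcongr
  have hV' : A * ∑' n, ENNReal.ofReal (ε * v n) ≤ ENNReal.ofReal (‖a‖ ^ 2 * (ε * S)) := by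
    rw [ENNReal.ofReal_mul (by positivity)]; gcongr
  refine (add_le_add (add_le_add (add_le_add (add_le_add hQ' hQ') hV') hD') hD').trans ?_
  rw [← ENNReal.ofReal_add (by positivity) (by positivity),
    ← ENNReal.ofReal_add (by positivity) (by positivity),
    ← ENNReal.ofReal_add (by positivity) (by positivity),
    ← ENNReal.ofReal_add (by positivity) (by positivity)]
  refine ENNReal.ofReal_le_ofReal (le_of_eq ?_)
  ring

end

section

variable {h : Type*} [NormedAddCommGroup h] [InnerProductSpace ℂ h] [CompleteSpace h]
variable {ι κ I : Type*}

/-! ### Families of slowly varying diagonal weights -/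

/-- Families of nonnegative weights `w i` on the index set of a basis, which vary slowly in terms
of `lam`, and whose sums are of order `(k i)⁻¹`, where `k → 0`. -/
structure IsSlowWeightFamily (l : Filter I) (lam : ι → ℝ) (k : I → ℝ) (w : I → ι → ℝ) : Prop where
  nonneg : ∀ i n, 0 ≤ w i n
  pos : ∀ᶠ i in l, 0 < k i
  tendsto : Tendsto k l (𝓝 0)
  near : ∃ v : I → ι → ℝ, (∀ i n, 0 ≤ v i n) ∧
    (∃ S : ℝ, 0 ≤ S ∧ ∀ᶠ i in l, ∑' n, ENNReal.ofReal (w i n) ≤ ENNReal.ofReal (S / k i) ∧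
      ∑' n, ENNReal.ofReal (v i n) ≤ ENNReal.ofReal (S / k i)) ∧
    ∀ W ε : ℝ, 0 < W → 0 < ε → ∃ M : ℝ, ∀ᶠ i in l, ∀ m n, |lam m - lam n| ≤ W → M < lam n →
      |w i m - w i n| ≤ ε * v i n
  low : ∀ M : ℝ, ∃ Q : ℝ, 0 ≤ Q ∧
    ∀ᶠ i in l, ∑' n, ENNReal.ofReal (if lam n ≤ M then w i n else 0) ≤ ENNReal.ofReal Q

theorem IsSlowWeightFamily.sum_le {l : Filter I} {lam : ι → ℝ} {k : I → ℝ} {w : I → ι → ℝ}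
    (hw : IsSlowWeightFamily l lam k w) :
    ∃ S : ℝ, 0 ≤ S ∧ ∀ᶠ i in l, ∑' n, ENNReal.ofReal (w i n) ≤ ENNReal.ofReal (S / k i) := by
  obtain ⟨v, -, ⟨S, hS, hSi⟩, -⟩ := hw.near
  exact ⟨S, hS, hSi.mono fun i hi => hi.1⟩

/-- A large `W` makes the far entries cost at most `δ/3`, then a small `ε` does so for the near
ones; the low part is bounded by a constant, negligible against `1 / k i` because `k → 0`. The order
matters: `M` depends on `W` and `ε`, and `Q` on `M`. -/
theorem IsSlowWeightFamily.eventually_hsSum_commutator_le {l : Filter I} {lam : ι → ℝ} {k : I → ℝ}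
    {w : I → ι → ℝ} (hw : IsSlowWeightFamily l lam k w) (b : HilbertBasis ι ℂ h)
    {R : I → h →L[ℂ] h} (hR : ∀ i n, R i (b n) = ((√(w i n) : ℝ) : ℂ) • b n) {a : h →L[ℂ] h} {D : ℝ}
    (hD : 0 ≤ D)
    (hcol : ∀ n, ∑' m, entrySq b a m n * ENNReal.ofReal ((lam m - lam n) ^ 2) ≤ ENNReal.ofReal D)
    (hrow : ∀ m, ∑' n, entrySq b a m n * ENNReal.ofReal ((lam m - lam n) ^ 2) ≤ ENNReal.ofReal D)
    {δ : ℝ} (hδ : 0 < δ) :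
    ∀ᶠ i in l, hsSum b (a * R i - R i * a) ≤ ENNReal.ofReal (δ / k i) := by
  obtain ⟨v, hv, ⟨S, hS, hSi⟩, hnear⟩ := hw.near
  -- choice of the parameters
  obtain ⟨W, hW, hWδ⟩ : ∃ W : ℝ, 0 < W ∧ 2 * (D * (S / W ^ 2)) ≤ δ / 3 := by
    refine ⟨√(6 * D * S / δ) + 1, by positivity, ?_⟩
    have h1 : 6 * D * S / δ ≤ (√(6 * D * S / δ) + 1) ^ 2 := by
      have h2 := Real.sq_sqrt (by positivity : 0 ≤ 6 * D * S / δ)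
      nlinarith [Real.sqrt_nonneg (6 * D * S / δ)]
    rw [← mul_div_assoc, ← mul_div_assoc, div_le_iff₀ (by positivity)]
    rw [div_le_iff₀ hδ] at h1
    linarith
  obtain ⟨ε, hε, hεδ⟩ : ∃ ε : ℝ, 0 < ε ∧ ‖a‖ ^ 2 * (ε * S) ≤ δ / 3 := by
    refine ⟨δ / (3 * (‖a‖ ^ 2 * S + 1)), by positivity, ?_⟩
    have h1 : ‖a‖ ^ 2 * (δ / (3 * (‖a‖ ^ 2 * S + 1)) * S)
        = δ / 3 * (‖a‖ ^ 2 * S / (‖a‖ ^ 2 * S + 1)) := by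
      field_simp
    rw [h1]
    refine mul_le_of_le_one_right (by positivity) ?_
    rw [div_le_one (by positivity)]
    linarith
  obtain ⟨M, hM⟩ := hnear W ε hW hε
  obtain ⟨Q, hQ, hQi⟩ := hw.low (M + W)
  have hkQ : ∀ᶠ i in l, 2 * ‖a‖ ^ 2 * Q * k i ≤ δ / 3 := by
    have h1 := hw.tendsto.const_mul (2 * ‖a‖ ^ 2 * Q)
    rw [mul_zero] at h1
    exact h1.eventually_le_const (by positivity)
  filter_upwards [hw.pos, hSi, hM, hQi, hkQ] with i hk hS' hM' hQ' hkQ'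
  refine (hsSum_commutator_sqrt_le b (hw.nonneg i) (hv i) (hR i) hD hcol hrow hW hε.le
    (div_nonneg hS hk.le) hQ hM' hS'.1 hS'.2 hQ').trans (ENNReal.ofReal_le_ofReal ?_)
  rw [le_div_iff₀ hk]
  have h1 : (2 * ‖a‖ ^ 2 * Q + ‖a‖ ^ 2 * (ε * (S / k i)) + 2 * (D * (S / k i / W ^ 2))) * k i
      = 2 * ‖a‖ ^ 2 * Q * k i + ‖a‖ ^ 2 * (ε * S) + 2 * (D * (S / W ^ 2)) := by
    field_simp
  rw [h1]
  linarith

theorem hsSum_star (b : HilbertBasis ι ℂ h) (T : h →L[ℂ] h) : hsSum b (star T) = hsSum b T :=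
  hsSum_adjoint b b T

/-- Leibniz: `[a, R²] = [a, R] R + R [a, R]`. Each product of Hilbert–Schmidt operators is estimated
with the weight `t` on the side of `R` and `t⁻¹` on the side of the commutator. -/
theorem sum_abs_sub_le_of_hsSum_le {R a : h →L[ℂ] h} {α β t : ℝ} (hR : IsSelfAdjoint R)
    (hα : 0 ≤ α) (hβ : 0 ≤ β) (ht : 0 < t) (hRα : hsSum (onBasis h) R ≤ ENNReal.ofReal α)
    (hX : hsSum (onBasis h) (a * R - R * a) ≤ ENNReal.ofReal β) (F : Finset (basisSet h)) :
    ∑ i ∈ F, (⟪onBasis h i, CFC.abs (a * (R * R) - R * R * a) (onBasis h i)⟫_ℂ).re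
      ≤ t * α + t⁻¹ * β := by
  refine sum_abs_le_of_forall_contraction (fun V hV F => ?_) F
  set X := a * R - R * a with hXdef
  have h1 : a * (R * R) - R * R * a = star (star X) * R + star R * X := by
    rw [star_star, hR.star_eq, hXdef]; noncomm_ring
  have h2 := sum_re_inner_le (A := star X) (B := R) hβ hα (inv_pos.2 ht)
    (by rw [hsSum_star]; exact hX) hRα hV F
  have h3 := sum_re_inner_le (A := R) (B := X) hα hβ ht hRα hX hV F
  have h4 : ∀ i, (⟪V (onBasis h i), (a * (R * R) - R * R * a) (onBasis h i)⟫_ℂ).re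
      = (⟪V (onBasis h i), (star (star X) * R) (onBasis h i)⟫_ℂ).re
        + (⟪V (onBasis h i), (star R * X) (onBasis h i)⟫_ℂ).re := fun i => by
    rw [h1, add_apply, inner_add_right, Complex.add_re]
  simp only [h4, Finset.sum_add_distrib]
  rw [inv_inv] at h2
  linarith

/-- `t` makes the first term at most `η/2` whatever the size of `δ`, and then `δ = t η / 2` makes
the second equal to `η/2`. -/
theorem exists_weight_parameters {S η : ℝ} (hS : 0 ≤ S) (hη : 0 < η) :
    ∃ t δ : ℝ, 0 < t ∧ 0 < δ ∧ t * S + t⁻¹ * δ ≤ η := by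
  have ht : 0 < η / (2 * (S + 1)) := by positivity
  refine ⟨η / (2 * (S + 1)), η / (2 * (S + 1)) * (η / 2), ht, by positivity, ?_⟩
  rw [inv_mul_cancel_left₀ ht.ne']
  have h1 : η / (2 * (S + 1)) * S = η / 2 * (S / (S + 1)) := by field_simp
  have h2 : η / 2 * (S / (S + 1)) ≤ η / 2 :=
    mul_le_of_le_one_right (by positivity) (by rw [div_le_one (by positivity)]; linarith)
  linarith

theorem hsSum_diag_sqrt (b : HilbertBasis ι ℂ h) {R : h →L[ℂ] h} {w : ι → ℝ} (hw : ∀ n, 0 ≤ w n)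
    (hR : ∀ n, R (b n) = ((√(w n) : ℝ) : ℂ) • b n) :
    hsSum b R = ∑' n, ENNReal.ofReal (w n) := by
  rw [hsSum_diag b hR]
  exact tsum_congr fun n => by rw [Real.sq_sqrt (hw n)]

/-- The trace norm of the commutators is of lower order than the sum of the weights. -/
theorem IsSlowWeightFamily.eventually_sum_abs_le {l : Filter I} {lam : ι → ℝ} {k : I → ℝ}
    {w : I → ι → ℝ} (hw : IsSlowWeightFamily l lam k w) (b : HilbertBasis ι ℂ h)
    {R : I → h →L[ℂ] h} (hR : ∀ i n, R i (b n) = ((√(w i n) : ℝ) : ℂ) • b n) {a : h →L[ℂ] h} {D : ℝ}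
    (hD : 0 ≤ D)
    (hcol : ∀ n, ∑' m, entrySq b a m n * ENNReal.ofReal ((lam m - lam n) ^ 2) ≤ ENNReal.ofReal D)
    (hrow : ∀ m, ∑' n, entrySq b a m n * ENNReal.ofReal ((lam m - lam n) ^ 2) ≤ ENNReal.ofReal D)
    {η : ℝ} (hη : 0 < η) :
    ∀ᶠ i in l, ∀ F : Finset (basisSet h),
      ∑ j ∈ F, (⟪onBasis h j, CFC.abs (a * (R i * R i) - R i * R i * a) (onBasis h j)⟫_ℂ).re
        ≤ η / k i := by
  obtain ⟨S, hS, hSi⟩ := hw.sum_le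
  obtain ⟨t, δ, ht, hδ, htδ⟩ := exists_weight_parameters hS hη
  filter_upwards [hw.pos, hSi, hw.eventually_hsSum_commutator_le b hR hD hcol hrow hδ]
    with i hk hS' hδ' F
  have hsa : IsSelfAdjoint (R i) :=
    IsSelfAdjoint.of_nonneg (isPositive_diag b (hR i) fun n => Real.sqrt_nonneg _)
  refine (sum_abs_sub_le_of_hsSum_le (α := S / k i) (β := δ / k i) hsa (div_nonneg hS hk.le)
    (div_nonneg hδ.le hk.le) ht ?_ ?_ F).trans ?_
  · rwa [hsSum_basis_indep (onBasis h) b, hsSum_diag_sqrt b (hw.nonneg i) (hR i)]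
  · rwa [hsSum_basis_indep (onBasis h) b]
  · rw [le_div_iff₀ hk]
    have h1 : (t * (S / k i) + t⁻¹ * (δ / k i)) * k i = t * S + t⁻¹ * δ := by field_simp
    rw [h1]; exact htδ

/-! ### Cyclicity of the trace -/

/-- Cyclicity of the trace for products of Hilbert–Schmidt operators. -/
theorem hasSum_inner_mul_comm (b : HilbertBasis ι ℂ h) (b' : HilbertBasis κ ℂ h) {X Y : h →L[ℂ] h}
    (hX : hsSum b X ≠ ∞) (hY : hsSum b Y ≠ ∞) :
    HasSum (fun n => ⟪b n, (X * Y) (b n)⟫_ℂ) (∑' j, ⟪b' j, (Y * X) (b' j)⟫_ℂ) := by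
  have h1 := hasSum_inner_of_hsSum_ne_top b b' (A := star X) (B := Y) (by rwa [hsSum_star]) hY
  simp only [← ContinuousLinearMap.star_eq_adjoint, star_star] at h1
  simp only [ContinuousLinearMap.star_eq_adjoint, ContinuousLinearMap.adjoint_inner_left] at h1
  exact h1

theorem hsSum_mul_ne_top_left (b : HilbertBasis ι ℂ h) (A : h →L[ℂ] h) {B : h →L[ℂ] h}
    (hB : hsSum b B ≠ ∞) : hsSum b (A * B) ≠ ∞ :=
  ne_top_of_le_ne_top (ENNReal.mul_ne_top (by simp) hB) (hsSum_mul_le_left b A B)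

theorem hsSum_mul_ne_top_right (b : HilbertBasis ι ℂ h) {A : h →L[ℂ] h} (B : h →L[ℂ] h)
    (hA : hsSum b A ≠ ∞) : hsSum b (A * B) ≠ ∞ :=
  ne_top_of_le_ne_top (ENNReal.mul_ne_top (by simp) hA) (hsSum_mul_le_right b A B)

theorem hasSum_inner_mul_comm' (b : HilbertBasis ι ℂ h) (b' : HilbertBasis κ ℂ h)
    {X Y : h →L[ℂ] h} (hX : hsSum b X ≠ ∞) (hY : hsSum b Y ≠ ∞) {s : ℂ}
    (hs : HasSum (fun j => ⟪b' j, (Y * X) (b' j)⟫_ℂ) s) :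
    HasSum (fun n => ⟪b n, (X * Y) (b n)⟫_ℂ) s := by
  have := hasSum_inner_mul_comm b b' hX hY
  rwa [hs.tsum_eq] at this

/-- The diagonal values of `c (R R)` are summable with the same sum in each basis. -/
theorem hasSum_inner_mul_sq (b : HilbertBasis ι ℂ h) (b' : HilbertBasis κ ℂ h) (c : h →L[ℂ] h)
    {R : h →L[ℂ] h} (hR : hsSum b R ≠ ∞) :
    HasSum (fun n => ⟪b n, (c * (R * R)) (b n)⟫_ℂ) (∑' j, ⟪b' j, (c * (R * R)) (b' j)⟫_ℂ) := by
  have hR' : hsSum b' R ≠ ∞ := by rwa [hsSum_basis_indep b' b]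
  have h1 := hasSum_inner_mul_comm b' b (X := c * R) (Y := R) (hsSum_mul_ne_top_left b' c hR') hR'
  have h2 := hasSum_inner_mul_comm b b (X := R) (Y := c * R) hR (hsSum_mul_ne_top_left b c hR)
  -- Cyclicity passes from `cRR` in `b` to `RcR` in `b'`; a second use inside `b'` returns to `cRR`.
  have h3 := hasSum_inner_mul_comm b b' (X := c * R) (Y := R) (hsSum_mul_ne_top_left b c hR) hR
  have h4 := hasSum_inner_mul_comm b' b' (X := R) (Y := c * R) hR' (hsSum_mul_ne_top_left b' c hR')
  rw [h4.tsum_eq] at h3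
  simpa only [mul_assoc] using h3

/-- The diagonal sum of `[a, c] R²` is controlled by the commutator of `a` and `R`. -/
theorem norm_tsum_inner_commutator_le (b : HilbertBasis ι ℂ h) {R a c : h →L[ℂ] h} {α β t : ℝ}
    (hR : IsSelfAdjoint R) (hα : 0 ≤ α) (hβ : 0 ≤ β) (ht : 0 < t)
    (hRα : hsSum b R ≤ ENNReal.ofReal α)
    (hX : hsSum b (a * R - R * a) ≤ ENNReal.ofReal β) :
    ‖∑' n, ⟪b n, ((a * c - c * a) * (R * R)) (b n)⟫_ℂ‖
      ≤ t * α + t⁻¹ * (‖c‖ ^ 2 * β) := by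
  have hRt : hsSum b R ≠ ∞ := ne_top_of_le_ne_top ENNReal.ofReal_ne_top hRα
  set X := a * R - R * a with hXdef
  have hXt : hsSum b X ≠ ∞ := ne_top_of_le_ne_top ENNReal.ofReal_ne_top hX
  -- `s` is the common value of `Tr(c R² a) = Tr(R a c R) = Tr(a c R²)`. Each cyclic move keeps one
  -- factor `R` on either side, so that only products of Hilbert–Schmidt operators occur.
  obtain ⟨s, hs⟩ : ∃ s, HasSum (fun n => ⟪b n, (c * (R * R) * a) (b n)⟫_ℂ) s := by
    have := hasSum_inner_mul_comm b b (X := c * R) (Y := R * a) (hsSum_mul_ne_top_left b c hRt)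
      (hsSum_mul_ne_top_right b a hRt)
    exact ⟨_, by simpa only [mul_assoc] using this⟩
  have h1 : HasSum (fun n => ⟪b n, ((R * a) * (c * R)) (b n)⟫_ℂ) s := by
    refine hasSum_inner_mul_comm' b b (hsSum_mul_ne_top_right b a hRt)
      (hsSum_mul_ne_top_left b c hRt) ?_
    simpa only [mul_assoc] using hs
  have h2 : HasSum (fun n => ⟪b n, ((a * c) * (R * R)) (b n)⟫_ℂ) s := by
    have := hasSum_inner_mul_comm' b b (X := (a * c) * R) (Y := R) (s := s)
      (hsSum_mul_ne_top_left b _ hRt) hRt (by simpa only [mul_assoc] using h1)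
    simpa only [mul_assoc] using this
  -- the two remaining products
  have hbd : ∀ A B : h →L[ℂ] h, ∀ p q : ℝ, 0 ≤ p → 0 ≤ q → hsSum b A ≤ ENNReal.ofReal p →
      hsSum b B ≤ ENNReal.ofReal q → ∀ F : Finset ι,
      ∑ n ∈ F, ‖⟪A (b n), B (b n)⟫_ℂ‖ ≤ (t * p + t⁻¹ * q) / 2 := by
    intro A B p q hp hq hA hB F
    calc _ ≤ ∑ n ∈ F, (t * ‖A (b n)‖ ^ 2 + t⁻¹ * ‖B (b n)‖ ^ 2) / 2 :=
          Finset.sum_le_sum fun n _ => norm_inner_le_weighted _ _ ht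
      _ = (t * ∑ n ∈ F, ‖A (b n)‖ ^ 2 + t⁻¹ * ∑ n ∈ F, ‖B (b n)‖ ^ 2) / 2 := by
          rw [← Finset.sum_div, Finset.sum_add_distrib, Finset.mul_sum, Finset.mul_sum]
      _ ≤ _ := by
          have := sum_norm_sq_le_of_hsSum_le hp hA F
          have := sum_norm_sq_le_of_hsSum_le hq hB F
          gcongr
  have hcX : hsSum b (c * X) ≤ ENNReal.ofReal (‖c‖ ^ 2 * β) := by
    refine (hsSum_mul_le_left b c X).trans ?_
    rw [ENNReal.ofReal_mul (by positivity), ENNReal.ofReal_pow (norm_nonneg _), ofReal_norm]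
    gcongr
  have hXc : hsSum b (X * c) ≤ ENNReal.ofReal (‖c‖ ^ 2 * β) := by
    refine (hsSum_mul_le_right b X c).trans ?_
    rw [ENNReal.ofReal_mul (by positivity), ENNReal.ofReal_pow (norm_nonneg _), ofReal_norm]
    gcongr
  have hc0 : 0 ≤ ‖c‖ ^ 2 * β := by positivity
  -- `Tr(ac R²) - Tr(ca R²) = - Tr(c X R) - Tr(c R X)`
  have h3 : HasSum (fun n => ⟪b n, ((c * a) * (R * R)) (b n)⟫_ℂ)
      (∑' n, ⟪b n, ((c * a) * (R * R)) (b n)⟫_ℂ) := hasSum_inner_mul_sq b b (c * a) hRt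
  have h4 : HasSum (fun n => ⟪b n, (c * X * R) (b n)⟫_ℂ) (∑' n, ⟪b n, (R * (c * X)) (b n)⟫_ℂ) :=
    hasSum_inner_mul_comm b b (hsSum_mul_ne_top_left b c hXt) hRt
  have h5 : HasSum (fun n => ⟪b n, (c * R * X) (b n)⟫_ℂ) (∑' n, ⟪b n, (X * (c * R)) (b n)⟫_ℂ) :=
    hasSum_inner_mul_comm b b (hsSum_mul_ne_top_left b c hRt) hXt
  have hkey : ∀ n, ⟪b n, ((c * a) * (R * R)) (b n)⟫_ℂ
      = ⟪b n, (c * (R * R) * a) (b n)⟫_ℂ + (⟪b n, (c * X * R) (b n)⟫_ℂ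
        + ⟪b n, (c * R * X) (b n)⟫_ℂ) := by
    intro n
    rw [← inner_add_right, ← inner_add_right, ← add_apply, ← add_apply]
    congr 2
    rw [hXdef]
    noncomm_ring
  have h6 := hs.add (h4.add h5)
  simp only [← hkey] at h6
  have h7 := h2.sub h6
  have h8 : ∀ n, ⟪b n, ((a * c - c * a) * (R * R)) (b n)⟫_ℂ
      = ⟪b n, ((a * c) * (R * R)) (b n)⟫_ℂ - ⟪b n, ((c * a) * (R * R)) (b n)⟫_ℂ := fun n => by
    rw [sub_mul, sub_apply, inner_sub_right]
  simp only [h8]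
  rw [h7.tsum_eq, sub_add_cancel_left, norm_neg]
  have h9 : ‖∑' n, ⟪b n, (R * (c * X)) (b n)⟫_ℂ‖ ≤ (t * α + t⁻¹ * (‖c‖ ^ 2 * β)) / 2 := by
    have e : ∀ n, ⟪b n, (R * (c * X)) (b n)⟫_ℂ = ⟪R (b n), (c * X) (b n)⟫_ℂ := fun n => by
      conv_lhs => rw [← hR.star_eq]
      rw [mul_apply_eq_comp, ContinuousLinearMap.star_eq_adjoint,
        ContinuousLinearMap.adjoint_inner_right]
    simp only [e]
    have hb := hbd R (c * X) _ _ hα hc0 hRα hcX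
    have hsm : Summable fun n => ‖⟪R (b n), (c * X) (b n)⟫_ℂ‖ :=
      summable_of_sum_le (fun n => norm_nonneg _) hb
    exact (norm_tsum_le_tsum_norm hsm).trans (hsm.tsum_le_of_sum_le hb)
  have h10 : ‖∑' n, ⟪b n, (X * (c * R)) (b n)⟫_ℂ‖ ≤ (t * α + t⁻¹ * (‖c‖ ^ 2 * β)) / 2 := by
    have h11 := hasSum_inner_mul_comm b b (X := R) (Y := X * c) hRt
      (hsSum_mul_ne_top_right b c hXt)
    have h12 : ∑' n, ⟪b n, (X * (c * R)) (b n)⟫_ℂ = ∑' n, ⟪b n, (R * (X * c)) (b n)⟫_ℂ := by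
      rw [h11.tsum_eq]
      simp only [mul_assoc]
    rw [h12]
    have e : ∀ n, ⟪b n, (R * (X * c)) (b n)⟫_ℂ = ⟪R (b n), (X * c) (b n)⟫_ℂ := fun n => by
      conv_lhs => rw [← hR.star_eq]
      rw [mul_apply_eq_comp, ContinuousLinearMap.star_eq_adjoint,
        ContinuousLinearMap.adjoint_inner_right]
    simp only [e]
    have hb := hbd R (X * c) _ _ hα hc0 hRα hXc
    have hsm : Summable fun n => ‖⟪R (b n), (X * c) (b n)⟫_ℂ‖ :=
      summable_of_sum_le (fun n => norm_nonneg _) hb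
    exact (norm_tsum_le_tsum_norm hsm).trans (hsm.tsum_le_of_sum_le hb)
  refine (norm_add_le _ _).trans ?_
  linarith

theorem IsSlowWeightFamily.eventually_norm_tsum_le {l : Filter I} {lam : ι → ℝ} {k : I → ℝ}
    {w : I → ι → ℝ} (hw : IsSlowWeightFamily l lam k w) (b : HilbertBasis ι ℂ h)
    {R : I → h →L[ℂ] h} (hR : ∀ i n, R i (b n) = ((√(w i n) : ℝ) : ℂ) • b n) {a : h →L[ℂ] h} {D : ℝ}
    (hD : 0 ≤ D)
    (hcol : ∀ n, ∑' m, entrySq b a m n * ENNReal.ofReal ((lam m - lam n) ^ 2) ≤ ENNReal.ofReal D)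
    (hrow : ∀ m, ∑' n, entrySq b a m n * ENNReal.ofReal ((lam m - lam n) ^ 2) ≤ ENNReal.ofReal D)
    (c : h →L[ℂ] h) {η : ℝ} (hη : 0 < η) :
    ∀ᶠ i in l, ‖∑' n, ⟪b n, ((a * c - c * a) * (R i * R i)) (b n)⟫_ℂ‖ ≤ η / k i := by
  obtain ⟨S, hS, hSi⟩ := hw.sum_le
  obtain ⟨t, δ, ht, hδ, htδ⟩ := exists_weight_parameters hS hη
  -- The commutator bound will be multiplied by `‖c‖²`; dividing in advance absorbs it, and the `+
  -- 1` covers `c = 0`.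
  have hδ' : 0 < δ / (‖c‖ ^ 2 + 1) := by positivity
  filter_upwards [hw.pos, hSi, hw.eventually_hsSum_commutator_le b hR hD hcol hrow hδ']
    with i hk hS' hδi
  have hsa : IsSelfAdjoint (R i) :=
    IsSelfAdjoint.of_nonneg (isPositive_diag b (hR i) fun n => Real.sqrt_nonneg _)
  refine (norm_tsum_inner_commutator_le b (α := S / k i) (β := δ / (‖c‖ ^ 2 + 1) / k i) (c := c)
    hsa (div_nonneg hS hk.le) (div_nonneg hδ'.le hk.le) ht ?_ hδi).trans ?_
  · rwa [hsSum_diag_sqrt b (hw.nonneg i) (hR i)]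
  · rw [le_div_iff₀ hk]
    have h1 : (t * (S / k i) + t⁻¹ * (‖c‖ ^ 2 * (δ / (‖c‖ ^ 2 + 1) / k i))) * k i
        = t * S + t⁻¹ * (δ * (‖c‖ ^ 2 / (‖c‖ ^ 2 + 1))) := by field_simp
    have h2 : δ * (‖c‖ ^ 2 / (‖c‖ ^ 2 + 1)) ≤ δ :=
      mul_le_of_le_one_right hδ.le (by rw [div_le_one (by positivity)]; linarith)
    have h3 := mul_le_mul_of_nonneg_left h2 (inv_pos.2 ht).le
    rw [h1]
    linarith

end

section

variable {h : Type*} [NormedAddCommGroup h] [InnerProductSpace ℂ h] [CompleteSpace h]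
variable {L : h →ₗ.[ℂ] h}

/-! ### The spectral decomposition of `L` -/

theorem mem_eigenspace_iff {x : ℝ} {v : h} :
    v ∈ eigenspace L x ↔ ∃ hv : v ∈ L.domain, L ⟨v, hv⟩ = (x : ℂ) • v := by
  constructor
  · rintro ⟨w, hw, rfl⟩
    refine ⟨w.2, ?_⟩
    have h1 : L.toFun w - (x : ℂ) • (w : h) = 0 := hw
    exact sub_eq_zero.1 h1
  · rintro ⟨hv, hLv⟩
    refine ⟨⟨v, hv⟩, ?_, rfl⟩
    change L.toFun ⟨v, hv⟩ - (x : ℂ) • v = 0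
    exact sub_eq_zero.2 hLv

theorem inner_apply_eq (hL : IsSelfAdjoint L) (x y : L.domain) :
    ⟪L x, (y : h)⟫_ℂ = ⟪(x : h), L y⟫_ℂ := by
  have hA : LinearPMap.adjoint L = L := LinearPMap.isSelfAdjoint_def.1 hL
  have := LinearPMap.adjoint_isFormalAdjoint hL.dense_domain
  rw [hA] at this
  exact this x y

/-- A weak eigenvector defines a bounded functional `y ↦ ⟪v, L y⟫`, so it lies in the domain of the
adjoint, which is `L`. Weak conditions are closed, hence so are the eigenspaces. -/
theorem mem_eigenspace_of_inner (hL : IsSelfAdjoint L) {x : ℝ} {v : h}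
    (hv : ∀ y : L.domain, ⟪v, L y⟫_ℂ = (x : ℂ) * ⟪v, (y : h)⟫_ℂ) : v ∈ eigenspace L x := by
  have hA : LinearPMap.adjoint L = L := LinearPMap.isSelfAdjoint_def.1 hL
  have hdom : v ∈ L.domain := by
    have h1 : Continuous ((innerₛₗ ℂ v).comp L.toFun) := by
      refine AddMonoidHomClass.continuous_of_bound _ (|x| * ‖v‖) fun y => ?_
      change ‖⟪v, L y⟫_ℂ‖ ≤ _
      rw [hv, norm_mul, Complex.norm_real, mul_assoc]
      exact mul_le_mul_of_nonneg_left (norm_inner_le_norm _ _) (norm_nonneg _)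
    have := (LinearPMap.mem_adjoint_domain_iff (T := L) v).2 h1
    rwa [hA] at this
  refine mem_eigenspace_iff.2 ⟨hdom, ?_⟩
  refine hL.dense_domain.eq_of_inner_left (𝕜 := ℂ) fun y hy => ?_
  rw [inner_apply_eq hL ⟨v, hdom⟩ ⟨y, hy⟩, hv ⟨y, hy⟩, inner_smul_left, Complex.conj_ofReal]

theorem isClosed_eigenspace (hL : IsSelfAdjoint L) (x : ℝ) :
    IsClosed (eigenspace L x : Set h) := by
  have h1 : (eigenspace L x : Set h)
      = ⋂ y : L.domain, {v : h | ⟪v, L y⟫_ℂ = (x : ℂ) * ⟪v, (y : h)⟫_ℂ} := by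
    ext v
    rw [mem_iInter]
    refine ⟨fun hv y => ?_, fun hv => mem_eigenspace_of_inner hL hv⟩
    obtain ⟨hd, hv⟩ := mem_eigenspace_iff.1 hv
    change ⟪v, L y⟫_ℂ = _
    rw [← inner_apply_eq hL ⟨v, hd⟩ y, hv, inner_smul_left, Complex.conj_ofReal]
  rw [h1]
  exact isClosed_iInter fun y => isClosed_eq (by fun_prop) (by fun_prop)

theorem apply_mem_orthogonal_kernel (hL : IsSelfAdjoint L) (x : L.domain) :
    L x ∈ (eigenspace L 0)ᗮ := by
  intro v hv
  obtain ⟨hd, hv⟩ := mem_eigenspace_iff.1 hv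
  rw [← inner_apply_eq hL ⟨v, hd⟩ x, hv]
  simp

theorem not_finiteDimensional (hL : IsDiscreteOffKernel L) : ¬ FiniteDimensional ℂ h := by
  intro hfin
  refine hL.unbounded ⟨‖LinearMap.toContinuousLinearMap L.toFun‖, fun x => ?_⟩
  exact (LinearMap.toContinuousLinearMap L.toFun).le_opNorm x

/-- The compact inverse of `L` off the kernel is a positive operator which vanishes exactly
on the kernel. -/
theorem exists_positive_compact_inverse (hL : IsDiscreteOffKernel L) :
    ∃ K : h →L[ℂ] h, IsCompactOperator K ∧ K.IsPositive ∧
      (∀ x, K x ∈ (eigenspace L 0)ᗮ) ∧ (∀ x, K x = 0 → x ∈ eigenspace L 0) ∧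
      ∀ x ∈ (eigenspace L 0)ᗮ, ∃ hx : K x ∈ L.domain, L ⟨K x, hx⟩ = x := by
  obtain ⟨K, hKc, hK0, hK⟩ := hL.compact_inverse
  set E := eigenspace L 0 with hE
  have : CompleteSpace E := (isClosed_eigenspace hL.selfAdjoint 0).completeSpace_coe
  -- Only the component `q` off the kernel matters: `K x = K q` and `q = L (K q)`, so `⟪K x, x⟫ = ⟪K
  -- q, L (K q)⟫` and positivity comes from that of `L`.
  have hdec : ∀ x : h, ∃ p ∈ E, ∃ q ∈ Eᗮ, x = p + q ∧ K x = K q := by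
    intro x
    obtain ⟨p, hp, q, hq, hx⟩ := E.exists_add_mem_mem_orthogonal x
    exact ⟨p, hp, q, hq, hx, by rw [hx, map_add, hK0 p hp, zero_add]⟩
  have hmem : ∀ x, K x ∈ Eᗮ := fun x => by
    obtain ⟨p, -, q, hq, -, hKx⟩ := hdec x
    rw [hKx]; exact (hK q hq).1
  refine ⟨K, hKc, ?_, hmem, fun x hx => ?_, fun x hx => (hK x hx).2⟩
  · rw [ContinuousLinearMap.isPositive_iff_complex]
    intro x
    obtain ⟨p, hp, q, hq, hx, hKx⟩ := hdec x
    obtain ⟨hqm, hqd, hLq⟩ := hK q hq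
    have h1 : ⟪K x, x⟫_ℂ = ⟪K q, L ⟨K q, hqd⟩⟫_ℂ := by
      rw [hKx, hLq, hx, inner_add_right, inner_eq_zero_symm.1 (hqm p hp), zero_add]
    have h2 : (starRingEnd ℂ) ⟪K q, L ⟨K q, hqd⟩⟫_ℂ = ⟪K q, L ⟨K q, hqd⟩⟫_ℂ := by
      rw [inner_conj_symm]; exact inner_apply_eq hL.selfAdjoint ⟨K q, hqd⟩ ⟨K q, hqd⟩
    rw [h1]
    exact ⟨Complex.conj_eq_iff_re.1 h2, hL.nonneg ⟨K q, hqd⟩⟩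
  · obtain ⟨p, hp, q, hq, hx', hKx⟩ := hdec x
    obtain ⟨-, hqd, hLq⟩ := hK q hq
    have h1 : q = 0 := by
      rw [← hLq]
      have h2 : (⟨K q, hqd⟩ : L.domain) = 0 := Subtype.ext (hKx.symm.trans hx)
      rw [h2, LinearPMap.map_zero]
    rw [hx', h1, add_zero]
    exact hp

/-- `b` is an orthonormal basis of eigenvectors of `L`: those indexed by `ℕ` belong to the
positive eigenvalues, in increasing order, the other ones span the kernel. -/
structure IsEigenbasis {κ : Type*} (L : h →ₗ.[ℂ] h) (b : HilbertBasis (ℕ ⊕ κ) ℂ h)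
    (lam : ℕ ⊕ κ → ℝ) : Prop where
  kernel : ∀ k, lam (Sum.inr k) = 0
  pos : ∀ n, 0 < lam (Sum.inl n)
  mono : Monotone fun n => lam (Sum.inl n)
  tendsto : Tendsto (fun n => lam (Sum.inl n)) atTop atTop
  mem : ∀ i, b i ∈ eigenspace L (lam i)

/-- The eigenvectors of the compact inverse `K` for `ν > 0` are eigenvectors of `L` for `ν⁻¹`.
Unboundedness of `L` forces infinitely many of them, and `ν → 0` by compactness. Any vector
orthogonal to them all is killed by `K`, hence lies in the kernel; since the kernel may have any
dimension, a separate index set is kept for it. -/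
theorem exists_isEigenbasis (hL : IsDiscreteOffKernel L) :
    ∃ (s : Set h) (b : HilbertBasis (ℕ ⊕ s) ℂ h) (lam : ℕ ⊕ s → ℝ), IsEigenbasis L b lam := by
  have hinf := not_finiteDimensional hL
  obtain ⟨K, hKc, hKp, hKm, hK0, hK⟩ := exists_positive_compact_inverse hL
  obtain ⟨g, ν, hg, hKg, hbd⟩ := exists_decreasing_eigensequence hinf hKc hKp
  have hν0 := eigenvalue_nonneg_of_bound hg hbd
  have hanti := eigenvalue_antitone_of_bound hg hKg hbd
  have hgm : ∀ n, 0 < ν n → g n ∈ (eigenspace L 0)ᗮ := fun n hn => by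
    have h1 := hKm (g n)
    rw [hKg] at h1
    exact (Submodule.smul_mem_iff _ (by exact_mod_cast hn.ne')).1 h1
  have hge : ∀ n, 0 < ν n → g n ∈ eigenspace L (ν n)⁻¹ := fun n hn => by
    obtain ⟨hd, hLK⟩ := hK (g n) (hgm n hn)
    have hn' : (ν n : ℂ) ≠ 0 := by exact_mod_cast hn.ne'
    have h1 : K (g n) ∈ eigenspace L (ν n)⁻¹ := by
      refine mem_eigenspace_iff.2 ⟨hd, ?_⟩
      rw [hLK, hKg, smul_smul]
      push_cast
      rw [inv_mul_cancel₀ hn', one_smul]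
    rw [hKg] at h1
    exact (Submodule.smul_mem_iff _ hn').1 h1
  have hνpos : ∀ n, 0 < ν n := by
    by_contra hcon
    push Not at hcon
    classical
    set N := Nat.find hcon with hN
    have hνN : ν N ≤ 0 := Nat.find_spec hcon
    have hpos : ∀ i < N, 0 < ν i := fun i hi => not_le.1 (Nat.find_min hcon hi)
    -- If the positive `ν` stopped at index `N`, `K` would vanish off `g_0, …, g_{N-1}`; the range
    -- of `L` would then be spanned by these finitely many eigenvectors and `L` would be bounded by
    -- the sum of their eigenvalues.
    refine hL.unbounded ⟨∑ i ∈ Finset.range N, (ν i)⁻¹, fun x => ?_⟩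
    set y := L x with hy
    set v := y - ∑ i ∈ Finset.range N, ⟪g i, y⟫_ℂ • g i with hv
    have hvm : v ∈ (eigenspace L 0)ᗮ := Submodule.sub_mem _
      (apply_mem_orthogonal_kernel hL.selfAdjoint x)
      (Submodule.sum_mem _ fun i hi => Submodule.smul_mem _ _
        (hgm i (hpos i (Finset.mem_range.1 hi))))
    have hvg : ∀ i < N, ⟪g i, v⟫_ℂ = 0 := fun i hi => by
      rw [hv, inner_sub_right, hg.inner_right_sum _ (Finset.mem_range.2 hi), sub_self]
    have hKv : K v = 0 := by
      have h1 := hbd N v hvg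
      have h2 : ν N * ‖v‖ ≤ 0 := mul_nonpos_of_nonpos_of_nonneg hνN (norm_nonneg _)
      exact norm_le_zero_iff.1 (h1.trans h2)
    have hv0 : v = 0 := by
      obtain ⟨hd, hLK⟩ := hK v hvm
      rw [← hLK]
      have h2 : (⟨K v, hd⟩ : L.domain) = 0 := Subtype.ext hKv
      rw [h2, LinearPMap.map_zero]
    rw [sub_eq_zero.1 hv0, Finset.sum_mul]
    refine norm_sum_le_of_le _ fun i hi => ?_
    have hi' := hpos i (Finset.mem_range.1 hi)
    obtain ⟨hd, hLg⟩ := mem_eigenspace_iff.1 (hge i hi')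
    rw [norm_smul, hg.1 i, mul_one, hy, ← inner_apply_eq hL.selfAdjoint ⟨g i, hd⟩ x, hLg,
      inner_smul_left, Complex.conj_ofReal, norm_mul, Complex.norm_real,
      Real.norm_of_nonneg (by positivity)]
    gcongr
    have := norm_inner_le_norm (𝕜 := ℂ) (g i) (x : h)
    rwa [hg.1 i, one_mul] at this
  have hνlim : Tendsto ν atTop (𝓝 0) := by
    have h1 := (tendsto_apply_orthonormal hKc hg).norm
    rw [norm_zero] at h1
    refine h1.congr fun n => ?_
    rw [hKg, norm_smul, hg.1 n, mul_one, Complex.norm_real, Real.norm_of_nonneg (hν0 n)]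
  have hνlim' : Tendsto (fun n => (ν n)⁻¹) atTop atTop :=
    tendsto_inv_nhdsGT_zero.comp (tendsto_nhdsWithin_iff.2 ⟨hνlim, Eventually.of_forall hνpos⟩)
  obtain ⟨w, B, hsw, hB⟩ := hg.toSubtypeRange.exists_hilbertBasis_extension
  have hBo : Orthonormal ℂ ((↑) : w → h) := hB ▸ B.orthonormal
  have hgne : ∀ (n : ℕ) (e : ↥(w \ range g)), ⟪g n, (e : h)⟫_ℂ = 0 := fun n e =>
    hBo.2 (i := ⟨g n, hsw ⟨n, rfl⟩⟩) (j := ⟨e, e.2.1⟩)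
      (fun h1 => e.2.2 ⟨n, congrArg Subtype.val h1⟩)
  -- The Hilbert basis extending `g` is reindexed to keep the order of the sequence `g`.
  let u : ℕ ⊕ ↥(w \ range g) → h := Sum.elim g (↑)
  have hu : Orthonormal ℂ u := by
    refine ⟨?_, ?_⟩
    · rintro (n | e)
      · exact hg.1 n
      · exact hBo.1 ⟨e, e.2.1⟩
    · rintro (n | e) (m | e') hne
      · exact hg.2 fun h1 => hne (by rw [h1])
      · exact hgne n e'
      · exact inner_eq_zero_symm.1 (hgne m e)
      · refine hBo.2 (i := ⟨e, e.2.1⟩) (j := ⟨e', e'.2.1⟩) fun h1 => hne ?_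
        exact congrArg Sum.inr (Subtype.ext (congrArg (fun z : w => (z : h)) h1))
  have husp : (Submodule.span ℂ (range u))ᗮ = ⊥ := by
    rw [eq_bot_iff]
    intro x hx
    have h1 : ∀ i, ⟪B i, x⟫_ℂ = 0 := by
      intro i
      refine hx _ (Submodule.subset_span ?_)
      rw [hB]
      by_cases hi : (i : h) ∈ range g
      · obtain ⟨n, hn⟩ := hi
        exact ⟨Sum.inl n, hn⟩
      · exact ⟨Sum.inr ⟨i, i.2, hi⟩, rfl⟩
    have h2 := hasSum_norm_inner_sq B x
    simp only [h1] at h2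
    have h3 : ‖x‖ ^ 2 = 0 :=
      h2.unique (by simp)
    simpa using h3
  refine ⟨w \ range g, HilbertBasis.mkOfOrthogonalEqBot hu husp,
    Sum.elim (fun n => (ν n)⁻¹) (fun _ => 0), fun k => rfl, fun n => inv_pos.2 (hνpos n),
    fun m n hmn => inv_anti₀ (hνpos n) (hanti hmn), hνlim', ?_⟩
  rw [HilbertBasis.coe_mkOfOrthogonalEqBot]
  rintro (n | e)
  · exact hge n (hνpos n)
  · refine hK0 _ ?_
    have h1 : ∀ n, ‖K (e : h)‖ ≤ ν n * ‖(e : h)‖ := fun n => hbd n _ fun i _ => hgne i e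
    have h2 : ‖K (e : h)‖ ≤ 0 * ‖(e : h)‖ :=
      ge_of_tendsto' (hνlim.mul_const _) h1
    rw [zero_mul] at h2
    exact norm_le_zero_iff.1 h2

/-! ### Counting function, spectral weight and Lipschitz algebra in an eigenbasis -/

section Eigenbasis

variable {κ : Type*} {b : HilbertBasis (ℕ ⊕ κ) ℂ h} {lam : ℕ ⊕ κ → ℝ}

theorem inner_eigenvector_eq_zero (hL : IsSelfAdjoint L) {x y : ℝ} {v w : h} (hxy : x ≠ y)
    (hv : v ∈ eigenspace L x) (hw : w ∈ eigenspace L y) : ⟪v, w⟫_ℂ = 0 := by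
  obtain ⟨hv1, hv2⟩ := mem_eigenspace_iff.1 hv
  obtain ⟨hw1, hw2⟩ := mem_eigenspace_iff.1 hw
  have h1 := inner_apply_eq hL ⟨v, hv1⟩ ⟨w, hw1⟩
  rw [hv2, hw2, inner_smul_left, inner_smul_right, Complex.conj_ofReal] at h1
  have h2 : ((x : ℂ) - y) * ⟪v, w⟫_ℂ = 0 := by rw [sub_mul, h1, sub_self]
  refine (mul_eq_zero.1 h2).resolve_left ?_
  exact sub_ne_zero.2 (by exact_mod_cast hxy)

/-- The counting function counts the vectors of an eigenbasis. -/
theorem IsEigenbasis.counting_eq (hb : IsEigenbasis L b lam) (hL : IsSelfAdjoint L) {x : ℝ} {m : ℕ}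
    (hm : ∀ n, lam (Sum.inl n) ≤ x ↔ n < m) : counting L x = m := by
  classical
  have h1 : (⨆ y ∈ Ioc (0 : ℝ) x, eigenspace L y : Submodule ℂ h)
      = Submodule.span ℂ (range fun n : Fin m => b (Sum.inl n)) := by
    refine le_antisymm (iSup₂_le fun y hy v hv => ?_) ?_
    · have hs : HasSum (fun i => ⟪b i, v⟫_ℂ • b i) v := by
        have := b.hasSum_repr v
        simpa only [b.repr_apply_apply] using this
      -- An eigenvector for `y ∈ (0, x]` is orthogonal to the kernel and to every `b (inl n)` with
      -- eigenvalue beyond `x`, so its expansion is a finite sum.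
      have hz : ∀ i ∉ (Finset.univ.image fun n : Fin m => (Sum.inl (n : ℕ) : ℕ ⊕ κ)),
          ⟪b i, v⟫_ℂ • b i = 0 := by
        intro i hi
        rw [inner_eigenvector_eq_zero hL ?_ (hb.mem i) hv, zero_smul]
        rintro rfl
        rcases i with n | k
        · exact hi (Finset.mem_image.2 ⟨⟨n, (hm n).1 hy.2⟩, Finset.mem_univ _, rfl⟩)
        · have := hy.1
          rw [hb.kernel] at this
          exact lt_irrefl _ this
      rw [hs.unique (hasSum_sum_of_ne_finset_zero hz)]
      refine Submodule.sum_mem _ fun i hi => Submodule.smul_mem _ _ (Submodule.subset_span ?_)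
      obtain ⟨n, -, rfl⟩ := Finset.mem_image.1 hi
      exact ⟨n, rfl⟩
    · rw [Submodule.span_le]
      rintro _ ⟨n, rfl⟩
      exact Submodule.mem_iSup_of_mem (lam (Sum.inl n)) (Submodule.mem_iSup_of_mem
        ⟨hb.pos n, (hm n).2 n.2⟩ (hb.mem _))
  rw [counting, h1, finrank_span_eq_card, Fintype.card_fin]
  exact (b.orthonormal.comp (fun n : Fin m => (Sum.inl (n : ℕ) : ℕ ⊕ κ))
    (Sum.inl_injective.comp Fin.val_injective)).linearIndependent

/-- As the eigenvalues increase to infinity, those at most `x` form an initial segment, and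
`counting L x` is its length. This equivalence replaces the dimension count from here on. -/
theorem IsEigenbasis.le_iff_lt_counting (hb : IsEigenbasis L b lam) (hL : IsSelfAdjoint L) (x : ℝ)
    (n : ℕ) : lam (Sum.inl n) ≤ x ↔ n < counting L x := by
  classical
  have hex : ∃ n, x < lam (Sum.inl n) := (hb.tendsto.eventually_gt_atTop x).exists
  have hm : ∀ n, lam (Sum.inl n) ≤ x ↔ n < Nat.find hex := by
    intro n
    constructor
    · intro hn
      by_contra hcon
      exact absurd ((Nat.find_spec hex).trans_le (hb.mono (not_lt.1 hcon))) (not_lt.2 hn)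
    · intro hn
      exact not_lt.1 (Nat.find_min hex hn)
  rw [hb.counting_eq hL hm, hm]

theorem IsEigenbasis.counting_mono (hb : IsEigenbasis L b lam) (hL : IsSelfAdjoint L) :
    Monotone (counting L) := by
  intro x y hxy
  by_contra hcon
  rw [not_le] at hcon
  have h1 := (hb.le_iff_lt_counting hL x _).2 hcon
  exact lt_irrefl _ ((hb.le_iff_lt_counting hL y _).1 (h1.trans hxy))

theorem IsEigenbasis.succ_le_counting (hb : IsEigenbasis L b lam) (hL : IsSelfAdjoint L) (n : ℕ) :
    n + 1 ≤ counting L (lam (Sum.inl n)) :=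
  (hb.le_iff_lt_counting hL _ n).1 le_rfl

theorem IsEigenbasis.tendsto_counting (hb : IsEigenbasis L b lam) (hL : IsSelfAdjoint L) :
    Tendsto (fun x => (counting L x : ℝ)) atTop atTop := by
  refine tendsto_natCast_atTop_atTop.comp (tendsto_atTop_atTop.2 fun n =>
    ⟨lam (Sum.inl n), fun x hx => ?_⟩)
  exact ((Nat.le_succ n).trans (hb.succ_le_counting hL n)).trans (hb.counting_mono hL hx)

variable (L lam) in
/-- The eigenvalues of the spectral weight. -/
noncomputable def weight : ℕ ⊕ κ → ℝ :=
  Sum.elim (fun n => (counting L (lam (Sum.inl n)) : ℝ)⁻¹) fun _ => 0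

theorem weight_nonneg (i : ℕ ⊕ κ) : 0 ≤ weight L lam i := by
  rcases i with n | k
  · exact inv_nonneg.2 (Nat.cast_nonneg _)
  · exact le_rfl

theorem IsEigenbasis.weight_le (hb : IsEigenbasis L b lam) (hL : IsSelfAdjoint L) (n : ℕ) :
    weight L lam (Sum.inl n) ≤ ((n : ℝ) + 1)⁻¹ := by
  refine inv_anti₀ (by positivity) ?_
  exact_mod_cast hb.succ_le_counting hL n

theorem IsEigenbasis.weight_antitone (hb : IsEigenbasis L b lam) (hL : IsSelfAdjoint L) :
    Antitone fun n => weight L lam (Sum.inl n) := by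
  intro m n hmn
  refine inv_anti₀ ?_ ?_
  · exact_mod_cast Nat.lt_of_lt_of_le m.succ_pos (hb.succ_le_counting hL m)
  · exact_mod_cast hb.counting_mono hL (hb.mono hmn)

theorem IsEigenbasis.starProjection_apply (hb : IsEigenbasis L b lam) (hL : IsSelfAdjoint L) (y : ℝ)
    (i : ℕ ⊕ κ) : (eigenspace L y).topologicalClosure.starProjection (b i)
      = if lam i = y then b i else 0 := by
  split_ifs with hi
  · rw [Submodule.starProjection_eq_self_iff]
    exact Submodule.le_topologicalClosure _ (hi ▸ hb.mem i)
  · rw [Submodule.starProjection_apply_eq_zero_iff, Submodule.orthogonal_closure]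
    intro v hv
    exact inner_eigenvector_eq_zero hL (Ne.symm hi) hv (hb.mem i)

/-- The convergence is in norm and need not be absolute. A finite partial sum avoiding the first `N`
eigenvalues is diagonal with at most one nonzero contribution to each entry, so its norm is at most
the largest entry, `1 / (N + 1)`. The uncountable index set is harmless because non-eigenvalues
contribute zero. -/
theorem IsEigenbasis.summable_spectralWeight (hb : IsEigenbasis L b lam) (hL : IsSelfAdjoint L) :
    Summable fun y : Ioi (0 : ℝ) => ((counting L y : ℂ)⁻¹) •
      (eigenspace L (y : ℝ)).topologicalClosure.starProjection := by
  classical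
  rw [summable_iff_vanishing_norm]
  intro ε hε
  obtain ⟨N, hN⟩ := exists_nat_one_div_lt hε
  refine ⟨(Finset.range N).image fun n => ⟨lam (Sum.inl n), hb.pos n⟩, fun t ht => ?_⟩
  set T := ∑ y ∈ t, ((counting L y : ℂ)⁻¹) •
      (eigenspace L (y : ℝ)).topologicalClosure.starProjection with hT
  have hTb : ∀ i, T (b i)
      = ((∑ y ∈ t, if lam i = y then (counting L y : ℝ)⁻¹ else 0 : ℝ) : ℂ) • b i := by
    intro i
    rw [hT, sum_apply, Complex.ofReal_sum, Finset.sum_smul]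
    refine Finset.sum_congr rfl fun y _ => ?_
    rw [smul_apply, hb.starProjection_apply hL]
    split_ifs <;> simp
  refine (norm_diag_le b hTb (C := 1 / ((N : ℝ) + 1)) (by positivity) fun i => ?_).trans_lt hN
  have h0 : ∀ y ∈ t, 0 ≤ (if lam i = (y : ℝ) then (counting L y : ℝ)⁻¹ else 0) := fun y _ => by
    split_ifs <;> positivity
  rw [abs_of_nonneg (Finset.sum_nonneg h0)]
  by_cases hi : ∃ y ∈ t, lam i = (y : ℝ)
  · obtain ⟨y, hy, hiy⟩ := hi
    rw [Finset.sum_eq_single_of_mem y hy fun z _ hz => if_neg fun h1 =>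
      hz (Subtype.ext (h1.symm.trans hiy)), if_pos hiy]
    rcases i with n | k
    · have hn : N ≤ n := by
        by_contra hcon
        refine Finset.disjoint_left.1 ht hy (Finset.mem_image.2
          ⟨n, Finset.mem_range.2 (not_le.1 hcon), Subtype.ext hiy⟩)
      rw [← hiy, one_div]
      refine (hb.weight_le hL n).trans (inv_anti₀ (by positivity) ?_)
      have : (N : ℝ) ≤ n := by exact_mod_cast hn
      linarith
    · have h1 : (0 : ℝ) < y := y.2
      rw [← hiy, hb.kernel] at h1
      exact absurd h1 (lt_irrefl _)
  · push Not at hi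
    rw [Finset.sum_eq_zero fun y hy => if_neg (hi y hy)]
    positivity

/-- The spectral weight is diagonal in the eigenbasis. -/
theorem IsEigenbasis.spectralWeight_apply (hb : IsEigenbasis L b lam) (hL : IsSelfAdjoint L)
    (i : ℕ ⊕ κ) : spectralWeight L (b i) = (weight L lam i : ℂ) • b i := by
  have hs := (hb.summable_spectralWeight hL).hasSum.mapL (ContinuousLinearMap.apply ℂ h (b i))
  have h1 : ∀ y : Ioi (0 : ℝ), (ContinuousLinearMap.apply ℂ h (b i)) (((counting L y : ℂ)⁻¹) •
      (eigenspace L (y : ℝ)).topologicalClosure.starProjection)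
      = if lam i = y then ((counting L y : ℂ)⁻¹) • b i else 0 := fun y => by
    rw [ContinuousLinearMap.apply_apply, smul_apply, hb.starProjection_apply hL]
    split_ifs <;> simp
  simp only [h1] at hs
  have h2 : spectralWeight L (b i) = _ := hs.tsum_eq.symm
  rw [h2]
  rcases i with n | k
  · have h3 := tsum_eq_single (L := .unconditional _) (f := fun y : Ioi (0 : ℝ) => if lam (Sum.inl n) = (y : ℝ) then
        ((counting L y : ℂ)⁻¹) • b (Sum.inl n) else 0) ⟨lam (Sum.inl n), hb.pos n⟩
      (fun y hy => if_neg fun h4 => hy (Subtype.ext h4.symm))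
    rw [h3, if_pos rfl]
    simp [weight]
  · have h3 : ∀ y : Ioi (0 : ℝ), (if lam (Sum.inr k) = (y : ℝ) then
        ((counting L y : ℂ)⁻¹) • b (Sum.inr k) else 0) = 0 := fun y => by
      refine if_neg fun h4 => ?_
      have : (0 : ℝ) < y := y.2
      rw [← h4, hb.kernel] at this
      exact lt_irrefl _ this
    simp only [h3]
    simp [weight]

/-- The entries of the bounded operator `[a, L]` are `(lam n - lam m)` times those of `a`, and
Parseval bounds the column by `‖[a, L] b_n‖² ≤ C²`. Rows then follow from the adjoint of `a`, which
lies in the same algebra. -/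
theorem IsEigenbasis.tsum_entrySq_le (hb : IsEigenbasis L b lam) (hL : IsSelfAdjoint L)
    {a : h →L[ℂ] h} (ha : a ∈ lipschitzAlgebra L hL) :
    ∃ D : ℝ, 0 ≤ D ∧ ∀ n, ∑' m, entrySq b a m n * ENNReal.ofReal ((lam m - lam n) ^ 2)
      ≤ ENNReal.ofReal D := by
  obtain ⟨C, hC⟩ := ha
  refine ⟨C ^ 2, sq_nonneg C, fun n => ?_⟩
  obtain ⟨hn, hLn⟩ := mem_eigenspace_iff.1 (hb.mem n)
  obtain ⟨hx, hCx⟩ := hC ⟨b n, hn⟩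
  rw [b.orthonormal.1 n, mul_one] at hCx
  set v := a (L ⟨b n, hn⟩) - L ⟨a (b n), hx⟩ with hv
  have h1 : ∀ m, entrySq b a m n * ENNReal.ofReal ((lam m - lam n) ^ 2) = ‖⟪b m, v⟫_ℂ‖ₑ ^ 2 := by
    intro m
    obtain ⟨hm, hLm⟩ := mem_eigenspace_iff.1 (hb.mem m)
    have h2 : ⟪b m, v⟫_ℂ = ((lam n - lam m : ℝ) : ℂ) * ⟪b m, a (b n)⟫_ℂ := by
      rw [hv, inner_sub_right, ← inner_apply_eq hL ⟨b m, hm⟩ ⟨a (b n), hx⟩, hLm, hLn, map_smul,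
        inner_smul_right, inner_smul_left, Complex.conj_ofReal]
      push_cast; ring
    rw [h2, enorm_mul, mul_pow, mul_comm, entrySq]
    congr 1
    rw [← ofReal_norm, Complex.norm_real, ← ENNReal.ofReal_pow (norm_nonneg _), Real.norm_eq_abs,
      sq_abs]
    congr 1
    ring
  rw [tsum_congr h1, tsum_enorm_inner_sq, ← ofReal_norm, ← ENNReal.ofReal_pow (norm_nonneg _)]
  refine ENNReal.ofReal_le_ofReal ?_
  gcongr

theorem IsEigenbasis.exists_entry_bound (hb : IsEigenbasis L b lam) (hL : IsSelfAdjoint L)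
    {a : h →L[ℂ] h} (ha : a ∈ lipschitzAlgebra L hL) :
    ∃ D : ℝ, 0 ≤ D ∧
      (∀ n, ∑' m, entrySq b a m n * ENNReal.ofReal ((lam m - lam n) ^ 2) ≤ ENNReal.ofReal D) ∧
      ∀ m, ∑' n, entrySq b a m n * ENNReal.ofReal ((lam m - lam n) ^ 2) ≤ ENNReal.ofReal D := by
  obtain ⟨D, hD, h1⟩ := hb.tsum_entrySq_le hL ha
  obtain ⟨D', hD', h2⟩ := hb.tsum_entrySq_le hL (star_mem ha)
  refine ⟨max D D', le_max_of_le_left hD, fun n => (h1 n).trans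
    (ENNReal.ofReal_le_ofReal (le_max_left _ _)), fun m => ?_⟩
  refine le_trans (le_of_eq ?_) ((h2 m).trans (ENNReal.ofReal_le_ofReal (le_max_right _ _)))
  refine tsum_congr fun n => ?_
  rw [entrySq_star]
  congr 2
  ring

end Eigenbasis

end

section

/-! ### Sums of powers -/

theorem summable_inv_succ_rpow {s : ℝ} (hs : 1 < s) :
    Summable fun n : ℕ => ((n : ℝ) + 1)⁻¹ ^ s := by
  have h1 := (summable_nat_add_iff 1).2 (Real.summable_one_div_nat_rpow.2 hs)
  refine h1.congr fun n => ?_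
  rw [Real.inv_rpow (by positivity), one_div]
  push_cast
  rfl

theorem tendsto_sub_mul_tsum_inv_succ_rpow :
    Tendsto (fun s : ℝ => (s - 1) * ∑' n : ℕ, ((n : ℝ) + 1)⁻¹ ^ s) (𝓝[>] 1) (𝓝 1) := by
  refine tendsto_sub_mul_tsum_nat_rpow.congr' ?_
  filter_upwards [self_mem_nhdsWithin] with s (hs : 1 < s)
  rw [(Real.summable_one_div_nat_rpow.2 hs).tsum_eq_zero_add]
  congr 1
  rw [Nat.cast_zero, Real.zero_rpow (by linarith), div_zero, zero_add]
  refine tsum_congr fun n => ?_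
  rw [Real.inv_rpow (by positivity), one_div]
  push_cast
  rfl

theorem inv_succ_rpow_le_one {s : ℝ} (hs : 0 ≤ s) (n : ℕ) : ((n : ℝ) + 1)⁻¹ ^ s ≤ 1 :=
  Real.rpow_le_one (by positivity) (inv_le_one_of_one_le₀ (by linarith [n.cast_nonneg (α := ℝ)])) hs

theorem inv_succ_rpow_nonneg (s : ℝ) (n : ℕ) : 0 ≤ ((n : ℝ) + 1)⁻¹ ^ s := by positivity

theorem summable_inv_succ_rpow_mul {x : ℕ → ℝ} {X : ℝ} (hx : ∀ n, |x n| ≤ X) {s : ℝ} (hs : 1 < s) :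
    Summable fun n : ℕ => ((n : ℝ) + 1)⁻¹ ^ s * x n := by
  refine Summable.of_norm_bounded ((summable_inv_succ_rpow hs).mul_right X) fun n => ?_
  rw [norm_mul, Real.norm_of_nonneg (inv_succ_rpow_nonneg s n)]
  exact mul_le_mul_of_nonneg_left (hx n) (inv_succ_rpow_nonneg s n)

/-- An Abelian theorem for Dirichlet series. -/
theorem tendsto_sub_mul_tsum_mul_zero {x : ℕ → ℝ} {X : ℝ} (h0 : ∀ n, 0 ≤ x n) (hx : ∀ n, x n ≤ X)
    (hlim : Tendsto x atTop (𝓝 0)) :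
    Tendsto (fun s : ℝ => (s - 1) * ∑' n : ℕ, ((n : ℝ) + 1)⁻¹ ^ s * x n) (𝓝[>] 1) (𝓝 0) := by
  have hX : 0 ≤ X := (h0 0).trans (hx 0)
  have habs : ∀ n, |x n| ≤ X := fun n => by rw [abs_of_nonneg (h0 n)]; exact hx n
  rw [Metric.tendsto_nhds]
  intro η hη
  obtain ⟨N, hN⟩ := eventually_atTop.1 (hlim.eventually_le_const (by positivity : 0 < η / 4))
  have h1 : Tendsto (fun s : ℝ => (s - 1) * (N * X)) (𝓝[>] 1) (𝓝 0) := by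
    have : Tendsto (fun s : ℝ => (s - 1) * (N * X)) (𝓝 1) (𝓝 ((1 - 1) * (N * X))) :=
      Continuous.tendsto (by fun_prop) 1
    rw [sub_self, zero_mul] at this
    exact this.mono_left nhdsWithin_le_nhds
  filter_upwards [self_mem_nhdsWithin, h1.eventually_lt_const (by positivity : 0 < η / 2),
    tendsto_sub_mul_tsum_inv_succ_rpow.eventually_lt_const (by norm_num : (1 : ℝ) < 2)]
    with s (hs : 1 < s) h2 h3
  have hs0 : 0 ≤ s := by linarith
  -- The tail costs `η/4` times a sum with `(s - 1)∑ < 2`, hence less than `η/2`; the first `N`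
  -- terms are bounded, and the factor `s - 1` makes them smaller than `η/2`.
  have hb : ∀ n : ℕ, ((n : ℝ) + 1)⁻¹ ^ s * x n
      ≤ ((n : ℝ) + 1)⁻¹ ^ s * (η / 4) + (if n ∈ Finset.range N then X else 0) := by
    intro n
    split_ifs with hn
    · have e1 := mul_le_mul (inv_succ_rpow_le_one hs0 n) (hx n) (h0 n) zero_le_one
      have e2 : 0 ≤ ((n : ℝ) + 1)⁻¹ ^ s * (η / 4) := by positivity
      linarith
    · rw [add_zero]
      exact mul_le_mul_of_nonneg_left (hN n (by simpa using hn)) (inv_succ_rpow_nonneg s n)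
  have hsum2 : HasSum (fun n : ℕ => if n ∈ Finset.range N then X else 0) (N * X) := by
    have := hasSum_sum_of_ne_finset_zero (L := .unconditional _) (f := fun n : ℕ => if n ∈ Finset.range N then X else 0)
      (s := Finset.range N) (fun n hn => if_neg hn)
    rwa [Finset.sum_congr rfl fun n hn => if_pos hn, Finset.sum_const, Finset.card_range,
      nsmul_eq_mul] at this
  have h4 := hasSum_le hb (summable_inv_succ_rpow_mul habs hs).hasSum
    (((summable_inv_succ_rpow hs).hasSum.mul_right (η / 4)).add hsum2)
  have h5 : 0 ≤ ∑' n : ℕ, ((n : ℝ) + 1)⁻¹ ^ s * x n :=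
    tsum_nonneg fun n => mul_nonneg (inv_succ_rpow_nonneg s n) (h0 n)
  have hs1 : 0 < s - 1 := by linarith
  rw [Real.dist_eq, sub_zero, abs_of_nonneg (mul_nonneg hs1.le h5)]
  have h6 := mul_le_mul_of_nonneg_left h4 hs1.le
  nlinarith

/-- Sequences equivalent to `1 / n` have the same residue at `1` as the zeta function. -/
theorem tendsto_sub_mul_tsum_rpow {d : ℕ → ℝ} (h0 : ∀ n, 0 ≤ d n)
    (hd : ∀ n, d n ≤ ((n : ℝ) + 1)⁻¹) (hlim : Tendsto (fun n : ℕ => ((n : ℝ) + 1) * d n) atTop (𝓝 1)) :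
    Tendsto (fun s : ℝ => (s - 1) * ∑' n : ℕ, d n ^ s) (𝓝[>] 1) (𝓝 1) := by
  set c : ℕ → ℝ := fun n => ((n : ℝ) + 1) * d n with hc
  have hn0 : ∀ n : ℕ, 0 < (n : ℝ) + 1 := fun n => by positivity
  have hc0 : ∀ n, 0 ≤ c n := fun n => mul_nonneg (hn0 n).le (h0 n)
  have hc1 : ∀ n, c n ≤ 1 := fun n => by
    have := mul_le_mul_of_nonneg_left (hd n) (hn0 n).le
    rwa [mul_inv_cancel₀ (hn0 n).ne'] at this
  have hdc : ∀ n, d n = ((n : ℝ) + 1)⁻¹ * c n := fun n => by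
    rw [hc]; exact (inv_mul_cancel_left₀ (hn0 n).ne' _).symm
  -- For `s ≤ 2` and `0 ≤ c ≤ 1` one has `c^s ≥ c²`. This exponent-free lower bound reduces the
  -- squeeze to the Abelian theorem for the null sequence `1 - c_n²`.
  have hx := tendsto_sub_mul_tsum_mul_zero (x := fun n => 1 - c n ^ 2) (X := 1)
    (fun n => by nlinarith [hc0 n, hc1 n]) (fun n => by nlinarith [hc0 n])
    (by have := (hlim.pow 2).const_sub 1; simpa using this)
  have hlow := tendsto_sub_mul_tsum_inv_succ_rpow.sub hx
  rw [sub_zero] at hlow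
  have hb : ∀ n, |1 - c n ^ 2| ≤ 1 := fun n => by
    rw [abs_le]; constructor <;> nlinarith [hc0 n, hc1 n]
  refine tendsto_of_tendsto_of_tendsto_of_le_of_le' hlow tendsto_sub_mul_tsum_inv_succ_rpow ?_ ?_
  · filter_upwards [Ioc_mem_nhdsGT (by norm_num : (1 : ℝ) < 2)] with s hs
    have hsm : Summable fun n => d n ^ s :=
      (summable_inv_succ_rpow hs.1).of_nonneg_of_le (fun n => Real.rpow_nonneg (h0 n) s)
        fun n => Real.rpow_le_rpow (h0 n) (hd n) (by linarith [hs.1])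
    rw [← mul_sub, ← (summable_inv_succ_rpow hs.1).tsum_sub (summable_inv_succ_rpow_mul hb hs.1)]
    refine mul_le_mul_of_nonneg_left (Summable.tsum_le_tsum (fun n => ?_)
      ((summable_inv_succ_rpow hs.1).sub (summable_inv_succ_rpow_mul hb hs.1)) hsm)
      (by linarith [hs.1])
    rw [← mul_one_sub, sub_sub_cancel, hdc n, Real.mul_rpow (by positivity) (hc0 n)]
    refine mul_le_mul_of_nonneg_left ?_ (inv_succ_rpow_nonneg s n)
    rw [← Real.rpow_natCast]
    exact Real.rpow_le_rpow_of_exponent_ge_of_imp (hc0 n) (hc1 n) (by exact_mod_cast hs.2)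
      (fun _ h => absurd h (by norm_num))
  · filter_upwards [self_mem_nhdsWithin] with s (hs : 1 < s)
    have hsm : Summable fun n => d n ^ s :=
      (summable_inv_succ_rpow hs).of_nonneg_of_le (fun n => Real.rpow_nonneg (h0 n) s)
        fun n => Real.rpow_le_rpow (h0 n) (hd n) (by linarith)
    refine mul_le_mul_of_nonneg_left (Summable.tsum_le_tsum (fun n => ?_) hsm
      (summable_inv_succ_rpow hs)) (by linarith)
    exact Real.rpow_le_rpow (h0 n) (hd n) (by linarith)

theorem tendsto_logMeanSeq_inv_succ :
    Tendsto (logMeanSeq fun n => ((n : ℝ) + 1)⁻¹) atTop (𝓝 1) := by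
  have h1 : Tendsto (fun N : ℕ => (Real.log N)⁻¹ * ((harmonic N : ℝ) - Real.log N)) atTop (𝓝 0) := by
    have h2 : Tendsto (fun N : ℕ => (Real.log N)⁻¹) atTop (𝓝 0) :=
      tendsto_inv_atTop_zero.comp tendsto_log_natCast_atTop
    simpa using h2.mul Real.tendsto_harmonic_sub_log
  have h3 := h1.add_const 1
  rw [zero_add] at h3
  refine h3.congr' ?_
  filter_upwards [tendsto_log_natCast_atTop.eventually_gt_atTop 0] with N hN
  rw [logMeanSeq, mul_sub, inv_mul_cancel₀ hN.ne', sub_add_cancel]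
  simp [harmonic]

/-- The logarithmic means of a sequence equivalent to `1 / n` tend to `1`. -/
theorem tendsto_logMeanSeq {d : ℕ → ℝ}
    (hlim : Tendsto (fun n : ℕ => ((n : ℝ) + 1) * d n) atTop (𝓝 1)) :
    Tendsto (logMeanSeq d) atTop (𝓝 1) := by
  have hn0 : ∀ n : ℕ, 0 < (n : ℝ) + 1 := fun n => by positivity
  have h1 : (fun n : ℕ => d n - ((n : ℝ) + 1)⁻¹) =o[atTop] fun n : ℕ => ((n : ℝ) + 1)⁻¹ := by
    rw [Asymptotics.isLittleO_iff_tendsto' (Eventually.of_forall fun n h =>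
      absurd h (inv_pos.2 (hn0 n)).ne')]
    have h2 := hlim.sub_const 1
    rw [sub_self] at h2
    refine h2.congr fun n => ?_
    rw [div_inv_eq_mul, sub_mul, inv_mul_cancel₀ (hn0 n).ne', mul_comm]
  have hdiv : Tendsto (fun N => ∑ n ∈ Finset.range N, ((n : ℝ) + 1)⁻¹) atTop atTop := by
    have := tendsto_logMeanSeq_inv_succ.pos_mul_atTop one_pos tendsto_log_natCast_atTop
    refine this.congr' ?_
    filter_upwards [tendsto_log_natCast_atTop.eventually_gt_atTop 0] with N hN
    rw [logMeanSeq, mul_comm, mul_inv_cancel_left₀ hN.ne']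
  -- Little-o passes to partial sums because the comparison series diverges.
  have h3 := h1.sum_range (fun n => (inv_pos.2 (hn0 n)).le) hdiv
  have h4 := h3.tendsto_div_nhds_zero
  have h5 := (h4.mul tendsto_logMeanSeq_inv_succ).add tendsto_logMeanSeq_inv_succ
  rw [zero_mul, zero_add] at h5
  refine h5.congr' ?_
  filter_upwards [hdiv.eventually_gt_atTop 0] with N hN
  rw [logMeanSeq, logMeanSeq, Finset.sum_sub_distrib]
  generalize ∑ n ∈ Finset.range N, ((n : ℝ) + 1)⁻¹ = A at hN ⊢
  have hA := hN.ne'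
  field_simp
  ring

/-! ### Asymptotics of the spectral weight -/

variable {h : Type*} [NormedAddCommGroup h] [InnerProductSpace ℂ h] [CompleteSpace h]
variable {L : h →ₗ.[ℂ] h} {κ : Type*} {b : HilbertBasis (ℕ ⊕ κ) ℂ h} {lam : ℕ ⊕ κ → ℝ}

/-- The counting function grows by a factor tending to `1` over intervals of constant length. -/
def HasSlowGrowth (L : h →ₗ.[ℂ] h) : Prop :=
  ∀ W η : ℝ, 0 < W → 1 < η → ∀ᶠ x in atTop, (counting L (x + W) : ℝ) ≤ η * counting L x

theorem weight_le_one (hb : IsEigenbasis L b lam) (hL : IsSelfAdjoint L) (i : ℕ ⊕ κ) :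
    weight L lam i ≤ 1 := by
  rcases i with n | k
  · exact (hb.weight_le hL n).trans
      (inv_le_one_of_one_le₀ (by linarith [n.cast_nonneg (α := ℝ)]))
  · exact zero_le_one

/-- One has `N(λ_n - 1) ≤ n < N(λ_n)`: the index is caught between values of the counting function
at distance one, whose ratio tends to `1`. Thus high multiplicities do not spoil the asymptotics. -/
theorem IsEigenbasis.tendsto_mul_weight (hb : IsEigenbasis L b lam) (hL : IsSelfAdjoint L)
    (hg : HasSlowGrowth L) :
    Tendsto (fun n : ℕ => ((n : ℝ) + 1) * weight L lam (Sum.inl n)) atTop (𝓝 1) := by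
  have hup : ∀ n : ℕ, ((n : ℝ) + 1) * weight L lam (Sum.inl n) ≤ 1 := fun n => by
    have hn : 0 < (n : ℝ) + 1 := by positivity
    have := mul_le_mul_of_nonneg_left (hb.weight_le hL n) hn.le
    rwa [mul_inv_cancel₀ hn.ne'] at this
  refine tendsto_order.2 ⟨fun y hy => ?_, fun y hy => Eventually.of_forall fun n =>
    (hup n).trans_lt hy⟩
  obtain ⟨η, hη1, hη⟩ : ∃ η : ℝ, 1 < η ∧ y < η⁻¹ := by
    rcases le_or_gt y 0 with h0 | h0
    · exact ⟨2, by norm_num, h0.trans_lt (by norm_num)⟩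
    · refine ⟨(1 + y⁻¹) / 2, ?_, ?_⟩
      · linarith [(one_lt_inv₀ h0).2 hy]
      · rw [lt_inv_comm₀ h0 (by positivity)]
        linarith [(one_lt_inv₀ h0).2 hy]
  have h1 : Tendsto (fun n => lam (Sum.inl n) - 1) atTop atTop :=
    tendsto_atTop_add_const_right atTop (-1) hb.tendsto
  filter_upwards [h1.eventually (hg 1 η one_pos hη1)] with n hn
  rw [sub_add_cancel] at hn
  refine hη.trans_le ?_
  have h2 : counting L (lam (Sum.inl n) - 1) ≤ n := by
    by_contra hcon
    have := (hb.le_iff_lt_counting hL _ n).2 (not_le.1 hcon)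
    linarith
  have h3 : (counting L (lam (Sum.inl n) - 1) : ℝ) ≤ n := by exact_mod_cast h2
  have h4 : (0 : ℝ) < counting L (lam (Sum.inl n)) := by
    exact_mod_cast Nat.lt_of_lt_of_le n.succ_pos (hb.succ_le_counting hL n)
  have h5 : (counting L (lam (Sum.inl n)) : ℝ) ≤ η * ((n : ℝ) + 1) :=
    hn.trans (mul_le_mul_of_nonneg_left (by linarith) (by linarith))
  change η⁻¹ ≤ ((n : ℝ) + 1) * (counting L (lam (Sum.inl n)) : ℝ)⁻¹
  rw [← div_eq_mul_inv, le_div_iff₀ h4, inv_mul_le_iff₀ (by linarith)]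
  exact h5

/-! ### The weights `ρ ^ s` and the truncated weights -/

theorem tsum_sum_eq_tsum_inl {α : Type*} [AddCommMonoid α] [TopologicalSpace α] {u : ℕ ⊕ κ → α}
    (hu : ∀ k, u (Sum.inr k) = 0) : ∑' i, u i = ∑' n, u (Sum.inl n) := by
  refine (Function.Injective.tsum_eq Sum.inl_injective fun i hi => ?_).symm
  rcases i with n | k
  · exact ⟨n, rfl⟩
  · exact absurd (hu k) hi

/-- Only `counting L M` of the positive eigenvalues are at most `M`; the kernel, possibly
infinite-dimensional, contributes nothing as `u` vanishes there. -/
theorem IsEigenbasis.tsum_low_le (hb : IsEigenbasis L b lam) (hL : IsSelfAdjoint L)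
    {u : ℕ ⊕ κ → ℝ} (hu : ∀ i, u i ≤ 1) (hu0 : ∀ k, u (Sum.inr k) = 0) (M : ℝ) :
    ∑' i, ENNReal.ofReal (if lam i ≤ M then u i else 0) ≤ ENNReal.ofReal (counting L M) := by
  rw [tsum_sum_eq_tsum_inl fun k => by simp [hu0]]
  rw [tsum_eq_sum (s := Finset.range (counting L M)) fun n hn => by
    rw [if_neg, ENNReal.ofReal_zero]
    intro h1
    exact hn (Finset.mem_range.2 ((hb.le_iff_lt_counting hL M n).1 h1))]
  refine (Finset.sum_le_card_nsmul _ _ 1 fun n _ => ?_).trans ?_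
  · rw [← ENNReal.ofReal_one]
    refine ENNReal.ofReal_le_ofReal ?_
    split_ifs
    · exact hu _
    · exact zero_le_one
  · simp

theorem IsEigenbasis.abs_weight_rpow_sub_le (hb : IsEigenbasis L b lam) (hL : IsSelfAdjoint L)
    (hg : HasSlowGrowth L) {W ε : ℝ} (hW : 0 < W) (hε : 0 < ε) :
    ∃ M : ℝ, ∀ i j, |lam i - lam j| ≤ W → M < lam j → ∀ s : ℝ, 0 ≤ s → s ≤ 2 →
      |weight L lam i ^ s - weight L lam j ^ s| ≤ ε * weight L lam j ^ s := by
  have hmono : Monotone fun x => (counting L x : ℝ) := fun x y hxy =>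
    Nat.cast_le.2 (hb.counting_mono hL hxy)
  obtain ⟨M, hM⟩ := exists_forall_abs_rpow_inv_sub_le hmono (hb.tendsto_counting hL) hg hW hε
  -- Requiring `lam j > W` forces `lam i > 0`, so no kernel index takes part.
  refine ⟨max M W, fun i j hij hj s hs0 hs2 => ?_⟩
  have hjW : W < lam j := (le_max_right _ _).trans_lt hj
  have hiW : 0 < lam i := by linarith [(abs_le.1 hij).1]
  rcases i with i | i
  · rcases j with j | j
    · exact hM _ _ hij ((le_max_left _ _).trans_lt hj) s hs0 hs2
    · rw [hb.kernel] at hjW; linarith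
  · rw [hb.kernel] at hiW; exact absurd hiW (lt_irrefl _)

theorem IsEigenbasis.weight_rpow_le (hb : IsEigenbasis L b lam) (hL : IsSelfAdjoint L) {s : ℝ}
    (hs : 0 ≤ s) (n : ℕ) : weight L lam (Sum.inl n) ^ s ≤ ((n : ℝ) + 1)⁻¹ ^ s :=
  Real.rpow_le_rpow (weight_nonneg _) (hb.weight_le hL n) hs

theorem IsEigenbasis.summable_weight_rpow (hb : IsEigenbasis L b lam) (hL : IsSelfAdjoint L) {s : ℝ}
    (hs : 1 < s) : Summable fun n : ℕ => weight L lam (Sum.inl n) ^ s :=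
  (summable_inv_succ_rpow hs).of_nonneg_of_le (fun _ => Real.rpow_nonneg (weight_nonneg _) s)
    (hb.weight_rpow_le hL (by linarith))

theorem IsEigenbasis.tsum_weight_rpow (hb : IsEigenbasis L b lam) (hL : IsSelfAdjoint L) {s : ℝ}
    (hs : 1 < s) : ∑' i, ENNReal.ofReal (weight L lam i ^ s)
      = ENNReal.ofReal (∑' n : ℕ, weight L lam (Sum.inl n) ^ s) := by
  rw [ENNReal.ofReal_tsum_of_nonneg (fun _ => Real.rpow_nonneg (weight_nonneg _) s)
    (hb.summable_weight_rpow hL hs)]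
  refine tsum_sum_eq_tsum_inl fun k => ?_
  change ENNReal.ofReal ((0 : ℝ) ^ s) = 0
  rw [Real.zero_rpow (by linarith), ENNReal.ofReal_zero]

theorem IsEigenbasis.tendsto_sub_mul_tsum_weight (hb : IsEigenbasis L b lam) (hL : IsSelfAdjoint L)
    (hg : HasSlowGrowth L) :
    Tendsto (fun s : ℝ => (s - 1) * ∑' n : ℕ, weight L lam (Sum.inl n) ^ s) (𝓝[>] 1) (𝓝 1) :=
  tendsto_sub_mul_tsum_rpow (fun _ => weight_nonneg _) (hb.weight_le hL)
    (hb.tendsto_mul_weight hL hg)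

/-- Here the weights can dominate themselves, and `S = 2` comes from the residue being `1`. The
exponent `max s 1` equals `s` on the filter; it keeps the exponent nonnegative for every `s`, as
needed when the square roots are realized as operators. -/
theorem IsEigenbasis.isSlowWeightFamily_rpow (hb : IsEigenbasis L b lam) (hL : IsSelfAdjoint L)
    (hg : HasSlowGrowth L) :
    IsSlowWeightFamily (𝓝[>] (1 : ℝ)) lam (fun s => s - 1)
      fun s i => weight L lam i ^ max s 1 where
  nonneg s i := Real.rpow_nonneg (weight_nonneg i) _
  pos := by
    filter_upwards [self_mem_nhdsWithin] with s (hs : 1 < s)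
    linarith
  tendsto := by
    have : Tendsto (fun s : ℝ => s - 1) (𝓝 1) (𝓝 (1 - 1)) := Continuous.tendsto (by fun_prop) 1
    rw [sub_self] at this
    exact this.mono_left nhdsWithin_le_nhds
  near := by
    refine ⟨fun s i => weight L lam i ^ s, fun s i => Real.rpow_nonneg (weight_nonneg i) s,
      ⟨2, by norm_num, ?_⟩, ?_⟩
    · filter_upwards [self_mem_nhdsWithin,
        (hb.tendsto_sub_mul_tsum_weight hL hg).eventually_lt_const (by norm_num : (1 : ℝ) < 2)]
        with s (hs : 1 < s) h2
      have h3 : ∑' i, ENNReal.ofReal (weight L lam i ^ s) ≤ ENNReal.ofReal (2 / (s - 1)) := by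
        rw [hb.tsum_weight_rpow hL hs]
        refine ENNReal.ofReal_le_ofReal ?_
        rw [le_div_iff₀ (by linarith), mul_comm]
        exact h2.le
      rw [max_eq_left hs.le]
      exact ⟨h3, h3⟩
    · intro W ε hW hε
      obtain ⟨M, hM⟩ := hb.abs_weight_rpow_sub_le hL hg hW hε
      refine ⟨M, ?_⟩
      filter_upwards [Ioc_mem_nhdsGT (by norm_num : (1 : ℝ) < 2)] with s hs i j hij hj
      rw [max_eq_left hs.1.le]
      exact hM i j hij hj s (by linarith [hs.1]) hs.2
  low M := by
    refine ⟨counting L M, Nat.cast_nonneg _, ?_⟩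
    filter_upwards [self_mem_nhdsWithin] with s (hs : 1 < s)
    rw [max_eq_left hs.le]
    refine hb.tsum_low_le hL (fun i => Real.rpow_le_one (weight_nonneg i) (weight_le_one hb hL i)
      (by linarith)) (fun k => ?_) M
    exact Real.zero_rpow (by linarith)

/-- A sharp cut-off at index `N` would not vary slowly, whereas subtracting `1/N` and taking the
positive part is a contraction of the weights. The variation is relative to `w`, not to the
truncated weight, so a larger dominating family is needed: `w` restricted to `w > 1/(2N)`. Its sum
is at most `1 + log (2N)`, hence at most `3 log N` for large `N`. -/
theorem IsEigenbasis.isSlowWeightFamily_truncated (hb : IsEigenbasis L b lam) (hL : IsSelfAdjoint L)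
    (hg : HasSlowGrowth L) :
    IsSlowWeightFamily atTop lam (fun N : ℕ => (Real.log N)⁻¹)
      fun N i => max (weight L lam i - (N : ℝ)⁻¹) 0 where
  nonneg N i := le_max_right _ _
  pos := by
    filter_upwards [tendsto_log_natCast_atTop.eventually_gt_atTop 0] with N hN
    exact inv_pos.2 hN
  tendsto := tendsto_inv_atTop_zero.comp tendsto_log_natCast_atTop
  near := by
    refine ⟨fun N i => if (2 * N : ℝ)⁻¹ < weight L lam i then weight L lam i else 0, fun N i => ?_,
      ⟨3, by norm_num, ?_⟩, ?_⟩
    · dsimp only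
      split_ifs
      · exact weight_nonneg i
      · exact le_rfl
    · filter_upwards [tendsto_log_natCast_atTop.eventually_ge_atTop (1 + Real.log 2),
        eventually_gt_atTop 0] with N hN hN0
      have hN0' : (0 : ℝ) < N := by exact_mod_cast hN0
      have hv : ∑' i, ENNReal.ofReal
          (if (2 * N : ℝ)⁻¹ < weight L lam i then weight L lam i else 0)
          ≤ ENNReal.ofReal (3 / (Real.log N)⁻¹) := by
        rw [tsum_sum_eq_tsum_inl fun k => by simp [weight]]
        rw [tsum_eq_sum (s := Finset.range (2 * N)) fun n hn => by
          rw [if_neg, ENNReal.ofReal_zero]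
          rw [not_lt]
          refine (hb.weight_le hL n).trans (inv_anti₀ (by positivity) ?_)
          have : 2 * N ≤ n := by simpa using hn
          have : (2 * N : ℝ) ≤ n := by exact_mod_cast this
          linarith]
        rw [← ENNReal.ofReal_sum_of_nonneg fun n _ => by
          split_ifs
          · exact weight_nonneg _
          · exact le_rfl]
        refine ENNReal.ofReal_le_ofReal ?_
        calc _ ≤ ∑ n ∈ Finset.range (2 * N), ((n : ℝ) + 1)⁻¹ := by
              refine Finset.sum_le_sum fun n _ => ?_
              split_ifs
              · exact hb.weight_le hL n
              · positivity
          _ ≤ 1 + Real.log (2 * N : ℕ) := sum_inv_succ_le _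
          _ ≤ 3 / (Real.log N)⁻¹ := by
              rw [div_inv_eq_mul]
              push_cast
              rw [Real.log_mul (by norm_num) hN0'.ne']
              linarith [Real.log_nonneg (by norm_num : (1 : ℝ) ≤ 2)]
      refine ⟨le_trans (ENNReal.tsum_le_tsum fun i => ENNReal.ofReal_le_ofReal ?_) hv, hv⟩
      split_ifs with hi
      · exact max_le (by linarith [inv_pos.2 hN0']) (weight_nonneg i)
      · refine max_le ?_ le_rfl
        have : (2 * N : ℝ)⁻¹ ≤ (N : ℝ)⁻¹ := inv_anti₀ hN0' (by linarith)
        linarith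
    · intro W ε hW hε
      -- The cap at `1` matters when `w_j ≤ 1/(2N)`: then `w_i ≤ 2 w_j ≤ 1/N`, so both truncated
      -- weights vanish.
      obtain ⟨M, hM⟩ := hb.abs_weight_rpow_sub_le hL hg hW (lt_min hε one_pos)
      refine ⟨M, ?_⟩
      filter_upwards [eventually_gt_atTop 0] with N hN0 i j hij hj
      have hN0' : (0 : ℝ) < N := by exact_mod_cast hN0
      have h1 := hM i j hij hj 1 zero_le_one one_le_two
      rw [Real.rpow_one, Real.rpow_one] at h1
      have hj0 := weight_nonneg (L := L) (lam := lam) j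
      split_ifs with hv
      · calc _ ≤ |(weight L lam i - (N : ℝ)⁻¹) - (weight L lam j - (N : ℝ)⁻¹)| :=
              abs_max_sub_max_le_abs _ _ _
          _ = |weight L lam i - weight L lam j| := by rw [sub_sub_sub_cancel_right]
          _ ≤ _ := h1.trans (mul_le_mul_of_nonneg_right (min_le_left _ _) hj0)
      · have h2 : min ε 1 * weight L lam j ≤ 1 * weight L lam j :=
          mul_le_mul_of_nonneg_right (min_le_right _ _) hj0
        have h3 := (abs_le.1 h1).2
        have h4 : (2 * N : ℝ)⁻¹ = (N : ℝ)⁻¹ / 2 := by rw [mul_inv]; ring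
        rw [not_lt, h4] at hv
        rw [max_eq_right (by linarith), max_eq_right (by linarith)]
        simp
  low M := by
    refine ⟨counting L M, Nat.cast_nonneg _, Eventually.of_forall fun N => ?_⟩
    have hN0 : (0 : ℝ) ≤ (N : ℝ)⁻¹ := by positivity
    refine hb.tsum_low_le hL (fun i => max_le ?_ zero_le_one) (fun k => max_eq_right ?_) M
    · linarith [weight_le_one hb hL i]
    · change 0 - (N : ℝ)⁻¹ ≤ 0
      linarith

end

section

variable {h : Type*} [NormedAddCommGroup h] [InnerProductSpace ℂ h] [CompleteSpace h]

/-! ### Trace class operators -/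

theorem exists_sum_re_inner_le {A B : h →L[ℂ] h} (hA : hsSum (onBasis h) A ≠ ∞)
    (hB : hsSum (onBasis h) B ≠ ∞) : ∃ c : ℝ, ∀ V : h →L[ℂ] h, ‖V‖ ≤ 1 →
      ∀ F : Finset (basisSet h),
        ∑ i ∈ F, (⟪V (onBasis h i), (star A * B) (onBasis h i)⟫_ℂ).re ≤ c :=
  ⟨_, fun _ hV F => sum_re_inner_le ENNReal.toReal_nonneg ENNReal.toReal_nonneg one_pos
    (ENNReal.ofReal_toReal hA).ge (ENNReal.ofReal_toReal hB).ge hV F⟩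

theorem isTraceClass_mul_sq (c : h →L[ℂ] h) {R : h →L[ℂ] h} (hR : hsSum (onBasis h) R ≠ ∞) :
    IsTraceClass (c * (R * R)) := by
  obtain ⟨C, hC⟩ := exists_sum_re_inner_le (A := star (c * R)) (B := R)
    (by rw [hsSum_star]; exact hsSum_mul_ne_top_left _ c hR) hR
  rw [star_star, mul_assoc] at hC
  exact isTraceClass_of_sum_le (sum_abs_le_of_forall_contraction hC)

theorem isTraceClass_commutator_sq (a : h →L[ℂ] h) {R : h →L[ℂ] h} (hRsa : IsSelfAdjoint R)
    (hR : hsSum (onBasis h) R ≠ ∞) : IsTraceClass (a * (R * R) - R * R * a) := by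
  obtain ⟨C, hC⟩ := exists_sum_re_inner_le (A := star (a * R)) (B := R)
    (by rw [hsSum_star]; exact hsSum_mul_ne_top_left _ a hR) hR
  obtain ⟨D, hD⟩ := exists_sum_re_inner_le (A := R) (B := R * a) hR
    (hsSum_mul_ne_top_right _ a hR)
  rw [star_star, mul_assoc] at hC
  rw [hRsa.star_eq, ← mul_assoc] at hD
  refine isTraceClass_of_sum_le (c := C + D) (sum_abs_le_of_forall_contraction fun V hV F => ?_)
  have h1 : ∀ i, (⟪V (onBasis h i), (a * (R * R) - R * R * a) (onBasis h i)⟫_ℂ).re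
      = (⟪V (onBasis h i), (a * (R * R)) (onBasis h i)⟫_ℂ).re
        + (⟪(-V) (onBasis h i), (R * R * a) (onBasis h i)⟫_ℂ).re := fun i => by
    rw [sub_apply, inner_sub_right, neg_apply, inner_neg_left, Complex.sub_re, Complex.neg_re,
      sub_eq_add_neg]
  simp only [h1, Finset.sum_add_distrib]
  exact add_le_add (hC V hV F) (hD (-V) (by rwa [norm_neg]) F)

theorem sq_apply_of_sqrt {ι : Type*} (b : HilbertBasis ι ℂ h) {R : h →L[ℂ] h} {w : ι → ℝ}
    (hw : ∀ n, 0 ≤ w n) (hR : ∀ n, R (b n) = ((√(w n) : ℝ) : ℂ) • b n) (n : ι) :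
    (R * R) (b n) = (w n : ℂ) • b n := by
  rw [mul_apply_eq_comp, hR, map_smul, hR, smul_smul, ← Complex.ofReal_mul, Real.mul_self_sqrt (hw n)]

/-! ### Powers of the spectral weight -/

variable {L : h →ₗ.[ℂ] h} {κ : Type*} {b : HilbertBasis (ℕ ⊕ κ) ℂ h} {lam : ℕ ⊕ κ → ℝ}

theorem IsEigenbasis.spectralWeight_nonneg (hb : IsEigenbasis L b lam) (hL : IsSelfAdjoint L) :
    0 ≤ spectralWeight L :=
  isPositive_diag b (hb.spectralWeight_apply hL) weight_nonneg

theorem IsEigenbasis.rpow_apply (hb : IsEigenbasis L b lam) (hL : IsSelfAdjoint L) {s : ℝ}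
    (hs : 0 ≤ s) (i : ℕ ⊕ κ) :
    (spectralWeight L ^ s) (b i) = ((weight L lam i ^ s : ℝ) : ℂ) • b i :=
  rpow_apply_eigenvector (hb.spectralWeight_nonneg hL) (hb.spectralWeight_apply hL i) hs

theorem IsEigenbasis.rpow_half_apply (hb : IsEigenbasis L b lam) (hL : IsSelfAdjoint L) {s : ℝ}
    (hs : 0 ≤ s) (i : ℕ ⊕ κ) :
    (spectralWeight L ^ (s / 2)) (b i) = ((√(weight L lam i ^ s) : ℝ) : ℂ) • b i := by
  rw [hb.rpow_apply hL (by positivity), Real.sqrt_eq_rpow, ← Real.rpow_mul (weight_nonneg i),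
    mul_one_div]

theorem IsEigenbasis.rpow_half_mul_self (hb : IsEigenbasis L b lam) (hL : IsSelfAdjoint L) {s : ℝ}
    (hs : 0 ≤ s) :
    spectralWeight L ^ (s / 2) * spectralWeight L ^ (s / 2) = spectralWeight L ^ s :=
  hilbertBasis_ext b fun i => by
    rw [hb.rpow_apply hL hs, sq_apply_of_sqrt b (fun i => Real.rpow_nonneg (weight_nonneg i) s)
      (hb.rpow_half_apply hL hs)]

theorem IsEigenbasis.isSelfAdjoint_rpow_half (hb : IsEigenbasis L b lam) (hL : IsSelfAdjoint L)
    {s : ℝ} (hs : 0 ≤ s) : IsSelfAdjoint (spectralWeight L ^ (s / 2)) :=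
  IsSelfAdjoint.of_nonneg (isPositive_diag b (hb.rpow_half_apply hL hs) fun _ => Real.sqrt_nonneg _)

theorem IsEigenbasis.hsSum_rpow_half (hb : IsEigenbasis L b lam) (hL : IsSelfAdjoint L) {s : ℝ}
    (hs : 1 < s) : hsSum b (spectralWeight L ^ (s / 2)) ≠ ∞ := by
  rw [hsSum_diag_sqrt b (fun i => Real.rpow_nonneg (weight_nonneg i) s)
    (hb.rpow_half_apply hL (by linarith)), hb.tsum_weight_rpow hL hs]
  exact ENNReal.ofReal_ne_top

theorem IsEigenbasis.isTraceClass_mul_rpow (hb : IsEigenbasis L b lam) (hL : IsSelfAdjoint L)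
    (c : h →L[ℂ] h) {s : ℝ} (hs : 1 < s) : IsTraceClass (c * spectralWeight L ^ s) := by
  rw [← hb.rpow_half_mul_self hL (by linarith)]
  refine isTraceClass_mul_sq c ?_
  rw [hsSum_basis_indep (onBasis h) b]
  exact hb.hsSum_rpow_half hL hs

theorem IsEigenbasis.isTraceClass_commutator (hb : IsEigenbasis L b lam) (hL : IsSelfAdjoint L)
    (a : h →L[ℂ] h) {s : ℝ} (hs : 1 < s) :
    IsTraceClass (a * spectralWeight L ^ s - spectralWeight L ^ s * a) := by
  rw [← hb.rpow_half_mul_self hL (by linarith)]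
  refine isTraceClass_commutator_sq a (hb.isSelfAdjoint_rpow_half hL (by linarith)) ?_
  rw [hsSum_basis_indep (onBasis h) b]
  exact hb.hsSum_rpow_half hL hs

/-- Writing `ρ^s` as the square of a Hilbert–Schmidt operator allows the trace, defined in a fixed
basis, to be computed in the eigenbasis. -/
theorem IsEigenbasis.hasSum_trace (hb : IsEigenbasis L b lam) (hL : IsSelfAdjoint L)
    (c : h →L[ℂ] h) {s : ℝ} (hs : 1 < s) :
    HasSum (fun n : ℕ => ((weight L lam (Sum.inl n) ^ s : ℝ) : ℂ)
      * ⟪b (Sum.inl n), c (b (Sum.inl n))⟫_ℂ) (trace (c * spectralWeight L ^ s)) := by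
  have h1 := hasSum_inner_mul_sq b (onBasis h) c (hb.hsSum_rpow_half hL hs)
  rw [hb.rpow_half_mul_self hL (by linarith)] at h1
  have h2 : ∀ i, ⟪b i, (c * spectralWeight L ^ s) (b i)⟫_ℂ
      = ((weight L lam i ^ s : ℝ) : ℂ) * ⟪b i, c (b i)⟫_ℂ := fun i => by
    rw [mul_apply_eq_comp, hb.rpow_apply hL (by linarith), map_smul, inner_smul_right]
  simp only [h2] at h1
  refine (Function.Injective.hasSum_iff Sum.inl_injective fun i hi => ?_).2 h1
  rcases i with n | k
  · exact absurd ⟨n, rfl⟩ hi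
  · have : weight L lam (Sum.inr k) ^ s = 0 := Real.zero_rpow (by linarith)
    rw [this, Complex.ofReal_zero, zero_mul]

theorem IsEigenbasis.trace_rpow (hb : IsEigenbasis L b lam) (hL : IsSelfAdjoint L) {s : ℝ}
    (hs : 1 < s) :
    trace (spectralWeight L ^ s) = ((∑' n : ℕ, weight L lam (Sum.inl n) ^ s : ℝ) : ℂ) := by
  have h1 := hb.hasSum_trace hL 1 hs
  rw [one_mul] at h1
  rw [Complex.ofReal_tsum, ← h1.tsum_eq]
  refine tsum_congr fun n => ?_
  rw [one_apply_eq_self, inner_self_eq_norm_sq_to_K, b.orthonormal.1]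
  simp

theorem norm_inner_basis_le {ι : Type*} (b : HilbertBasis ι ℂ h) (c : h →L[ℂ] h) (i : ι) :
    ‖⟪b i, c (b i)⟫_ℂ‖ ≤ ‖c‖ := by
  refine (norm_inner_le_norm _ _).trans ?_
  have := c.le_opNorm (b i)
  rw [b.orthonormal.1 i, mul_one] at this
  rwa [b.orthonormal.1 i, one_mul]

theorem IsEigenbasis.norm_trace_mul_rpow_le (hb : IsEigenbasis L b lam) (hL : IsSelfAdjoint L)
    (c : h →L[ℂ] h) {s : ℝ} (hs : 1 < s) :
    ‖trace (c * spectralWeight L ^ s)‖ ≤ (∑' n : ℕ, weight L lam (Sum.inl n) ^ s) * ‖c‖ := by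
  rw [← (hb.hasSum_trace hL c hs).tsum_eq]
  refine tsum_of_norm_bounded ((hb.summable_weight_rpow hL hs).hasSum.mul_right ‖c‖) fun n => ?_
  rw [norm_mul, Complex.norm_real, Real.norm_of_nonneg (Real.rpow_nonneg (weight_nonneg _) s)]
  exact mul_le_mul_of_nonneg_left (norm_inner_basis_le b c _) (Real.rpow_nonneg (weight_nonneg _) s)

theorem norm_ofReal_mul_le {k η : ℝ} (hk : 0 < k) {z : ℂ} (hz : ‖z‖ ≤ η / k) :
    ‖(k : ℂ) * z‖ ≤ η := by
  rw [norm_mul, Complex.norm_real, Real.norm_of_nonneg hk.le, mul_comm]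
  rwa [le_div_iff₀ hk] at hz

theorem tendsto_zero_of_forall_eventually_le {α : Type*} {l : Filter α} {f : α → ℂ}
    (hf : ∀ η : ℝ, 0 < η → ∀ᶠ i in l, ‖f i‖ ≤ η) : Tendsto f l (𝓝 0) := by
  rw [Metric.tendsto_nhds]
  intro ε hε
  filter_upwards [hf (ε / 2) (by positivity)] with i hi
  rw [dist_zero_right]
  linarith

theorem IsEigenbasis.tendsto_trace_rpow (hb : IsEigenbasis L b lam) (hL : IsSelfAdjoint L)
    (hg : HasSlowGrowth L) :
    Tendsto (fun s : ℝ => ((s - 1 : ℝ) : ℂ) * trace (spectralWeight L ^ s)) (𝓝[>] 1) (𝓝 1) := by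
  have h1 := (Complex.continuous_ofReal.tendsto 1).comp (hb.tendsto_sub_mul_tsum_weight hL hg)
  rw [Complex.ofReal_one] at h1
  refine h1.congr' ?_
  filter_upwards [self_mem_nhdsWithin] with s (hs : 1 < s)
  rw [hb.trace_rpow hL hs, Function.comp_apply, Complex.ofReal_mul]

theorem IsEigenbasis.rpow_half_max_apply (hb : IsEigenbasis L b lam) (hL : IsSelfAdjoint L) (s : ℝ)
    (i : ℕ ⊕ κ) : (spectralWeight L ^ (max s 1 / 2)) (b i)
      = ((√(weight L lam i ^ max s 1) : ℝ) : ℂ) • b i :=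
  hb.rpow_half_apply hL (zero_le_one.trans (le_max_right s 1)) i

theorem IsEigenbasis.tendsto_trace_abs_commutator (hb : IsEigenbasis L b lam)
    (hL : IsSelfAdjoint L) (hg : HasSlowGrowth L) {a : h →L[ℂ] h} (ha : a ∈ lipschitzAlgebra L hL) :
    Tendsto (fun s : ℝ => ((s - 1 : ℝ) : ℂ) *
      trace (CFC.abs (a * spectralWeight L ^ s - spectralWeight L ^ s * a))) (𝓝[>] 1) (𝓝 0) := by
  obtain ⟨D, hD, hcol, hrow⟩ := hb.exists_entry_bound hL ha
  refine tendsto_zero_of_forall_eventually_le fun η hη => ?_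
  filter_upwards [self_mem_nhdsWithin, (hb.isSlowWeightFamily_rpow hL hg).eventually_sum_abs_le b
    (hb.rpow_half_max_apply hL) hD hcol hrow hη] with s (hs : 1 < s) h1
  rw [max_eq_left hs.le, hb.rpow_half_mul_self hL (by linarith)] at h1
  exact norm_ofReal_mul_le (by linarith) (norm_trace_abs_le h1)

theorem IsEigenbasis.tendsto_trace_commutator_mul (hb : IsEigenbasis L b lam)
    (hL : IsSelfAdjoint L) (hg : HasSlowGrowth L) {a : h →L[ℂ] h} (ha : a ∈ lipschitzAlgebra L hL)
    (c : h →L[ℂ] h) :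
    Tendsto (fun s : ℝ => ((s - 1 : ℝ) : ℂ) * trace ((a * c - c * a) * spectralWeight L ^ s))
      (𝓝[>] 1) (𝓝 0) := by
  obtain ⟨D, hD, hcol, hrow⟩ := hb.exists_entry_bound hL ha
  refine tendsto_zero_of_forall_eventually_le fun η hη => ?_
  filter_upwards [self_mem_nhdsWithin, (hb.isSlowWeightFamily_rpow hL hg).eventually_norm_tsum_le b
    (hb.rpow_half_max_apply hL) hD hcol hrow c hη] with s (hs : 1 < s) h1
  rw [max_eq_left hs.le, hb.rpow_half_mul_self hL (by linarith)] at h1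
  have h2 := hasSum_inner_mul_sq b (onBasis h) (a * c - c * a) (hb.hsSum_rpow_half hL hs)
  rw [hb.rpow_half_mul_self hL (by linarith)] at h2
  rw [h2.tsum_eq] at h1
  exact norm_ofReal_mul_le (by linarith) h1

/-- The forms `ω_s` vanish asymptotically on compact operators. -/
theorem IsEigenbasis.tendsto_trace_compact_mul (hb : IsEigenbasis L b lam)
    (hL : IsSelfAdjoint L) {T : h →L[ℂ] h} (hT : IsCompactOperator T) :
    Tendsto (fun s : ℝ => ((s - 1 : ℝ) : ℂ) * trace (T * spectralWeight L ^ s))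
      (𝓝[>] 1) (𝓝 0) := by
  have hf : Orthonormal ℂ fun n : ℕ => b (Sum.inl n) := b.orthonormal.comp _ Sum.inl_injective
  have h1 : Tendsto (fun n : ℕ => ‖T (b (Sum.inl n))‖) atTop (𝓝 0) := by
    simpa using (tendsto_apply_orthonormal hT hf).norm
  have hT1 : ∀ n : ℕ, ‖T (b (Sum.inl n))‖ ≤ ‖T‖ := fun n => by
    have := T.le_opNorm (b (Sum.inl n))
    rwa [b.orthonormal.1, mul_one] at this
  -- The diagonal values of `T` are dominated by `‖T b_n‖`, a null sequence by compactness, so the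
  -- Abelian theorem applies.
  have h2 := tendsto_sub_mul_tsum_mul_zero (fun n => norm_nonneg _) hT1 h1
  refine squeeze_zero_norm' ?_ h2
  filter_upwards [self_mem_nhdsWithin] with s (hs : 1 < s)
  rw [norm_mul, Complex.norm_real, Real.norm_of_nonneg (by linarith),
    ← (hb.hasSum_trace hL T hs).tsum_eq]
  refine mul_le_mul_of_nonneg_left (tsum_of_norm_bounded (summable_inv_succ_rpow_mul
    (fun n => by rw [abs_of_nonneg (norm_nonneg _)]; exact hT1 n) hs).hasSum fun n => ?_)
    (by linarith)
  rw [norm_mul, Complex.norm_real, Real.norm_of_nonneg (Real.rpow_nonneg (weight_nonneg _) s)]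
  refine mul_le_mul (hb.weight_rpow_le hL (by linarith) n) ?_ (norm_nonneg _)
    (inv_succ_rpow_nonneg s n)
  refine (norm_inner_le_norm _ _).trans ?_
  rw [b.orthonormal.1, one_mul]

/-! ### Logarithmic means of commutators -/

theorem IsEigenbasis.exists_sqrt_truncated (hb : IsEigenbasis L b lam) (hL : IsSelfAdjoint L) :
    ∃ R : ℕ → h →L[ℂ] h, ∀ N i,
      R N (b i) = ((√(max (weight L lam i - (N : ℝ)⁻¹) 0) : ℝ) : ℂ) • b i :=
  ⟨fun N => cfc (fun x : ℝ => √(max (x - (N : ℝ)⁻¹) 0)) (spectralWeight L), fun N i =>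
    cfc_apply_eigenvector (IsSelfAdjoint.of_nonneg (hb.spectralWeight_nonneg hL))
      (hb.spectralWeight_apply hL i) (Continuous.continuousOn (by fun_prop))⟩

/-- For the truncated weights the commutator estimate gives `o(log N)`. They vanish for `n ≥ N` and
differ from `w_n` by at most `1/N` for `n < N`, so replacing `w` by them changes the sum by at most
`‖[a, c]‖`, negligible against `log N`. -/
theorem IsEigenbasis.tendsto_log_mean_commutator (hb : IsEigenbasis L b lam)
    (hL : IsSelfAdjoint L) (hg : HasSlowGrowth L) {a : h →L[ℂ] h} (ha : a ∈ lipschitzAlgebra L hL)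
    (c : h →L[ℂ] h) :
    Tendsto (fun N : ℕ => (((Real.log N)⁻¹ : ℝ) : ℂ) * ∑ n ∈ Finset.range N,
      (weight L lam (Sum.inl n) : ℂ) * ⟪b (Sum.inl n), (a * c - c * a) (b (Sum.inl n))⟫_ℂ)
      atTop (𝓝 0) := by
  obtain ⟨D, hD, hcol, hrow⟩ := hb.exists_entry_bound hL ha
  obtain ⟨R, hR⟩ := hb.exists_sqrt_truncated hL
  set Z := a * c - c * a with hZ
  refine tendsto_zero_of_forall_eventually_le fun η hη => ?_
  have hlog : Tendsto (fun N : ℕ => (Real.log N)⁻¹ * ‖Z‖) atTop (𝓝 0) := by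
    simpa using (tendsto_inv_atTop_zero.comp tendsto_log_natCast_atTop).mul_const ‖Z‖
  filter_upwards [(hb.isSlowWeightFamily_truncated hL hg).eventually_norm_tsum_le b hR hD hcol hrow
    c (by positivity : 0 < η / 2), tendsto_log_natCast_atTop.eventually_gt_atTop 0,
    hlog.eventually_le_const (by positivity : 0 < η / 2), eventually_gt_atTop 0]
    with N h1 hN hN2 hN0
  have hN0' : (0 : ℝ) < N := by exact_mod_cast hN0
  have h2 : ∀ i, ⟪b i, (Z * (R N * R N)) (b i)⟫_ℂ
      = ((max (weight L lam i - (N : ℝ)⁻¹) 0 : ℝ) : ℂ) * ⟪b i, Z (b i)⟫_ℂ := fun i => by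
    rw [mul_apply_eq_comp, sq_apply_of_sqrt b (fun i => le_max_right _ _) (hR N), map_smul,
      inner_smul_right]
  have h0 : ∀ k, max (weight L lam (Sum.inr k) - (N : ℝ)⁻¹) 0 = 0 := fun k => by
    refine max_eq_right ?_
    change 0 - (N : ℝ)⁻¹ ≤ 0
    linarith [inv_pos.2 hN0']
  rw [← hZ, tsum_congr h2, tsum_sum_eq_tsum_inl fun k => by rw [h0, Complex.ofReal_zero, zero_mul],
    tsum_eq_sum (s := Finset.range N) fun n hn => by
      rw [max_eq_right, Complex.ofReal_zero, zero_mul]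
      rw [sub_nonpos]
      refine (hb.weight_le hL n).trans (inv_anti₀ hN0' ?_)
      have : N ≤ n := by simpa using hn
      have : (N : ℝ) ≤ n := by exact_mod_cast this
      linarith] at h1
  have h3 : ‖∑ n ∈ Finset.range N, ((weight L lam (Sum.inl n)
      - max (weight L lam (Sum.inl n) - (N : ℝ)⁻¹) 0 : ℝ) : ℂ)
        * ⟪b (Sum.inl n), Z (b (Sum.inl n))⟫_ℂ‖ ≤ ‖Z‖ := by
    refine (norm_sum_le _ _).trans ((Finset.sum_le_sum (g := fun _ => (N : ℝ)⁻¹ * ‖Z‖)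
      fun n _ => ?_).trans ?_)
    · rw [norm_mul, Complex.norm_real, Real.norm_eq_abs]
      refine mul_le_mul ?_ (norm_inner_basis_le b Z _) (norm_nonneg _) (inv_pos.2 hN0').le
      have := weight_nonneg (L := L) (lam := lam) (Sum.inl n)
      rcases max_cases (weight L lam (Sum.inl n) - (N : ℝ)⁻¹) 0 with ⟨h, h'⟩ | ⟨h, h'⟩ <;>
        rw [h, abs_le] <;> constructor <;> linarith [inv_pos.2 hN0']
    · rw [Finset.sum_const, Finset.card_range, nsmul_eq_mul, mul_inv_cancel_left₀ hN0'.ne']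
  have h4 : ∑ n ∈ Finset.range N, (weight L lam (Sum.inl n) : ℂ)
        * ⟪b (Sum.inl n), Z (b (Sum.inl n))⟫_ℂ
      = ∑ n ∈ Finset.range N, ((weight L lam (Sum.inl n)
        - max (weight L lam (Sum.inl n) - (N : ℝ)⁻¹) 0 : ℝ) : ℂ)
        * ⟪b (Sum.inl n), Z (b (Sum.inl n))⟫_ℂ
        + ∑ n ∈ Finset.range N, ((max (weight L lam (Sum.inl n) - (N : ℝ)⁻¹) 0 : ℝ) : ℂ)
        * ⟪b (Sum.inl n), Z (b (Sum.inl n))⟫_ℂ := by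
    rw [← Finset.sum_add_distrib]
    refine Finset.sum_congr rfl fun n _ => ?_
    rw [Complex.ofReal_sub]
    ring
  rw [h4, mul_add]
  have h5 := norm_ofReal_mul_le (inv_pos.2 hN) h1
  have h6 : ‖(((Real.log N)⁻¹ : ℝ) : ℂ) * ∑ n ∈ Finset.range N, ((weight L lam (Sum.inl n)
        - max (weight L lam (Sum.inl n) - (N : ℝ)⁻¹) 0 : ℝ) : ℂ)
        * ⟪b (Sum.inl n), Z (b (Sum.inl n))⟫_ℂ‖ ≤ η / 2 := by
    rw [norm_mul, Complex.norm_real, Real.norm_of_nonneg (inv_pos.2 hN).le]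
    exact (mul_le_mul_of_nonneg_left h3 (inv_pos.2 hN).le).trans hN2
  exact (norm_add_le _ _).trans (by linarith)

/-! ### The spectral weight belongs to the Macaev ideal -/

theorem IsEigenbasis.norm_spectralWeight_apply_le (hb : IsEigenbasis L b lam) (hL : IsSelfAdjoint L)
    (N : ℕ) (v : h) (hv : ∀ n < N, ⟪b (Sum.inl n), v⟫_ℂ = 0) :
    ‖spectralWeight L v‖ ≤ weight L lam (Sum.inl N) * ‖v‖ := by
  refine le_of_sq_le_sq ?_ (mul_nonneg (weight_nonneg _) (norm_nonneg v))
  rw [mul_pow]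
  refine hasSum_le (fun i => ?_) (hasSum_norm_inner_sq b (spectralWeight L v))
    ((hasSum_norm_inner_sq b v).mul_left (weight L lam (Sum.inl N) ^ 2))
  rw [inner_diag_apply b (hb.spectralWeight_apply hL), norm_mul, mul_pow, Complex.norm_real,
    Real.norm_of_nonneg (weight_nonneg _)]
  rcases i with n | k
  · rcases lt_or_ge n N with hn | hn
    · rw [hv n hn]; simp
    · gcongr
      · exact weight_nonneg _
      · exact hb.weight_antitone hL hn
  · simp only [weight, Sum.elim_inr]
    rw [zero_pow two_ne_zero, zero_mul]
    positivity

theorem IsEigenbasis.singularNumber_spectralWeight (hb : IsEigenbasis L b lam)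
    (hL : IsSelfAdjoint L) (n : ℕ) :
    singularNumber n (spectralWeight L) = weight L lam (Sum.inl n) :=
  singularNumber_eq_eigenvalue (b.orthonormal.comp _ Sum.inl_injective)
    (fun n => hb.spectralWeight_apply hL (Sum.inl n))
    (fun N v hv => hb.norm_spectralWeight_apply_le hL N v hv) n

/-- `ρ(L)` is the norm limit of its finite-rank restrictions to the first `N` eigenvectors, with
error at most `1 / (N + 1)`. -/
theorem IsEigenbasis.isCompactOperator_spectralWeight (hb : IsEigenbasis L b lam)
    (hL : IsSelfAdjoint L) : IsCompactOperator (spectralWeight L) := by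
  set U : ℕ → Submodule ℂ h := fun N => Submodule.span ℂ (range fun n : Fin N => b (Sum.inl (n : ℕ)))
  have hfin : ∀ N, FiniteDimensional ℂ (U N) := fun N =>
    FiniteDimensional.span_of_finite ℂ (finite_range _)
  refine isCompactOperator_of_tendsto (l := atTop)
    (F := fun N => spectralWeight L * (U N).starProjection) (f := spectralWeight L) ?_
    (Eventually.of_forall fun N => ?_)
  · rw [tendsto_iff_norm_sub_tendsto_zero]
    refine squeeze_zero (fun _ => norm_nonneg _) (fun N => ?_)
      (tendsto_one_div_add_atTop_nhds_zero_nat (𝕜 := ℝ))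
    refine ContinuousLinearMap.opNorm_le_bound _ (by positivity) fun v => ?_
    have h1 : (spectralWeight L * (U N).starProjection - spectralWeight L) v
        = -spectralWeight L (v - (U N).starProjection v) := by
      rw [sub_apply, mul_apply_eq_comp, map_sub, neg_sub]
    rw [h1, norm_neg]
    refine (hb.norm_spectralWeight_apply_le hL N _ fun n hn => ?_).trans ?_
    · exact (U N).sub_starProjection_mem_orthogonal v _ (Submodule.subset_span ⟨⟨n, hn⟩, rfl⟩)
    · rw [one_div]
      refine mul_le_mul (hb.weight_le hL N) ?_ (norm_nonneg _) (by positivity)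
      have h2 : v - (U N).starProjection v = (U N)ᗮ.starProjection v := by
        rw [Submodule.starProjection_orthogonal_val]
      rw [h2]
      exact (U N)ᗮ.norm_starProjection_apply_le v
  · have : ProperSpace (U N) := FiniteDimensional.proper ℂ (U N)
    have h1 : IsCompactOperator (U N).orthogonalProjectionOnto :=
      isCompactOperator_of_locallyCompactSpace_dom (U N).orthogonalProjectionOnto
    have h2 : IsCompactOperator (U N).starProjection := h1.clm_comp (U N).subtypeL
    exact h2.clm_comp (spectralWeight L)

/-- The ideal property of singular numbers gives `μ_n(Tρ) ≤ ‖T‖ w_n ≤ ‖T‖ / (n + 1)`, whose partial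
sums grow at most logarithmically. -/
theorem IsEigenbasis.inMacaev (hb : IsEigenbasis L b lam) (hL : IsSelfAdjoint L)
    (T : h →L[ℂ] h) : InMacaev (T * spectralWeight L) := by
  refine ⟨(hb.isCompactOperator_spectralWeight hL).clm_comp T, 3 * ‖T‖, fun N _ => ?_⟩
  have h1 := abs_logMeanSeq_le (d := fun n => singularNumber n (T * spectralWeight L))
    (norm_nonneg T) (fun n => ?_) N
  · exact (le_abs_self _).trans h1
  · rw [abs_of_nonneg (singularNumber_nonneg _ _), div_eq_mul_inv]
    refine (singularNumber_mul_le _ _ n).trans (mul_le_mul_of_nonneg_left ?_ (norm_nonneg T))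
    rw [hb.singularNumber_spectralWeight hL]
    exact hb.weight_le hL n

end

section

variable {h : Type*} [NormedAddCommGroup h] [InnerProductSpace ℂ h] [CompleteSpace h]

/-! ### States and hypertraces -/

/-- For fixed `c` the relation is a norm-closed condition on `a`, as `τ` is norm continuous. -/
theorem IsHypertraceOn.topologicalClosure {A : StarSubalgebra ℂ (h →L[ℂ] h)}
    {τ : WeakDual ℂ (h →L[ℂ] h)} (hA : IsHypertraceOn A τ) :
    IsHypertraceOn A.topologicalClosure τ := by
  intro a ha c
  have hτ : Continuous τ := (WeakDual.toStrongDual τ).continuous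
  have hcl : IsClosed {a : h →L[ℂ] h | τ (c * a) = τ (a * c)} :=
    isClosed_eq (hτ.comp (continuous_const.mul continuous_id))
      (hτ.comp (continuous_id.mul continuous_const))
  exact closure_minimal (fun a ha => hA a ha c) hcl ha

theorem IsHypertraceOn.isTracialStateOn {A : StarSubalgebra ℂ (h →L[ℂ] h)}
    {τ : WeakDual ℂ (h →L[ℂ] h)} (hA : IsHypertraceOn A τ) (hτ : IsState τ) :
    IsTracialStateOn A τ :=
  ⟨hτ.1, fun a _ => hτ.2 _ ((ContinuousLinearMap.nonneg_iff_isPositive _).1 (star_mul_self_nonneg a)),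
    fun a _ b hb => hA b hb a⟩

theorem isHypertraceOn_of_commutator {A : StarSubalgebra ℂ (h →L[ℂ] h)}
    {τ : WeakDual ℂ (h →L[ℂ] h)} (hA : ∀ a ∈ A, ∀ c, τ (a * c - c * a) = 0) :
    IsHypertraceOn A τ := fun a ha c => by
  have h1 := hA a ha c
  rw [map_sub, sub_eq_zero] at h1
  exact h1.symm

theorem isPositive_inner {T : h →L[ℂ] h} (hT : T.IsPositive) (x : h) :
    0 ≤ (⟪x, T x⟫_ℂ).re ∧ (⟪x, T x⟫_ℂ).im = 0 := by
  refine ⟨hT.re_inner_nonneg_right x, ?_⟩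
  have h1 : (starRingEnd ℂ) ⟪x, T x⟫_ℂ = ⟪x, T x⟫_ℂ := by
    rw [inner_conj_symm]
    exact hT.inner_left_eq_inner_right x x
  exact Complex.conj_eq_iff_im.1 h1

variable {L : h →ₗ.[ℂ] h} {κ : Type*} {b : HilbertBasis (ℕ ⊕ κ) ℂ h} {lam : ℕ ⊕ κ → ℝ}

/-! ### The forms `ω_s` and their limit points -/

theorem IsEigenbasis.exists_zetaForm (hb : IsEigenbasis L b lam) (hL : IsSelfAdjoint L) {s : ℝ}
    (hs : 1 < s) : ∃ Ω : StrongDual ℂ (h →L[ℂ] h),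
      (∀ c, Ω c = ((s - 1 : ℝ) : ℂ) * trace (c * spectralWeight L ^ s)) ∧
      ‖Ω‖ ≤ (s - 1) * ∑' n : ℕ, weight L lam (Sum.inl n) ^ s := by
  have hs1 : 0 ≤ s - 1 := by linarith
  let f : (h →L[ℂ] h) →ₗ[ℂ] ℂ :=
    { toFun := fun c => ((s - 1 : ℝ) : ℂ) * trace (c * spectralWeight L ^ s)
      map_add' := fun c d => by
        have h1 := (hb.hasSum_trace hL c hs).add (hb.hasSum_trace hL d hs)
        simp only [← mul_add, ← inner_add_right, ← add_apply] at h1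
        rw [(hb.hasSum_trace hL (c + d) hs).unique h1, mul_add]
      map_smul' := fun r c => by
        have h1 := (hb.hasSum_trace hL c hs).mul_left r
        have h2 := hb.hasSum_trace hL (r • c) hs
        have e : ∀ n : ℕ, ((weight L lam (Sum.inl n) ^ s : ℝ) : ℂ)
            * ⟪b (Sum.inl n), (r • c) (b (Sum.inl n))⟫_ℂ
            = r * (((weight L lam (Sum.inl n) ^ s : ℝ) : ℂ)
              * ⟪b (Sum.inl n), c (b (Sum.inl n))⟫_ℂ) := fun n => by
          rw [smul_apply, inner_smul_right, mul_left_comm]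
        simp only [e] at h2
        rw [h2.unique h1, RingHom.id_apply, smul_eq_mul]
        ring }
  have hf : ∀ c, ‖f c‖ ≤ ((s - 1) * ∑' n : ℕ, weight L lam (Sum.inl n) ^ s) * ‖c‖ := fun c => by
    change ‖((s - 1 : ℝ) : ℂ) * trace (c * spectralWeight L ^ s)‖ ≤ _
    rw [norm_mul, Complex.norm_real, Real.norm_of_nonneg hs1, mul_assoc]
    exact mul_le_mul_of_nonneg_left (hb.norm_trace_mul_rpow_le hL c hs) hs1
  exact ⟨f.mkContinuous _ hf, fun c => rfl, f.mkContinuous_norm_le (mul_nonneg hs1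
    (tsum_nonneg fun n => Real.rpow_nonneg (weight_nonneg _) s)) hf⟩

theorem IsEigenbasis.zetaForm_nonneg (hb : IsEigenbasis L b lam) (hL : IsSelfAdjoint L) {s : ℝ}
    (hs : 1 < s) {T : h →L[ℂ] h} (hT : T.IsPositive) :
    0 ≤ (((s - 1 : ℝ) : ℂ) * trace (T * spectralWeight L ^ s)).re ∧
      (((s - 1 : ℝ) : ℂ) * trace (T * spectralWeight L ^ s)).im = 0 := by
  have h1 := hb.hasSum_trace hL T hs
  have hre := Complex.hasSum_re h1
  have him := Complex.hasSum_im h1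
  simp only [Complex.re_ofReal_mul] at hre
  simp only [Complex.im_ofReal_mul, (isPositive_inner hT _).2, mul_zero] at him
  rw [Complex.re_ofReal_mul, Complex.im_ofReal_mul, him.unique hasSum_zero, mul_zero]
  refine ⟨mul_nonneg (by linarith) (hre.nonneg fun n => ?_), rfl⟩
  exact mul_nonneg (Real.rpow_nonneg (weight_nonneg _) s) (isPositive_inner hT _).1

/-- Evaluation at `c` is weak-* continuous, so `τ c` is a cluster point of a convergent family of
numbers. Every limit relation for `ω_s` thereby passes to every limit point. -/
theorem eq_of_mapClusterPt_of_tendsto {α : Type*} {l : Filter α} {Ω : α → WeakDual ℂ (h →L[ℂ] h)}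
    {τ : WeakDual ℂ (h →L[ℂ] h)} (hτ : MapClusterPt τ l Ω) {c : h →L[ℂ] h} {z : ℂ}
    (hz : Tendsto (fun i => Ω i c) l (𝓝 z)) : τ c = z := by
  have h1 := hτ.continuousAt_comp (WeakDual.eval_continuous c).continuousAt
  exact @eq_of_nhds_neBot _ _ _ _ _ (ClusterPt.mono h1 hz)

/-- Near `s = 1` the norms of `ω_s` are at most `2`, the residue being `1`, so Banach–Alaoglu
provides a limit point. Normalization, vanishing on compacts and on commutators are limits of
numbers; positivity is a closed condition on values. -/
theorem IsEigenbasis.exists_zetaForms (hb : IsEigenbasis L b lam) (hL : IsSelfAdjoint L)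
    (hg : HasSlowGrowth L) :
    ∃ Ω : ℝ → WeakDual ℂ (h →L[ℂ] h),
      (∀ s : ℝ, 1 < s → ∀ c : h →L[ℂ] h,
        Ω s c = ((s - 1 : ℝ) : ℂ) * trace (c * spectralWeight L ^ s)) ∧
      (∃ τ : WeakDual ℂ (h →L[ℂ] h), MapClusterPt τ (𝓝[>] 1) Ω) ∧
      ∀ τ : WeakDual ℂ (h →L[ℂ] h), MapClusterPt τ (𝓝[>] 1) Ω →
        IsState τ ∧ (∀ T : h →L[ℂ] h, IsCompactOperator T → τ T = 0) ∧
        IsHypertraceOn (lipschitzAlgebra L hL) τ := by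
  -- The value `0` for `s ≤ 1` is a filler, invisible to the filter `𝓝[>] 1`.
  have h0 : ∀ s : ℝ, ∃ Ω : StrongDual ℂ (h →L[ℂ] h), 1 < s →
      (∀ c, Ω c = ((s - 1 : ℝ) : ℂ) * trace (c * spectralWeight L ^ s)) ∧
      ‖Ω‖ ≤ (s - 1) * ∑' n : ℕ, weight L lam (Sum.inl n) ^ s := fun s => by
    by_cases hs : 1 < s
    · obtain ⟨Ω, hΩ⟩ := hb.exists_zetaForm hL hs
      exact ⟨Ω, fun _ => hΩ⟩
    · exact ⟨0, fun h => absurd h hs⟩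
  choose Ω hΩ using h0
  have hval : ∀ s : ℝ, 1 < s → ∀ c : h →L[ℂ] h, StrongDual.toWeakDual (Ω s) c
      = ((s - 1 : ℝ) : ℂ) * trace (c * spectralWeight L ^ s) := fun s hs c => (hΩ s hs).1 c
  have hlim : ∀ {c : h →L[ℂ] h} {z : ℂ}, Tendsto (fun s : ℝ => ((s - 1 : ℝ) : ℂ) *
      trace (c * spectralWeight L ^ s)) (𝓝[>] 1) (𝓝 z) → ∀ τ : WeakDual ℂ (h →L[ℂ] h),
      MapClusterPt τ (𝓝[>] 1) (fun s => StrongDual.toWeakDual (Ω s)) → τ c = z := by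
    intro c z hz τ hτ
    refine eq_of_mapClusterPt_of_tendsto hτ (hz.congr' ?_)
    filter_upwards [self_mem_nhdsWithin] with s (hs : 1 < s)
    exact (hval s hs c).symm
  refine ⟨fun s => StrongDual.toWeakDual (Ω s), hval, ?_, fun τ hτ => ⟨⟨?_, fun T hT => ?_⟩,
    fun T hT => hlim (hb.tendsto_trace_compact_mul hL hT) τ hτ,
    isHypertraceOn_of_commutator fun a ha c =>
      hlim (hb.tendsto_trace_commutator_mul hL hg ha c) τ hτ⟩⟩
  · have hev : ∀ᶠ s in 𝓝[>] (1 : ℝ), StrongDual.toWeakDual (Ω s)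
        ∈ WeakDual.toStrongDual ⁻¹' Metric.closedBall (0 : StrongDual ℂ (h →L[ℂ] h)) 2 := by
      filter_upwards [self_mem_nhdsWithin,
        (hb.tendsto_sub_mul_tsum_weight hL hg).eventually_le_const (by norm_num : (1 : ℝ) < 2)]
        with s (hs : 1 < s) h2
      exact mem_closedBall_zero_iff.2 ((hΩ s hs).2.trans h2)
    obtain ⟨τ, -, hτ⟩ := (WeakDual.isCompact_closedBall (0 : StrongDual ℂ (h →L[ℂ] h))
      2).exists_mapClusterPt_of_frequently hev.frequently
    exact ⟨τ, hτ⟩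
  · refine hlim (c := 1) ?_ τ hτ
    simp only [one_mul]
    exact hb.tendsto_trace_rpow hL hg
  · have h1 := hτ.continuousAt_comp (WeakDual.eval_continuous T).continuousAt
    have hcl : IsClosed {z : ℂ | 0 ≤ z.re ∧ z.im = 0} :=
      (isClosed_le continuous_const Complex.continuous_re).inter
        (isClosed_eq Complex.continuous_im continuous_const)
    refine hcl.mem_of_mapClusterPt h1 ?_
    filter_upwards [self_mem_nhdsWithin] with s (hs : 1 < s)
    change 0 ≤ (StrongDual.toWeakDual (Ω s) T).re ∧ (StrongDual.toWeakDual (Ω s) T).im = 0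
    rw [hval s hs T]
    exact hb.zetaForm_nonneg hL hs hT

/-! ### Generalized limits of complex logarithmic means -/

/-- The generalized limit of the logarithmic means of a complex sequence. -/
noncomputable def logMeanLim (ω : LInfty →L[ℝ] ℝ) (z : ℕ → ℂ) : ℂ :=
  (omegaLim ω (logMeanSeq fun n => (z n).re) : ℂ)
    + Complex.I * (omegaLim ω (logMeanSeq fun n => (z n).im) : ℂ)

theorem logMeanSeq_add (u v : ℕ → ℝ) :
    logMeanSeq (fun n => u n + v n) = fun N => logMeanSeq u N + logMeanSeq v N := by
  funext N
  simp only [logMeanSeq, Finset.sum_add_distrib, mul_add]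

section LogMeanLim

variable {ω : LInfty →L[ℝ] ℝ} {z w : ℕ → ℂ} {C D : ℝ}

theorem abs_logMeanSeq_re_le (hD : 0 ≤ D) (hz : ∀ n, ‖z n‖ ≤ D / ((n : ℝ) + 1)) (N : ℕ) :
    |logMeanSeq (fun n => (z n).re) N| ≤ 3 * D :=
  abs_logMeanSeq_le hD (fun n => (Complex.abs_re_le_norm _).trans (hz n)) N

theorem abs_logMeanSeq_im_le (hD : 0 ≤ D) (hz : ∀ n, ‖z n‖ ≤ D / ((n : ℝ) + 1)) (N : ℕ) :
    |logMeanSeq (fun n => (z n).im) N| ≤ 3 * D :=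
  abs_logMeanSeq_le hD (fun n => (Complex.abs_im_le_norm _).trans (hz n)) N

theorem logMeanLim_add (hC : 0 ≤ C) (hD : 0 ≤ D) (hz : ∀ n, ‖z n‖ ≤ C / ((n : ℝ) + 1))
    (hw : ∀ n, ‖w n‖ ≤ D / ((n : ℝ) + 1)) :
    logMeanLim ω (fun n => z n + w n) = logMeanLim ω z + logMeanLim ω w := by
  simp only [logMeanLim, Complex.add_re, Complex.add_im, logMeanSeq_add]
  rw [omegaLim_add ω (abs_logMeanSeq_re_le hC hz) (abs_logMeanSeq_re_le hD hw),
    omegaLim_add ω (abs_logMeanSeq_im_le hC hz) (abs_logMeanSeq_im_le hD hw)]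
  push_cast
  ring

theorem logMeanLim_const_mul (hC : 0 ≤ C) (hz : ∀ n, ‖z n‖ ≤ C / ((n : ℝ) + 1)) (c : ℂ) :
    logMeanLim ω (fun n => c * z n) = c * logMeanLim ω z := by
  have hre := abs_logMeanSeq_re_le hC hz
  have him := abs_logMeanSeq_im_le hC hz
  have hmul : ∀ (r : ℝ) {u : ℕ → ℝ}, (∀ N, |logMeanSeq u N| ≤ 3 * C) →
      ∀ N, |r * logMeanSeq u N| ≤ |r| * (3 * C) := fun r u hu N => by
    rw [abs_mul]
    exact mul_le_mul_of_nonneg_left (hu N) (abs_nonneg r)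
  have h1 : (logMeanSeq fun n => (c * z n).re)
      = fun N => c.re * logMeanSeq (fun n => (z n).re) N
        - c.im * logMeanSeq (fun n => (z n).im) N := by
    funext N
    simp only [logMeanSeq, Complex.mul_re, Finset.sum_sub_distrib, ← Finset.mul_sum]
    ring
  have h2 : (logMeanSeq fun n => (c * z n).im)
      = fun N => c.re * logMeanSeq (fun n => (z n).im) N
        + c.im * logMeanSeq (fun n => (z n).re) N := by
    funext N
    simp only [logMeanSeq, Complex.mul_im, Finset.sum_add_distrib, ← Finset.mul_sum]
    ring
  rw [logMeanLim, h1, h2, omegaLim_sub ω (hmul c.re hre) (hmul c.im him),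
    omegaLim_add ω (hmul c.re him) (hmul c.im hre), omegaLim_const_mul ω hre,
    omegaLim_const_mul ω him, omegaLim_const_mul ω hre, omegaLim_const_mul ω him, logMeanLim]
  apply Complex.ext <;> simp

theorem norm_logMeanLim_le (hC : 0 ≤ C) (hz : ∀ n, ‖z n‖ ≤ C / ((n : ℝ) + 1)) :
    ‖logMeanLim ω z‖ ≤ 6 * ‖ω‖ * C := by
  refine (norm_add_le _ _).trans ?_
  rw [norm_mul, Complex.norm_I, one_mul, Complex.norm_real, Complex.norm_real]
  have h1 := abs_omegaLim_le ω (abs_logMeanSeq_re_le hC hz)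
  have h2 := abs_omegaLim_le ω (abs_logMeanSeq_im_le hC hz)
  rw [Real.norm_eq_abs, Real.norm_eq_abs]
  linarith

theorem logMeanLim_of_tendsto (hω : IsDixmierState ω) (hC : 0 ≤ C)
    (hz : ∀ n, ‖z n‖ ≤ C / ((n : ℝ) + 1)) {c : ℂ}
    (hc : Tendsto (fun N : ℕ => (((Real.log N)⁻¹ : ℝ) : ℂ) * ∑ n ∈ Finset.range N, z n)
      atTop (𝓝 c)) : logMeanLim ω z = c := by
  have h1 : Tendsto (logMeanSeq fun n => (z n).re) atTop (𝓝 c.re) := by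
    refine ((Complex.continuous_re.tendsto c).comp hc).congr fun N => ?_
    rw [Function.comp_apply, Complex.re_ofReal_mul, Complex.re_sum, logMeanSeq]
  have h2 : Tendsto (logMeanSeq fun n => (z n).im) atTop (𝓝 c.im) := by
    refine ((Complex.continuous_im.tendsto c).comp hc).congr fun N => ?_
    rw [Function.comp_apply, Complex.im_ofReal_mul, Complex.im_sum, logMeanSeq]
  rw [logMeanLim, omegaLim_of_tendsto hω (abs_logMeanSeq_re_le hC hz) h1,
    omegaLim_of_tendsto hω (abs_logMeanSeq_im_le hC hz) h2, mul_comm, Complex.re_add_im]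

theorem logMeanLim_nonneg (hω : IsDixmierState ω) (hC : 0 ≤ C)
    (hz : ∀ n, ‖z n‖ ≤ C / ((n : ℝ) + 1)) (h0 : ∀ n, 0 ≤ (z n).re ∧ (z n).im = 0) :
    0 ≤ (logMeanLim ω z).re ∧ (logMeanLim ω z).im = 0 := by
  have h1 : omegaLim ω (logMeanSeq fun n => (z n).im) = 0 := by
    refine omegaLim_of_tendsto hω (abs_logMeanSeq_im_le hC hz) (tendsto_const_nhds.congr fun N => ?_)
    simp [logMeanSeq, h0]
  rw [logMeanLim, h1]
  simp only [Complex.ofReal_zero, mul_zero, add_zero, Complex.ofReal_re, Complex.ofReal_im,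
    and_true]
  exact omegaLim_nonneg hω (abs_logMeanSeq_re_le hC hz) fun N => mul_nonneg
    (inv_nonneg.2 (Real.log_natCast_nonneg N)) (Finset.sum_nonneg fun n _ => (h0 n).1)

end LogMeanLim

/-! ### The volume forms -/

theorem inner_realPart_imaginaryPart (A : h →L[ℂ] h) (v : h) :
    (⟪v, (realPart A : h →L[ℂ] h) v⟫_ℂ).re = (⟪v, A v⟫_ℂ).re ∧
      (⟪v, (imaginaryPart A : h →L[ℂ] h) v⟫_ℂ).re = (⟪v, A v⟫_ℂ).im := by
  have him : ∀ X : selfAdjoint (h →L[ℂ] h), (⟪v, (X : h →L[ℂ] h) v⟫_ℂ).im = 0 := fun X => by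
    have hX : star (X : h →L[ℂ] h) = X := X.2
    have h1 : (starRingEnd ℂ) ⟪v, (X : h →L[ℂ] h) v⟫_ℂ = ⟪v, (X : h →L[ℂ] h) v⟫_ℂ := by
      rw [inner_conj_symm]
      conv_lhs => rw [← hX]
      rw [ContinuousLinearMap.star_eq_adjoint, ContinuousLinearMap.adjoint_inner_left]
    exact Complex.conj_eq_iff_im.1 h1
  have h2 : ⟪v, A v⟫_ℂ = ⟪v, (realPart A : h →L[ℂ] h) v⟫_ℂ
      + Complex.I * ⟪v, (imaginaryPart A : h →L[ℂ] h) v⟫_ℂ := by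
    rw [← inner_smul_right, ← inner_add_right, ← smul_apply, ← add_apply,
      realPart_add_I_smul_imaginaryPart]
  rw [h2]
  constructor
  · simp [him]
  · simp [him]

theorem isCompactOperator_realPart_imaginaryPart {A : h →L[ℂ] h} (hA : IsCompactOperator A)
    (hA' : IsCompactOperator ⇑(star A)) : IsCompactOperator (realPart A : h →L[ℂ] h) ∧
      IsCompactOperator (imaginaryPart A : h →L[ℂ] h) := by
  rw [realPart_apply_coe, imaginaryPart_apply_coe]
  exact ⟨(hA.add hA').smul (2⁻¹ : ℝ), ((hA.sub hA').smul (2⁻¹ : ℝ)).smul (-Complex.I)⟩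

theorem IsEigenbasis.norm_inner_mul_spectralWeight_le (hb : IsEigenbasis L b lam)
    (hL : IsSelfAdjoint L) (T : h →L[ℂ] h) (N : ℕ) (v : h)
    (hv : ∀ n < N, ⟪b (Sum.inl n), v⟫_ℂ = 0) :
    ‖⟪v, (T * spectralWeight L) v⟫_ℂ‖ ≤ ‖T‖ / ((N : ℝ) + 1) * ‖v‖ ^ 2 := by
  have h1 : ‖spectralWeight L v‖ ≤ ((N : ℝ) + 1)⁻¹ * ‖v‖ :=
    (hb.norm_spectralWeight_apply_le hL N v hv).trans
      (mul_le_mul_of_nonneg_right (hb.weight_le hL N) (norm_nonneg v))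
  calc _ ≤ ‖v‖ * ‖T (spectralWeight L v)‖ := norm_inner_le_norm _ _
    _ ≤ ‖v‖ * (‖T‖ * (((N : ℝ) + 1)⁻¹ * ‖v‖)) := by
        gcongr
        exact (T.le_opNorm _).trans (mul_le_mul_of_nonneg_left h1 (norm_nonneg T))
    _ = _ := by rw [div_eq_mul_inv]; ring

variable (L b lam) in
/-- The diagonal values of `T ρ(L)`. -/
noncomputable def diagValue (T : h →L[ℂ] h) (n : ℕ) : ℂ :=
  (weight L lam (Sum.inl n) : ℂ) * ⟪b (Sum.inl n), T (b (Sum.inl n))⟫_ℂ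

theorem IsEigenbasis.norm_diagValue_le (hb : IsEigenbasis L b lam) (hL : IsSelfAdjoint L)
    (T : h →L[ℂ] h) (n : ℕ) : ‖diagValue L b lam T n‖ ≤ ‖T‖ / ((n : ℝ) + 1) := by
  rw [diagValue, norm_mul, Complex.norm_real, Real.norm_of_nonneg (weight_nonneg _), mul_comm,
    div_eq_mul_inv]
  exact mul_le_mul (norm_inner_basis_le b T _) (hb.weight_le hL n) (weight_nonneg _) (norm_nonneg T)

/-- The comparison of eigenvalue sums with diagonal sums is applied to the real and imaginary parts
of `Tρ(L)`, both with `f_n = b_n`. Off the first `N` vectors `ρ(L)` is at most `1/(N+1)`, which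
supplies the required decay of the quadratic forms. -/
theorem IsEigenbasis.volumeForm_eq (hb : IsEigenbasis L b lam) (hL : IsSelfAdjoint L)
    (hinf : ¬ FiniteDimensional ℂ h) {ω : LInfty →L[ℝ] ℝ} (hω : IsDixmierState ω) (T : h →L[ℂ] h) :
    volumeForm L ω T = logMeanLim ω (diagValue L b lam T) := by
  set A := T * spectralWeight L with hA
  have hρ := hb.isCompactOperator_spectralWeight hL
  have hρsa : IsSelfAdjoint (spectralWeight L) :=
    IsSelfAdjoint.of_nonneg (hb.spectralWeight_nonneg hL)
  have hAc : IsCompactOperator A := hρ.clm_comp T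
  have hAc' : IsCompactOperator ⇑(star A) := by
    rw [hA, star_mul, hρsa.star_eq]
    exact hρ.comp_clm (star T)
  obtain ⟨hre, him⟩ := isCompactOperator_realPart_imaginaryPart hAc hAc'
  have hf : Orthonormal ℂ fun n : ℕ => b (Sum.inl n) := b.orthonormal.comp _ Sum.inl_injective
  have hdiag : ∀ n, ⟪b (Sum.inl n), A (b (Sum.inl n))⟫_ℂ = diagValue L b lam T n := fun n => by
    rw [hA, mul_apply_eq_comp, hb.spectralWeight_apply hL, map_smul, inner_smul_right, diagValue]
  have hbd := fun N v hv => hb.norm_inner_mul_spectralWeight_le hL T N v hv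
  have h1 := dixmierTracePos_sub_eq hinf hω (realPart A).2 hre hf (norm_nonneg T) fun N v hv => by
    rw [(inner_realPart_imaginaryPart A v).1]
    exact (Complex.abs_re_le_norm _).trans (hbd N v hv)
  have h2 := dixmierTracePos_sub_eq hinf hω (imaginaryPart A).2 him hf (norm_nonneg T)
    fun N v hv => by
      rw [(inner_realPart_imaginaryPart A v).2]
      exact (Complex.abs_im_le_norm _).trans (hbd N v hv)
  simp only [(inner_realPart_imaginaryPart A _).1, hdiag] at h1
  simp only [(inner_realPart_imaginaryPart A _).2, hdiag] at h2
  rw [volumeForm, dixmierTrace, ← hA, h1, h2, logMeanLim]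

/-- Linearity is not apparent from the definition through positive and negative parts; it is read
off the diagonal formula, as are positivity, the normalization from `(n+1) w_n → 1`, and vanishing
on commutators. -/
theorem IsEigenbasis.exists_volumeForm (hb : IsEigenbasis L b lam) (hL : IsSelfAdjoint L)
    (hg : HasSlowGrowth L) (hinf : ¬ FiniteDimensional ℂ h) {ω : LInfty →L[ℝ] ℝ}
    (hω : IsDixmierState ω) :
    ∃ τ : WeakDual ℂ (h →L[ℂ] h), (∀ T : h →L[ℂ] h, τ T = volumeForm L ω T) ∧
      IsState τ ∧ IsHypertraceOn (lipschitzAlgebra L hL) τ := by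
  have hbd := hb.norm_diagValue_le hL
  let f : (h →L[ℂ] h) →ₗ[ℂ] ℂ :=
    { toFun := fun T => logMeanLim ω (diagValue L b lam T)
      map_add' := fun S T => by
        rw [← logMeanLim_add (norm_nonneg S) (norm_nonneg T) (hbd S) (hbd T)]
        congr 1
        funext n
        simp only [diagValue, add_apply, inner_add_right, mul_add]
      map_smul' := fun r T => by
        rw [RingHom.id_apply, smul_eq_mul, ← logMeanLim_const_mul (norm_nonneg T) (hbd T)]
        congr 1
        funext n
        simp only [diagValue, smul_apply, inner_smul_right, mul_left_comm] }
  have hf : ∀ T, ‖f T‖ ≤ 6 * ‖ω‖ * ‖T‖ := fun T => norm_logMeanLim_le (norm_nonneg T) (hbd T)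
  refine ⟨StrongDual.toWeakDual (f.mkContinuous _ hf),
    fun T => (hb.volumeForm_eq hL hinf hω T).symm, ⟨?_, fun T hT => ?_⟩,
    isHypertraceOn_of_commutator fun a ha c => ?_⟩
  · refine logMeanLim_of_tendsto hω (norm_nonneg (1 : h →L[ℂ] h)) (hbd 1) ?_
    have h1 := (Complex.continuous_ofReal.tendsto 1).comp
      (tendsto_logMeanSeq (hb.tendsto_mul_weight hL hg))
    rw [Complex.ofReal_one] at h1
    refine h1.congr fun N => ?_
    rw [Function.comp_apply, logMeanSeq, Complex.ofReal_mul, Complex.ofReal_sum]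
    congr 1
    refine Finset.sum_congr rfl fun n _ => ?_
    rw [diagValue, one_apply_eq_self, inner_self_eq_norm_sq_to_K, b.orthonormal.1]
    simp
  · refine logMeanLim_nonneg hω (norm_nonneg T) (hbd T) fun n => ?_
    rw [diagValue, Complex.re_ofReal_mul, Complex.im_ofReal_mul, (isPositive_inner hT _).2, mul_zero]
    exact ⟨mul_nonneg (weight_nonneg _) (isPositive_inner hT _).1, rfl⟩
  · exact logMeanLim_of_tendsto hω (norm_nonneg _) (hbd _)
      (hb.tendsto_log_mean_commutator hL hg ha c)

end

end VolumeTrace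

/-! ### Assembly of the theorem -/

theorem corollary6p2 {h : Type*} [NormedAddCommGroup h] [InnerProductSpace ℂ h] [CompleteSpace h]
    (L : h →ₗ.[ℂ] h) (hL : IsDiscreteOffKernel L)
    (φ : ℝ → ℝ) (hφ_nonneg : ∀ x, 0 ≤ x → 0 ≤ φ x)
    (hφ_cont : ContinuousOn φ (Ici 0)) (hφ_mono : MonotoneOn φ (Ici 0))
    -- `φ' ∈ L^∞_loc`
    (hφ_lip : LocallyLipschitzOn (Ioi 0) φ)
    -- `ess-limsup φ' / φ = 0` at `+∞`
    (hφ_log : limsup (fun x : ℝ => ((deriv φ x / φ x : ℝ) : EReal)) (atTop ⊓ ae volume) = 0)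
    -- `N_L ∼ φ` at `+∞`
    (hN : Asymptotics.IsEquivalent atTop (fun x : ℝ => (counting L x : ℝ)) φ) :
    -- (1.a)
    (∀ s : ℝ, 1 < s → IsTraceClass (spectralWeight L ^ s)) ∧
    Tendsto (fun s : ℝ => ((s - 1 : ℝ) : ℂ) * trace (spectralWeight L ^ s)) (𝓝[>] 1) (𝓝 1) ∧
    -- (1.b)
    (∀ a ∈ lipschitzAlgebra L hL.selfAdjoint,
      (∀ s : ℝ, 1 < s → IsTraceClass (a * spectralWeight L ^ s - spectralWeight L ^ s * a)) ∧
      Tendsto (fun s : ℝ => ((s - 1 : ℝ) : ℂ) *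
          trace (CFC.abs (a * spectralWeight L ^ s - spectralWeight L ^ s * a)))
        (𝓝[>] 1) (𝓝 0)) ∧
    -- (1.c)
    (∀ (b : h →L[ℂ] h) (s : ℝ), 1 < s → IsTraceClass (b * spectralWeight L ^ s)) ∧
    (∀ a ∈ lipschitzAlgebra L hL.selfAdjoint, ∀ b : h →L[ℂ] h,
      Tendsto (fun s : ℝ => ((s - 1 : ℝ) : ℂ) * trace ((a * b - b * a) * spectralWeight L ^ s))
        (𝓝[>] 1) (𝓝 0)) ∧
    -- (2) the bounded linear forms `ω_s`, `s > 1`, and their weak-* limit points as `s ↓ 1`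
    (∃ Ω : ℝ → WeakDual ℂ (h →L[ℂ] h),
      (∀ s : ℝ, 1 < s → ∀ b : h →L[ℂ] h,
        Ω s b = ((s - 1 : ℝ) : ℂ) * trace (b * spectralWeight L ^ s)) ∧
      (∃ τ : WeakDual ℂ (h →L[ℂ] h), MapClusterPt τ (𝓝[>] 1) Ω) ∧
      ∀ τ : WeakDual ℂ (h →L[ℂ] h), MapClusterPt τ (𝓝[>] 1) Ω →
        IsState τ ∧
        (∀ T : h →L[ℂ] h, IsCompactOperator T → τ T = 0) ∧
        IsHypertraceOn (lipschitzAlgebra L hL.selfAdjoint).topologicalClosure τ ∧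
        IsTracialStateOn (lipschitzAlgebra L hL.selfAdjoint).topologicalClosure τ) ∧
    -- (3) the volume forms
    (∀ T : h →L[ℂ] h, InMacaev (T * spectralWeight L)) ∧
    (∀ ω : LInfty →L[ℝ] ℝ, IsDixmierState ω →
      ∃ τ : WeakDual ℂ (h →L[ℂ] h), (∀ T : h →L[ℂ] h, τ T = volumeForm L ω T) ∧
        IsState τ ∧
        IsHypertraceOn (lipschitzAlgebra L hL.selfAdjoint).topologicalClosure τ ∧
        IsTracialStateOn (lipschitzAlgebra L hL.selfAdjoint).topologicalClosure τ) := by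
  obtain ⟨s, b, lam, hb⟩ := exists_isEigenbasis hL
  have hsa := hL.selfAdjoint
  have hinf := not_finiteDimensional hL
  -- The comparison function `φ` serves only to give this property of `N_L`; everything asymptotic
  -- below is derived from it.
  have hg : HasSlowGrowth L := fun W η hW hη =>
    eventually_apply_add_le hφ_mono hφ_lip hφ_log hN (hb.tendsto_counting hsa) hW hη
  refine ⟨fun s hs => ?_, hb.tendsto_trace_rpow hsa hg, fun a ha =>
    ⟨fun s hs => hb.isTraceClass_commutator hsa a hs, hb.tendsto_trace_abs_commutator hsa hg ha⟩,
    fun c s hs => hb.isTraceClass_mul_rpow hsa c hs,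
    fun a ha c => hb.tendsto_trace_commutator_mul hsa hg ha c, ?_, hb.inMacaev hsa,
    fun ω hω => ?_⟩
  · have h1 := hb.isTraceClass_mul_rpow hsa 1 hs
    rwa [one_mul] at h1
  · obtain ⟨Ω, hΩ, hex, hall⟩ := hb.exists_zetaForms hsa hg
    refine ⟨Ω, hΩ, hex, fun τ hτ => ?_⟩
    obtain ⟨h1, h2, h3⟩ := hall τ hτ
    exact ⟨h1, h2, h3.topologicalClosure, h3.topologicalClosure.isTracialStateOn h1⟩
  · obtain ⟨τ, h1, h2, h3⟩ := hb.exists_volumeForm hsa hg hinf hω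
    exact ⟨τ, h1, h2, h3.topologicalClosure, h3.topologicalClosure.isTracialStateOn h2⟩
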